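/- All trees are finite, rooted and non-plane (considered up to isomorphism), and a tree is regarded as a poset whose maximum is the root ($x\le y$ iff $y$ lies on the path from the root to $x$). A binary tree is a tree in which every vertex has $0$ or $2$ children, and $\mathcal V_n$ is the set of all non-plane binary trees with $n$ vertices. For trees $S$ and $T$ let $a_T(S)$ be the number of embeddings of $S$ into $T$, i.e. of subposets of $T$ isomorphic to $S$, where two subposets that are mapped onto each other by an automorphism of $T$ are counted once, and let $a_{\mathcal V_n}(S)=\sum_{T\in\mathcal V_n}a_T(S)$. Let $V(z)=\sum_n|\mathcal V_n|z^n$ and $A_S(z)=\sum_n a_{\mathcal V_n}(S)z^n$. For a tree $S$, let $\mathcal M_S$ be the set of all unary-binary trees obtained from $S$ by replacing every vertex $v$ with $d\ge 3$ children, together with these children, by a non-plane binary tree with $d$ leaves whose root is $v$ and whose leaves are the children of $v$; its other $d-2$ internal vertices are called auxiliary, the vertices coming from $S$ are called original, and elements of $\mathcal M_S$ are taken up to isomorphisms that respect the distinction between original and auxiliary vertices. A symmetry node of $t\in\mathcal M_S$ is a vertex whose two children are the roots of isomorphic subtrees (again with the distinction respected), and $s(t)$ is the number of symmetry nodes of $t$.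 Put $$C_S=\sum_{t\in\mathcal M_S}\left(\tfrac12\right)^{s(t)}.$$ Theorem. The function $V$ satisfies $V(z)=z+\frac z2\left(V(z)^2+V(z^2)\right)$ for $|z|<\rho$, where $\rho\approx 0.6346$ (to the four digits given) is its radius of convergence. There is an $R>\rho$ such that $V$ and, for every tree $S$, the function $A_S$ are sums of their power series for $|z|<\rho$, continue analytically to the slit disc $$\Omega=\{z\in\mathbb C: |z|<R\}\setminus\left((-\infty,-\rho]\cup[\rho,\infty)\right),$$ and are singular at both $\rho$ and $-\rho$, so that $\pm\rho$ are the dominant singularities of $V$ and of $A_S$. If $S$ has $m$ vertices, $l$ leaves and $u$ vertices with exactly one child, then $$A_S(z)=\left(\frac1{1-zV(z)}\right)^{m+l-1}z^{l+u-1}\,V(z)^{l+u}\,C_S\,(1+o(1))$$ as $z\to\rho$ and as $z\to-\rho$ in $\Omega$. -/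

import Mathlib

open scoped Topology

/-- Finite rooted trees: a root together with finitely many subtrees. The list of subtrees is only
a way of writing the tree down: all notions below are formulated through the poset of vertices and
up to order isomorphism, so that the trees are considered as non-plane trees. -/
inductive FinRootedTree : Type
  | node (k : ℕ) (child : Fin k → FinRootedTree) : FinRootedTree

namespace FinRootedTree

/-- The vertices of a tree: the root `⊤` and the vertices of the subtrees of the root. -/
def Vertex : FinRootedTree → Type
  | node _ child => WithTop (Σ i, (child i).Vertex)

/-- The poset of vertices: `x ≤ y` iff `y` is on the path from the root to `x`. The vertices of
different subtrees of the root are incomparable, and the root is the maximum. -/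
instance instPartialOrderVertex : (T : FinRootedTree) → PartialOrder T.Vertex
  | node _ child =>
    letI := fun i => instPartialOrderVertex (child i)
    inferInstanceAs (PartialOrder (WithTop (Σ i, (child i).Vertex)))

/-- The root of a tree is the maximum of its poset of vertices. -/
instance instOrderTopVertex : (T : FinRootedTree) → OrderTop T.Vertex
  | node _ child => inferInstanceAs (OrderTop (WithTop (Σ i, (child i).Vertex)))

/-- The number of vertices. -/
noncomputable def size (T : FinRootedTree) : ℕ := Nat.card T.Vertex

/-- The out-degree (number of children) of an element of a poset. -/
noncomputable def outDegree {P : Type*} [PartialOrder P] (x : P) : ℕ :=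
  {y : P | y ⋖ x}.ncard

/-- The number of vertices of out-degree `i`. -/
noncomputable def degreeCount (T : FinRootedTree) (i : ℕ) : ℕ :=
  {x : T.Vertex | outDegree x = i}.ncard

/-- A binary tree: every vertex has `0` or `2` children. -/
def IsBinary (T : FinRootedTree) : Prop :=
  ∀ x : T.Vertex, outDegree x = 0 ∨ outDegree x = 2

/-- Isomorphism of the non-plane binary trees with `n` vertices. -/
instance binarySetoid (n : ℕ) : Setoid {T : FinRootedTree // T.IsBinary ∧ T.size = n} where
  r T T' := Nonempty (T.1.Vertex ≃o T'.1.Vertex)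
  iseqv :=
    ⟨fun _ => ⟨OrderIso.refl _⟩, fun ⟨e⟩ => ⟨e.symm⟩, fun ⟨e⟩ ⟨f⟩ => ⟨e.trans f⟩⟩

/-- The family `𝓥ₙ` of non-plane binary trees with `n` vertices. -/
def NonplaneBinary (n : ℕ) : Type := Quotient (binarySetoid n)

/-- A representative of a non-plane binary tree. -/
noncomputable def NonplaneBinary.tree {n : ℕ} (T : NonplaneBinary n) : FinRootedTree :=
  (Quotient.out T).1

/-- Two subposets of `T` isomorphic to `S` are the same embedding of `S` into the non-plane
tree `T` iff an automorphism of `T` maps one onto the other. -/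
instance embeddingSetoid (S T : FinRootedTree) :
    Setoid {E : Set T.Vertex // Nonempty (E ≃o S.Vertex)} where
  r E E' := ∃ φ : T.Vertex ≃o T.Vertex, φ '' E.1 = E'.1
  iseqv := by
    refine ⟨fun E => ⟨OrderIso.refl _, by simp⟩, ?_, ?_⟩
    · rintro E E' ⟨φ, h⟩
      exact ⟨φ.symm, by rw [← h, Set.image_image]; simp⟩
    · rintro E E' E'' ⟨φ, h⟩ ⟨ψ, h'⟩
      exact ⟨φ.trans ψ, by rw [← h', ← h, Set.image_image]; rfl⟩

/-- `a_T(S)`: the number of embeddings of `S` into the non-plane tree `T`. -/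
noncomputable def numEmbeddings (S T : FinRootedTree) : ℕ :=
  Nat.card (Quotient (embeddingSetoid S T))

/-- `a_{𝓥ₙ}(S)`: the number of embeddings of `S` into all non-plane binary trees with `n`
vertices. -/
noncomputable def totalEmbeddings (S : FinRootedTree) (n : ℕ) : ℕ :=
  ∑ᶠ T : NonplaneBinary n, numEmbeddings S T.tree

/-- A tree with a distinguished set of vertices, the *original* vertices; the other vertices are
called *auxiliary*. -/
structure MarkedTree where
  /-- the underlying tree -/
  tree : FinRootedTree
  /-- the set of original vertices -/
  original : Set tree.Vertex

/-- `t` arises from `S` by replacing each vertex `v` with `d ≥ 3` children, together with these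
children, by a binary tree with `d` leaves: the root of that binary tree is `v`, its leaves are the
children of `v`, and its `d - 2` other internal vertices are auxiliary. In terms of posets: the
original vertices form a copy of `S` and include the root of `t`, auxiliary vertices have two
children, and an original vertex with `d` children in `S` has `min 2 d` children in `t`. -/
def IsBinarization (S : FinRootedTree) (t : MarkedTree) : Prop :=
  ⊤ ∈ t.original ∧
  Nonempty (t.original ≃o S.Vertex) ∧
  (∀ x : t.tree.Vertex, x ∉ t.original → outDegree x = 2) ∧
  ∀ x : t.original, outDegree (x : t.tree.Vertex) = min 2 (outDegree x)

/-- Isomorphism of the binarizations of `S`; isomorphisms send original vertices to original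
vertices and auxiliary vertices to auxiliary vertices. -/
instance binarizationSetoid (S : FinRootedTree) : Setoid {t : MarkedTree // S.IsBinarization t} where
  r t t' := ∃ φ : t.1.tree.Vertex ≃o t'.1.tree.Vertex, φ '' t.1.original = t'.1.original
  iseqv := by
    refine ⟨fun t => ⟨OrderIso.refl _, by simp⟩, ?_, ?_⟩
    · rintro t t' ⟨φ, h⟩
      exact ⟨φ.symm, by rw [← h, Set.image_image]; simp⟩
    · rintro t t' t'' ⟨φ, h⟩ ⟨ψ, h'⟩
      exact ⟨φ.trans ψ, by rw [← h', ← h, Set.image_image]; rfl⟩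

/-- The set `𝓜_S` of non-plane unary-binary trees obtained from `S`. -/
def Binarization (S : FinRootedTree) : Type := Quotient (binarizationSetoid S)

/-- The number of symmetry nodes of `t`, i.e. of vertices with two children that are the roots of
isomorphic subtrees (where isomorphisms respect the distinction of original and auxiliary
vertices). -/
noncomputable def MarkedTree.numSymmetryNodes (t : MarkedTree) : ℕ :=
  {x : t.tree.Vertex | ∃ y y' : t.tree.Vertex, y ⋖ x ∧ y' ⋖ x ∧ y ≠ y' ∧
    ∃ φ : Set.Iic y ≃o Set.Iic y',
      ∀ a : Set.Iic y, (φ a : t.tree.Vertex) ∈ t.original ↔ (a : t.tree.Vertex) ∈ t.original}.ncard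

/-- The constant `C_S`: the sum of `(1/2) ^ s` over the trees of `𝓜_S`, with `s` the number of
symmetry nodes. -/
noncomputable def symmetryConstant (S : FinRootedTree) : ℝ :=
  ∑ᶠ t : S.Binarization, (1 / 2 : ℝ) ^ (Quotient.out t).1.numSymmetryNodes

end FinRootedTree

/-- The open disc of radius `R` around `0` without the two real half-lines `[ρ, ∞)` and
`(-∞, -ρ]`. -/
def slitDisc (ρ R : ℝ) : Set ℂ := {z | ‖z‖ < R ∧ ¬ (z.im = 0 ∧ ρ ≤ |z.re|)}

/-- `F` is the generating function of the sequence `c`, and `ρ` and `-ρ` are its dominant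
singularities: `F` is the sum of `∑ cₙ zⁿ` for `‖z‖ < ρ`, continued analytically to a disc of
radius `R > ρ` with the two slits from `±ρ` outwards, and at none of the two points `±ρ` it
coincides with a function that is analytic there. -/
def HasDominantSingularities (c : ℕ → ℕ) (F : ℂ → ℂ) (ρ R : ℝ) : Prop :=
  0 < ρ ∧ ρ < R ∧
  (∀ z : ℂ, ‖z‖ < ρ → HasSum (fun n => (c n : ℂ) * z ^ n) (F z)) ∧
  DifferentiableOn ℂ F (slitDisc ρ R) ∧
  (¬ ∃ g : ℂ → ℂ, AnalyticAt ℂ g (ρ : ℂ) ∧ F =ᶠ[𝓝[slitDisc ρ R] (ρ : ℂ)] g) ∧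
  (¬ ∃ g : ℂ → ℂ, AnalyticAt ℂ g (-ρ : ℂ) ∧ F =ᶠ[𝓝[slitDisc ρ R] (-ρ : ℂ)] g)

/-! An embedding of S into a non-plane tree, taken up to automorphisms, is an isomorphism class of
trees with marked vertices (`TreeClass`) whose marked poset is isomorphic to S. Removing the root of
a marked tree leaves disjoint unions as well as trees, so a series `gen F` is attached to every
isomorphism class F of finite posets; `gen 0` is V.

The root of a binary tree with marked poset F carries an unordered pair of marked trees whose marked
posets add up to F, or to F without its maximum if the root is marked. When nothing marked is lost
at the root, the trivial decompositions F = 0 + F = F + 0 contribute zV·A_F; moved to the left they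
produce the factor 1 - zV. So (1 - zV)A_F equals V if F is a point; zV·A_G if F is G with a top
added and G itself has a top; A_G if G is nonempty without a top; and, if F is nonempty without a
top, (z/2)·Σ(A_G(z)A_H(z) + [G = H]A_G(z²)) over all ordered decompositions F = G + H with G, H
nonzero. The constants C_F satisfy the same recursion without z, V and the diagonal terms: the
weight 1/2 of a symmetry node turns a sum over unordered pairs into half the sum over ordered pairs.

Completing the square in the equation of V gives (1 - zV(z))² = δ(z²) with δ(z) = 1 - 2z - zV(z)
(`one_sub_mul_gen_sq`). On [0, 1/2] the function δ is strictly decreasing with a simple zero x₀, and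
ρ = √x₀. For a suitable R > ρ the values δ(z²) stay off the cut of the square root on the slit disc,
which continues V; as δ is evaluated at z², both ρ and -ρ are square-root branch points, where zV →
1.

Dividing by 1 - zV continues every A_F, since R² < ρ makes the terms A_G(z²) harmless. By induction
A_F·(1 - zV)^(card + leaves - 1) tends to C_F/w at w = ±ρ (`exists_isGenContinuation`): a new top
costs one factor, and the exponents of two parts add up to one less than that of their union, the
missing factor being the division. The terms A_G(z²) are killed by a positive power of 1 - zV. As
z^(l+u-1)V^(l+u) also tends to 1/w, this is the asserted equivalence, and C_S > 0 makes ±ρ singular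
for A_S. -/

open FinRootedTree

/-! ### Out-degrees and extremal elements in disjoint unions and under an adjoined top -/

section OutDegree

variable {P Q : Type*} [PartialOrder P] [PartialOrder Q]

/-- Whatever lies below an element of a lower set is in that lower set, so covers can be computed
inside it. Disjoint unions, adjoined tops and grafted branches all embed their pieces as lower sets;
this is how local data pass from pieces to the whole. -/
theorem covBy_apply_iff_of_isLowerSet_range (f : P ↪o Q) (hf : IsLowerSet (Set.range f))
    {x : P} {y : Q} : y ⋖ f x ↔ ∃ z, z ⋖ x ∧ f z = y := by
  constructor
  · intro h
    obtain ⟨z, rfl⟩ := hf h.le ⟨x, rfl⟩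
    refine ⟨z, ⟨f.lt_iff_lt.1 h.lt, fun c h1 h2 => h.2 (f.lt_iff_lt.2 h1) (f.lt_iff_lt.2 h2)⟩, rfl⟩
  · rintro ⟨z, h, rfl⟩
    refine ⟨f.lt_iff_lt.2 h.lt, fun c h1 h2 => ?_⟩
    obtain ⟨c, rfl⟩ := hf h2.le ⟨x, rfl⟩
    exact h.2 (f.lt_iff_lt.1 h1) (f.lt_iff_lt.1 h2)

theorem outDegree_apply_of_isLowerSet_range (f : P ↪o Q) (hf : IsLowerSet (Set.range f)) (x : P) :
    outDegree (f x) = outDegree x := by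
  have : {y | y ⋖ f x} = f '' {y | y ⋖ x} := by
    ext y; exact covBy_apply_iff_of_isLowerSet_range f hf
  rw [outDegree, this, Set.ncard_image_of_injective _ f.injective, outDegree]

theorem outDegree_subtype_of_isLowerSet_range (f : P ↪o Q) (hf : IsLowerSet (Set.range f))
    {E : Set P} {E' : Set Q} (h : ∀ x, f x ∈ E' ↔ x ∈ E) (x : P) (hx : x ∈ E) :
    outDegree (⟨f x, (h x).2 hx⟩ : E') = outDegree (⟨x, hx⟩ : E) := by
  let g : E ↪o E' := ⟨⟨fun a => ⟨f a, (h a).2 a.2⟩, fun a b hab => by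
    have := congrArg Subtype.val hab; exact Subtype.ext (f.injective this)⟩, by
    intro a b; exact f.le_iff_le⟩
  refine outDegree_apply_of_isLowerSet_range g ?_ ⟨x, hx⟩
  rintro _ ⟨b, hb⟩ hab ⟨a, rfl⟩
  obtain ⟨c, rfl⟩ := hf (show b ≤ f a from hab) ⟨a, rfl⟩
  exact ⟨⟨c, (h c).1 hb⟩, rfl⟩

theorem outDegree_orderIso (e : P ≃o Q) (x : P) : outDegree (e x) = outDegree x :=
  outDegree_apply_of_isLowerSet_range e.toOrderEmbedding
    (fun _ b _ _ => ⟨e.symm b, by simp⟩) x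

theorem outDegree_eq_zero_iff [Finite P] (x : P) : outDegree x = 0 ↔ IsMin x := by
  rw [outDegree, Set.ncard_eq_zero (Set.toFinite _)]
  constructor
  · intro h y hy
    by_contra hne
    have hlt : y < x := lt_of_le_not_ge hy hne
    obtain ⟨z, _, hz⟩ := exists_le_covBy_of_lt hlt
    exact (Set.eq_empty_iff_forall_notMem.1 h z) hz
  · intro h
    exact Set.eq_empty_iff_forall_notMem.2 fun y hy => h.not_lt (CovBy.lt hy)

/-- The number of maximal elements. -/
noncomputable def maxCount (P : Type*) [PartialOrder P] : ℕ := {x : P | IsMax x}.ncard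

/-- The number of elements that cover nothing. -/
noncomputable def leafCount (P : Type*) [PartialOrder P] : ℕ := {x : P | outDegree x = 0}.ncard

theorem leafCount_congr (e : P ≃o Q) : leafCount P = leafCount Q := by
  rw [leafCount, leafCount, ← Set.ncard_image_of_injective _ e.injective]
  congr 1
  ext y
  obtain ⟨x, rfl⟩ := e.surjective y
  simp [outDegree_orderIso]

theorem maxCount_congr (e : P ≃o Q) : maxCount P = maxCount Q := by
  rw [maxCount, maxCount, ← Set.ncard_image_of_injective _ e.injective]
  congr 1
  ext y
  obtain ⟨x, rfl⟩ := e.surjective y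
  simp only [Set.mem_image, Set.mem_ofPred_eq, EmbeddingLike.apply_eq_iff_eq, exists_eq_right]
  exact ⟨fun h z hz => e.symm_apply_le.1 (h (e.le_symm_apply.2 hz)),
    fun h z hz => e.le_iff_le.1 (h (e.le_iff_le.2 hz))⟩

theorem outDegree_top_withTop : outDegree (⊤ : WithTop P) = maxCount P := by
  have : {y : WithTop P | y ⋖ ⊤} = (WithTop.some) '' {x : P | IsMax x} := by
    ext y
    simp only [Set.mem_ofPred_eq, WithTop.covBy_top_iff, Set.mem_image]
    exact exists_congr fun a => and_congr_right fun _ => eq_comm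
  rw [outDegree, this, Set.ncard_image_of_injective _ WithTop.coe_injective, maxCount]

theorem ncard_setOf_sum {P Q : Type*} [Finite P] [Finite Q] (p : P ⊕ Q → Prop) :
    {x | p x}.ncard = {x | p (.inl x)}.ncard + {x | p (.inr x)}.ncard := by
  rw [← Set.ncard_image_of_injective {x | p (.inl x)} (Sum.inl_injective (β := Q)),
    ← Set.ncard_image_of_injective {x | p (.inr x)} (Sum.inr_injective (α := P)),
    ← Set.ncard_union_eq]
  · congr 1
    ext (x | x) <;> simp
  · rw [Set.disjoint_left]; rintro _ ⟨x, _, rfl⟩ ⟨y, _, h⟩; cases h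

theorem leafCount_sum [Finite P] [Finite Q] : leafCount (P ⊕ Q) = leafCount P + leafCount Q := by
  rw [leafCount, ncard_setOf_sum]
  have h1 (x : P) : outDegree (Sum.inl x : P ⊕ Q) = outDegree x :=
    outDegree_apply_of_isLowerSet_range (⟨⟨Sum.inl, Sum.inl_injective⟩, Sum.inl_le_inl_iff⟩ : P ↪o P ⊕ Q)
      (by rintro _ (b | b) h ⟨x, rfl⟩
          · exact ⟨b, rfl⟩
          · exact absurd h Sum.not_inr_le_inl) x
  have h2 (x : Q) : outDegree (Sum.inr x : P ⊕ Q) = outDegree x :=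
    outDegree_apply_of_isLowerSet_range (⟨⟨Sum.inr, Sum.inr_injective⟩, Sum.inr_le_inr_iff⟩ : Q ↪o P ⊕ Q)
      (by rintro _ (b | b) h ⟨x, rfl⟩
          · exact absurd h Sum.not_inl_le_inr
          · exact ⟨b, rfl⟩) x
  simp only [h1, h2]; rfl

theorem maxCount_sum [Finite P] [Finite Q] : maxCount (P ⊕ Q) = maxCount P + maxCount Q := by
  rw [maxCount, ncard_setOf_sum]
  have h1 (x : P) : IsMax (Sum.inl x : P ⊕ Q) ↔ IsMax x := by
    constructor
    · intro h y hy; exact Sum.inl_le_inl_iff.1 (h (Sum.inl_le_inl_iff.2 hy))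
    · rintro h (y | y) hy
      · exact Sum.inl_le_inl_iff.2 (h (Sum.inl_le_inl_iff.1 hy))
      · exact absurd hy Sum.not_inl_le_inr
  have h2 (x : Q) : IsMax (Sum.inr x : P ⊕ Q) ↔ IsMax x := by
    constructor
    · intro h y hy; exact Sum.inr_le_inr_iff.1 (h (Sum.inr_le_inr_iff.2 hy))
    · rintro h (y | y) hy
      · exact absurd hy Sum.not_inr_le_inl
      · exact Sum.inr_le_inr_iff.2 (h (Sum.inr_le_inr_iff.1 hy))
  simp only [h1, h2]; rfl

theorem maxCount_pos [Finite P] [Nonempty P] : 0 < maxCount P := by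
  rw [maxCount, Set.ncard_pos]
  obtain ⟨x, hx⟩ := Set.Finite.exists_maximal (Set.finite_univ (α := P)) Set.univ_nonempty
  exact ⟨x, fun y hy => hx.2 trivial hy⟩

theorem leafCount_pos [Finite P] [Nonempty P] : 0 < leafCount P := by
  rw [leafCount, Set.ncard_pos]
  obtain ⟨x, hx⟩ := Set.Finite.exists_minimal (Set.finite_univ (α := P)) Set.univ_nonempty
  exact ⟨x, (outDegree_eq_zero_iff x).2 fun y hy => hx.2 trivial hy⟩

theorem maxCount_withTop [Finite P] : maxCount (WithTop P) = 1 := by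
  rw [maxCount, Set.ncard_eq_one]
  exact ⟨⊤, by ext x; simp⟩

theorem outDegree_coe_withTop (x : P) : outDegree (x : WithTop P) = outDegree x :=
  outDegree_apply_of_isLowerSet_range WithTop.coeOrderHom (by
    rintro _ b h ⟨x, rfl⟩
    obtain ⟨y, rfl, _⟩ := WithTop.le_coe_iff.1 h
    exact ⟨y, rfl⟩) x

open scoped Classical in
theorem leafCount_withTop [Finite P] :
    leafCount (WithTop P) = leafCount P + if IsEmpty P then 1 else 0 := by
  have : {x : WithTop P | outDegree x = 0} =
      (WithTop.some '' {x : P | outDegree x = 0}) ∪ {x | x = ⊤ ∧ IsEmpty P} := by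
    ext x
    induction x with
    | top =>
      simp only [Set.mem_ofPred_eq, outDegree_top_withTop, Set.mem_union, Set.mem_image,
        WithTop.coe_ne_top, and_false, exists_false, false_or, true_and]
      constructor
      · intro h
        by_contra h'
        rw [not_isEmpty_iff] at h'
        exact maxCount_pos.ne' h
      · intro h
        simp [maxCount, Set.eq_empty_of_isEmpty]
    | coe x => simp [outDegree_coe_withTop]
  rw [leafCount, this, Set.ncard_union_eq (by
    rw [Set.disjoint_left]; rintro _ ⟨x, _, rfl⟩ ⟨h, _⟩; exact WithTop.coe_ne_top h),
    Set.ncard_image_of_injective _ WithTop.coe_injective, leafCount]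
  congr 1
  split_ifs with h <;> simp [h]

theorem nonempty_orderIso_of_withTop (e : WithTop P ≃o WithTop Q) : Nonempty (P ≃o Q) := by
  have h (x : P) : ∃ y : Q, e x = y := by
    have : e x ≠ ⊤ := fun h => WithTop.coe_ne_top (e.injective (h.trans e.map_top.symm))
    exact ⟨(e x).untop this, (WithTop.coe_untop _ _).symm⟩
  choose f hf using h
  have hle (x y : P) : f x ≤ f y ↔ x ≤ y := by
    rw [← WithTop.coe_le_coe, ← hf, ← hf, e.le_iff_le, WithTop.coe_le_coe]
  refine ⟨RelIso.ofSurjective (⟨⟨f, fun x y h => ?_⟩, hle _ _⟩ : P ↪o Q) fun y => ?_⟩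
  · exact le_antisymm ((hle _ _).1 h.le) ((hle _ _).1 h.ge)
  · obtain ⟨x, hx⟩ := e.surjective y
    induction x with
    | top => rw [e.map_top] at hx; exact absurd hx.symm WithTop.coe_ne_top
    | coe x => exact ⟨x, WithTop.coe_injective ((hf x).symm.trans hx)⟩

end OutDegree

/-! ### Isomorphism classes of finite posets and their decompositions -/

/-- A finite poset. -/
structure FinPoset : Type 1 where
  carrier : Type
  [order : PartialOrder carrier]
  [finite : Finite carrier]

attribute [instance] FinPoset.order FinPoset.finite

instance FinPoset.isoSetoid : Setoid FinPoset where
  r P Q := Nonempty (P.carrier ≃o Q.carrier)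
  iseqv := ⟨fun _ => ⟨OrderIso.refl _⟩, fun ⟨e⟩ => ⟨e.symm⟩, fun ⟨e⟩ ⟨f⟩ => ⟨e.trans f⟩⟩

/-- Isomorphism classes of finite posets. -/
def Shape : Type 1 := Quotient FinPoset.isoSetoid

namespace Shape

/-- The isomorphism class of a finite poset. -/
def of (P : Type) [PartialOrder P] [Finite P] : Shape := Quotient.mk FinPoset.isoSetoid ⟨P⟩

theorem of_eq_of {P Q : Type} [PartialOrder P] [Finite P] [PartialOrder Q] [Finite Q] :
    of P = of Q ↔ Nonempty (P ≃o Q) := Quotient.eq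

theorem exists_of (F : Shape) : ∃ (P : Type) (_ : PartialOrder P) (_ : Finite P), F = of P := by
  obtain ⟨⟨P⟩, rfl⟩ := Quotient.exists_rep F
  exact ⟨P, _, _, rfl⟩

instance : Zero Shape := ⟨of Empty⟩

instance : Add Shape :=
  ⟨Quotient.map₂ (fun P Q => ⟨P.carrier ⊕ Q.carrier⟩)
    fun _ _ ⟨e⟩ _ _ ⟨f⟩ => ⟨OrderIso.sumCongr e f⟩⟩

/-- Adjoining a maximum. -/
def withTop : Shape → Shape :=
  Quotient.map (fun P => ⟨WithTop P.carrier⟩) fun _ _ ⟨e⟩ => ⟨e.withTopCongr⟩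

/-- The number of elements. -/
noncomputable def card : Shape → ℕ :=
  Quotient.lift (fun P => Nat.card P.carrier) fun _ _ ⟨e⟩ => Nat.card_congr e.toEquiv

/-- The number of minimal elements. -/
noncomputable def leaves : Shape → ℕ :=
  Quotient.lift (fun P => leafCount P.carrier) fun _ _ ⟨e⟩ => leafCount_congr e

/-- The number of maximal elements. -/
noncomputable def tops : Shape → ℕ :=
  Quotient.lift (fun P => maxCount P.carrier) fun _ _ ⟨e⟩ => maxCount_congr e

section

variable (P Q : Type) [PartialOrder P] [Finite P] [PartialOrder Q] [Finite Q]

theorem withTop_of : withTop (of P) = of (WithTop P) := rfl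

theorem card_of : card (of P) = Nat.card P := rfl

theorem leaves_of : leaves (of P) = leafCount P := rfl

theorem of_eq_zero_iff : of P = 0 ↔ IsEmpty P := by
  change of P = of Empty ↔ _
  rw [of_eq_of]
  constructor
  · rintro ⟨e⟩; exact e.toEquiv.isEmpty
  · intro h
    exact ⟨⟨Equiv.equivOfIsEmpty _ _, fun {a} => isEmptyElim a⟩⟩

end

theorem add_comm (F G : Shape) : F + G = G + F := by
  obtain ⟨P, _, _, rfl⟩ := F.exists_of
  obtain ⟨Q, _, _, rfl⟩ := G.exists_of
  exact of_eq_of.2 ⟨OrderIso.sumComm P Q⟩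

theorem zero_add (F : Shape) : 0 + F = F := by
  obtain ⟨P, _, _, rfl⟩ := F.exists_of
  refine of_eq_of.2 ⟨⟨Equiv.emptySum Empty P, ?_⟩⟩
  rintro (a | a) (b | b)
  · exact a.elim
  · exact a.elim
  · exact b.elim
  · exact Sum.inr_le_inr_iff.symm

theorem add_zero (F : Shape) : F + 0 = F := by rw [add_comm, zero_add]

theorem card_eq_zero {F : Shape} : F.card = 0 ↔ F = 0 := by
  obtain ⟨P, _, _, rfl⟩ := F.exists_of
  rw [card_of, of_eq_zero_iff, Finite.card_eq_zero_iff]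

theorem card_pos {F : Shape} (h : F ≠ 0) : 0 < F.card :=
  Nat.pos_of_ne_zero fun h' => h (card_eq_zero.1 h')

theorem card_zero : (0 : Shape).card = 0 := card_eq_zero.2 rfl

theorem card_add (F G : Shape) : (F + G).card = F.card + G.card := by
  obtain ⟨P, _, _, rfl⟩ := F.exists_of
  obtain ⟨Q, _, _, rfl⟩ := G.exists_of
  exact Nat.card_sum

theorem card_withTop (F : Shape) : F.withTop.card = F.card + 1 := by
  obtain ⟨P, _, _, rfl⟩ := F.exists_of
  exact Finite.card_option

theorem leaves_add (F G : Shape) : (F + G).leaves = F.leaves + G.leaves := by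
  obtain ⟨P, _, _, rfl⟩ := F.exists_of
  obtain ⟨Q, _, _, rfl⟩ := G.exists_of
  exact leafCount_sum

theorem leaves_pos {F : Shape} (h : F ≠ 0) : 0 < F.leaves := by
  obtain ⟨P, _, _, rfl⟩ := F.exists_of
  rw [Ne, of_eq_zero_iff, not_isEmpty_iff] at h
  exact leafCount_pos

theorem leaves_withTop {F : Shape} (h : F ≠ 0) : F.withTop.leaves = F.leaves := by
  obtain ⟨P, _, _, rfl⟩ := F.exists_of
  rw [Ne, of_eq_zero_iff] at h
  rw [withTop_of, leaves_of, leafCount_withTop, if_neg h]; rfl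

theorem leaves_withTop_zero : (withTop 0).leaves = 1 := by
  change leafCount (WithTop Empty) = 1
  rw [leafCount_withTop, if_pos (inferInstanceAs (IsEmpty Empty)), leafCount,
    Set.eq_empty_of_isEmpty {x : Empty | _}, Set.ncard_empty]

theorem tops_add (F G : Shape) : (F + G).tops = F.tops + G.tops := by
  obtain ⟨P, _, _, rfl⟩ := F.exists_of
  obtain ⟨Q, _, _, rfl⟩ := G.exists_of
  exact maxCount_sum

theorem tops_pos {F : Shape} (h : F ≠ 0) : 0 < F.tops := by
  obtain ⟨P, _, _, rfl⟩ := F.exists_of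
  rw [Ne, of_eq_zero_iff, not_isEmpty_iff] at h
  exact maxCount_pos

theorem tops_zero : (0 : Shape).tops = 0 := by
  change maxCount Empty = 0
  rw [maxCount, Set.eq_empty_of_isEmpty {x : Empty | _}, Set.ncard_empty]

theorem tops_withTop (F : Shape) : F.withTop.tops = 1 := by
  obtain ⟨P, _, _, rfl⟩ := F.exists_of
  exact maxCount_withTop

theorem withTop_injective : Function.Injective withTop := by
  intro F G h
  obtain ⟨P, _, _, rfl⟩ := F.exists_of
  obtain ⟨Q, _, _, rfl⟩ := G.exists_of
  obtain ⟨e⟩ := of_eq_of.1 h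
  exact of_eq_of.2 (nonempty_orderIso_of_withTop e)

theorem withTop_ne_zero (F : Shape) : F.withTop ≠ 0 := fun h => by
  have := F.card_withTop; rw [h, card_zero] at this; omega

theorem add_eq_zero {F G : Shape} : F + G = 0 ↔ F = 0 ∧ G = 0 := by
  rw [← card_eq_zero, card_add, Nat.add_eq_zero_iff, card_eq_zero, card_eq_zero]

/-- Two nonempty summands would give at least two maximal elements, whereas an adjoined top is the
only one. -/
theorem eq_zero_or_of_add_eq_withTop {F G H : Shape} (h : F + G = H.withTop) : F = 0 ∨ G = 0 := by
  by_contra! hne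
  have h1 := tops_pos hne.1
  have h2 := tops_pos hne.2
  have h3 := tops_add F G
  rw [h, tops_withTop] at h3
  omega

/-- Both summands embed into a fixed representative of `F`, hence are classes of its finitely many
subsets. -/
theorem finite_setOf_add_eq (F : Shape) : {p : Shape × Shape | p.1 + p.2 = F}.Finite := by
  obtain ⟨R, _, _, rfl⟩ := F.exists_of
  refine (Set.finite_range fun s : Set R × Set R => (of s.1, of s.2)).subset ?_
  rintro ⟨F, G⟩ h
  obtain ⟨P, _, _, rfl⟩ := F.exists_of
  obtain ⟨Q, _, _, rfl⟩ := G.exists_of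
  obtain ⟨e⟩ := of_eq_of.1 h
  let f : P ↪o R := RelEmbedding.trans
    (⟨⟨Sum.inl, Sum.inl_injective⟩, Sum.inl_le_inl_iff⟩ : P ↪o P ⊕ Q) e.toOrderEmbedding
  let g : Q ↪o R := RelEmbedding.trans
    (⟨⟨Sum.inr, Sum.inr_injective⟩, Sum.inr_le_inr_iff⟩ : Q ↪o P ⊕ Q) e.toOrderEmbedding
  exact ⟨(Set.range f, Set.range g), Prod.ext (of_eq_of.2 ⟨f.orderIso.symm⟩)
    (of_eq_of.2 ⟨g.orderIso.symm⟩)⟩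

/-- The pairs of isomorphism classes with a given disjoint union. -/
noncomputable def antidiag (F : Shape) : Finset (Shape × Shape) := (finite_setOf_add_eq F).toFinset

@[simp] theorem mem_antidiag {F : Shape} {p : Shape × Shape} : p ∈ antidiag F ↔ p.1 + p.2 = F := by
  simp [antidiag]

open scoped Classical in
/-- The pairs of nonzero isomorphism classes with a given disjoint union. -/
noncomputable def properAntidiag (F : Shape) : Finset (Shape × Shape) :=
  (antidiag F).filter fun p => p.1 ≠ 0 ∧ p.2 ≠ 0

theorem mem_properAntidiag {F : Shape} {p : Shape × Shape} :
    p ∈ properAntidiag F ↔ p.1 + p.2 = F ∧ p.1 ≠ 0 ∧ p.2 ≠ 0 := by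
  simp [properAntidiag]

theorem card_lt_of_mem_properAntidiag {F : Shape} {p : Shape × Shape} (hp : p ∈ properAntidiag F) :
    p.1.card < F.card ∧ p.2.card < F.card := by
  obtain ⟨rfl, h1, h2⟩ := mem_properAntidiag.1 hp
  have := card_pos h1
  have := card_pos h2
  rw [card_add]; omega

theorem properAntidiag_withTop (F : Shape) : properAntidiag F.withTop = ∅ := by
  refine Finset.eq_empty_of_forall_notMem fun p hp => ?_
  obtain ⟨h, h1, h2⟩ := mem_properAntidiag.1 hp
  exact (eq_zero_or_of_add_eq_withTop h).elim h1 h2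

theorem antidiag_zero : antidiag 0 = {(0, 0)} := by
  ext p; simp [add_eq_zero, Prod.ext_iff]

/-- The two trivial decompositions are isolated because they involve `F` itself; all others involve
strictly smaller posets, which makes induction on the cardinality possible. -/
theorem sum_antidiag {M : Type*} [AddCommMonoid M] {F : Shape} (hF : F ≠ 0)
    (g : Shape × Shape → M) :
    ∑ p ∈ antidiag F, g p = g (0, F) + g (F, 0) + ∑ p ∈ properAntidiag F, g p := by
  classical
  rw [← Finset.sum_pair (fun h => hF (Prod.ext_iff.1 h).2), ← Finset.sum_union]
  · congr 1
    ext ⟨a, b⟩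
    simp only [mem_antidiag, Finset.mem_union, Finset.mem_insert, Finset.mem_singleton,
      mem_properAntidiag, Prod.mk.injEq]
    constructor
    · intro h
      by_cases ha : a = 0
      · subst ha; rw [zero_add] at h; simp [h]
      · by_cases hb : b = 0
        · subst hb; rw [add_zero] at h; simp [h]
        · simp [h, ha, hb]
    · rintro ((⟨rfl, rfl⟩ | ⟨rfl, rfl⟩) | h)
      · exact zero_add _
      · exact add_zero _
      · exact h.1
  · rw [Finset.disjoint_left]
    rintro p hp hp'
    obtain ⟨_, h1, h2⟩ := mem_properAntidiag.1 hp'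
    simp only [Finset.mem_insert, Finset.mem_singleton] at hp
    rcases hp with rfl | rfl
    · exact h1 rfl
    · exact h2 rfl

end Shape

/-! ### Posets with marked elements and their invariants -/

section MarkedPoset

variable {P Q R : Type*} [PartialOrder P] [PartialOrder Q] [PartialOrder R]

/-- Isomorphism of posets with distinguished subsets. -/
def MarkedIso (E : Set P) (E' : Set Q) : Prop := ∃ φ : P ≃o Q, ∀ x, φ x ∈ E' ↔ x ∈ E

theorem MarkedIso.refl (E : Set P) : MarkedIso E E := ⟨OrderIso.refl _, fun _ => Iff.rfl⟩

theorem MarkedIso.symm {E : Set P} {E' : Set Q} : MarkedIso E E' → MarkedIso E' E := by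
  rintro ⟨φ, h⟩
  exact ⟨φ.symm, fun x => by rw [← h, φ.apply_symm_apply]⟩

theorem MarkedIso.trans {E : Set P} {E' : Set Q} {E'' : Set R} :
    MarkedIso E E' → MarkedIso E' E'' → MarkedIso E E'' := by
  rintro ⟨φ, h⟩ ⟨ψ, h'⟩
  exact ⟨φ.trans ψ, fun x => (h' _).trans (h x)⟩

theorem MarkedIso.nonempty_orderIso {E : Set P} {E' : Set Q} (h : MarkedIso E E') :
    Nonempty (E ≃o E') := by
  obtain ⟨φ, h⟩ := h
  exact ⟨⟨φ.toEquiv.subtypeEquiv fun x => (h x).symm, fun {a b} => φ.le_iff_le⟩⟩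

theorem image_eq_iff_forall_mem {E : Set P} {E' : Set Q} (φ : P ≃o Q) :
    φ '' E = E' ↔ ∀ x, φ x ∈ E' ↔ x ∈ E := by
  constructor
  · rintro rfl x
    simp
  · intro h
    ext y
    obtain ⟨x, rfl⟩ := φ.surjective y
    simp [h]

/-- The marked elements below a given element. -/
def markedBelow (E : Set P) (y : P) : Set (Set.Iic y) := {a | (a : P) ∈ E}

/-- An element covering two elements that are the maxima of isomorphic marked posets. -/
def IsSymmetric (E : Set P) (x : P) : Prop :=
  ∃ y y', y ⋖ x ∧ y' ⋖ x ∧ y ≠ y' ∧ MarkedIso (markedBelow E y) (markedBelow E y')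

theorem markedIso_markedBelow (f : P ↪o Q) (hf : IsLowerSet (Set.range f))
    {E : Set P} {E' : Set Q} (h : ∀ x, f x ∈ E' ↔ x ∈ E) (y : P) :
    MarkedIso (markedBelow E y) (markedBelow E' (f y)) := by
  let g : Set.Iic y ↪o Set.Iic (f y) :=
    ⟨⟨fun a => ⟨f a, f.le_iff_le.2 a.2⟩, fun a b hab => by
      have := congrArg Subtype.val hab; exact Subtype.ext (f.injective this)⟩, by
      intro a b; exact f.le_iff_le⟩
  refine ⟨RelIso.ofSurjective g ?_, fun x => h x⟩
  rintro ⟨b, hb⟩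
  obtain ⟨c, rfl⟩ := hf hb ⟨y, rfl⟩
  exact ⟨⟨c, f.le_iff_le.1 hb⟩, rfl⟩

theorem isSymmetric_apply_iff (f : P ↪o Q) (hf : IsLowerSet (Set.range f))
    {E : Set P} {E' : Set Q} (h : ∀ x, f x ∈ E' ↔ x ∈ E) (x : P) :
    IsSymmetric E' (f x) ↔ IsSymmetric E x := by
  constructor
  · rintro ⟨y, y', hy, hy', hne, hiso⟩
    obtain ⟨z, hz, rfl⟩ := (covBy_apply_iff_of_isLowerSet_range f hf).1 hy
    obtain ⟨z', hz', rfl⟩ := (covBy_apply_iff_of_isLowerSet_range f hf).1 hy'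
    exact ⟨z, z', hz, hz', fun e => hne (e ▸ rfl), (markedIso_markedBelow f hf h z).trans
      (hiso.trans (markedIso_markedBelow f hf h z').symm)⟩
  · rintro ⟨z, z', hz, hz', hne, hiso⟩
    exact ⟨f z, f z', (covBy_apply_iff_of_isLowerSet_range f hf).2 ⟨z, hz, rfl⟩,
      (covBy_apply_iff_of_isLowerSet_range f hf).2 ⟨z', hz', rfl⟩, fun e => hne (f.injective e),
      (markedIso_markedBelow f hf h z).symm.trans
      (hiso.trans (markedIso_markedBelow f hf h z'))⟩

theorem isLowerSet_range_orderIso (e : P ≃o Q) : IsLowerSet (Set.range e.toOrderEmbedding) :=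
  fun _ b _ _ => ⟨e.symm b, by simp⟩

/-- The unmarked elements cover two elements, and the marked elements cover two elements, or less
if they cover less than two elements in the poset of marked elements. -/
def IsBinarized (E : Set P) : Prop :=
  (∀ x : P, x ∉ E → outDegree x = 2) ∧ ∀ x : E, outDegree (x : P) = min 2 (outDegree x)

theorem MarkedIso.isBinarized {E : Set P} {E' : Set Q} (h : MarkedIso E E') (hE : IsBinarized E) :
    IsBinarized E' := by
  obtain ⟨φ, h⟩ := h
  constructor
  · intro y hy
    obtain ⟨x, rfl⟩ := φ.surjective y
    rw [outDegree_orderIso]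
    exact hE.1 x fun hx => hy ((h x).2 hx)
  · rintro ⟨y, hy⟩
    obtain ⟨x, rfl⟩ := φ.surjective y
    have hx := (h x).1 hy
    have := outDegree_subtype_of_isLowerSet_range φ.toOrderEmbedding
      (isLowerSet_range_orderIso φ) h x hx
    simp only [OrderIso.toOrderEmbedding, RelIso.coe_toRelEmbedding] at this
    rw [this, outDegree_orderIso]
    exact hE.2 ⟨x, hx⟩

theorem MarkedIso.ncard_isSymmetric {E : Set P} {E' : Set Q} (h : MarkedIso E E') :
    {x | IsSymmetric E x}.ncard = {x | IsSymmetric E' x}.ncard := by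
  obtain ⟨φ, h⟩ := h
  rw [← Set.ncard_image_of_injective _ φ.injective]
  congr 1
  ext y
  obtain ⟨x, rfl⟩ := φ.surjective y
  simpa using (isSymmetric_apply_iff φ.toOrderEmbedding (isLowerSet_range_orderIso φ) h x).symm

end MarkedPoset

/-! ### Joining marked posets under a new top -/

section Node

variable {ι κ : Type*} {P : ι → Type*} [∀ i, PartialOrder (P i)]
  {Q : κ → Type*} [∀ i, PartialOrder (Q i)]

/-- The inclusion of a component in the disjoint union with a maximum adjoined. -/
def nodeEmb (i : ι) : P i ↪o WithTop (Σ i, P i) :=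
  ⟨⟨fun x => ((⟨i, x⟩ : Σ i, P i) : WithTop (Σ i, P i)), fun x y h => by
    simpa using WithTop.coe_injective h⟩, by
    intro x y
    exact WithTop.coe_le_coe.trans Sigma.mk_le_mk_iff⟩

theorem nodeEmb_eq_or_eq_top (x : WithTop (Σ i, P i)) : x = ⊤ ∨ ∃ i y, x = nodeEmb i y := by
  induction x with
  | top => exact .inl rfl
  | coe x => exact .inr ⟨x.1, x.2, rfl⟩

theorem nodeEmb_ne_top (i : ι) (x : P i) : nodeEmb i x ≠ ⊤ := WithTop.coe_ne_top

theorem nodeEmb_inj {i j : ι} {x : P i} {y : P j} :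
    nodeEmb i x = nodeEmb j y ↔ (⟨i, x⟩ : Σ i, P i) = ⟨j, y⟩ := WithTop.coe_inj

theorem le_nodeEmb {x : WithTop (Σ i, P i)} {i : ι} {y : P i} (h : x ≤ nodeEmb i y) :
    ∃ z, x = nodeEmb i z := by
  obtain ⟨⟨j, z⟩, rfl, -⟩ := WithTop.le_coe_iff.1 h
  replace h : (⟨j, z⟩ : Σ i, P i) ≤ ⟨i, y⟩ := WithTop.coe_le_coe.1 h
  obtain ⟨h1, -⟩ := Sigma.le_def.1 h
  obtain rfl : j = i := h1
  exact ⟨z, rfl⟩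

theorem exists_component [∀ i, OrderTop (P i)]
    (φ : WithTop (Σ i, P i) ≃o WithTop (Σ i, Q i)) (i : ι) :
    ∃ j, ∀ x, ∃ y, φ (nodeEmb i x) = nodeEmb j y := by
  rcases nodeEmb_eq_or_eq_top (φ (nodeEmb i ⊤)) with h | ⟨j, y, h⟩
  · exact absurd (φ.injective (h.trans φ.map_top.symm)) (nodeEmb_ne_top _ _)
  · refine ⟨j, fun x => le_nodeEmb (y := y) ?_⟩
    rw [← h]
    exact φ.le_iff_le.2 ((nodeEmb i).le_iff_le.2 le_top)

theorem isLowerSet_range_nodeEmb (i : ι) : IsLowerSet (Set.range (nodeEmb (P := P) i)) := by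
  rintro _ b h ⟨x, rfl⟩
  obtain ⟨z, rfl⟩ := le_nodeEmb h
  exact ⟨z, rfl⟩

/-- The disjoint union of marked posets with a maximum adjoined, which is marked or not. -/
def nodeSet (b : Bool) (E : ∀ i, Set (P i)) : Set (WithTop (Σ i, P i)) :=
  {x | WithTop.recTopCoe (C := fun _ => Prop) (b = true) (fun y => y.2 ∈ E y.1) x}

theorem top_mem_nodeSet {P : ι → Type*} {b : Bool} {E : ∀ i, Set (P i)} : ⊤ ∈ nodeSet b E ↔ b = true := Iff.rfl

theorem nodeEmb_mem_nodeSet {b : Bool} {E : ∀ i, Set (P i)} {i : ι} (x : P i) :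
    nodeEmb i x ∈ nodeSet b E ↔ x ∈ E i := Iff.rfl

theorem outDegree_nodeEmb (i : ι) (x : P i) : outDegree (nodeEmb i x) = outDegree x :=
  outDegree_apply_of_isLowerSet_range _ (isLowerSet_range_nodeEmb i) x

open scoped Classical in
theorem ncard_setOf_eq_sum {X : Type*} [Fintype X] (q : X → Prop) :
    {x | q x}.ncard = ∑ x, if q x then 1 else 0 := by
  rw [Set.ncard_eq_toFinset_card', Finset.sum_boole]; simp

theorem ncard_setOf_node [Fintype ι] [∀ i, Finite (P i)] (p : WithTop (Σ i, P i) → Prop)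
    [Decidable (p ⊤)] :
    {x | p x}.ncard = (if p ⊤ then 1 else 0) + ∑ i, {x | p (nodeEmb i x)}.ncard := by
  classical
  have := fun i => Fintype.ofFinite (P i)
  have h' (q : WithTop (Σ i, P i) → Prop) : {x | q x}.ncard =
      (if q ⊤ then 1 else 0) + ∑ i, ∑ x, if q (nodeEmb i x) then 1 else 0 := by
    rw [ncard_setOf_eq_sum q]
    exact (Fintype.sum_option (α := Σ i, P i) (fun x => if q x then 1 else 0)).trans
      (congrArg _ (Fintype.sum_sigma _))
  rw [h' p]
  congr 1
  · congr
  · exact Finset.sum_congr rfl fun i _ => (ncard_setOf_eq_sum _).symm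

theorem covBy_top_node [∀ i, OrderTop (P i)] {y : WithTop (Σ i, P i)} :
    y ⋖ ⊤ ↔ ∃ i, y = nodeEmb i ⊤ := by
  rw [WithTop.covBy_top_iff]
  constructor
  · rintro ⟨⟨i, x⟩, h, rfl⟩
    have : x = ⊤ := top_le_iff.1 (Sigma.mk_le_mk_iff.1 (h (Sigma.mk_le_mk_iff.2 le_top)))
    subst this
    exact ⟨i, rfl⟩
  · rintro ⟨i, rfl⟩
    refine ⟨⟨i, ⊤⟩, ?_, rfl⟩
    rintro ⟨j, y⟩ h
    obtain ⟨h1, -⟩ := Sigma.le_def.1 h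
    obtain rfl : i = j := h1
    exact Sigma.mk_le_mk_iff.2 le_top

theorem outDegree_top_node [Fintype ι] [∀ i, OrderTop (P i)] :
    outDegree (⊤ : WithTop (Σ i, P i)) = Fintype.card ι := by
  have : {y : WithTop (Σ i, P i) | y ⋖ ⊤} = Set.range fun i => nodeEmb (P := P) i ⊤ := by
    ext y
    rw [Set.mem_ofPred_eq, covBy_top_node]
    exact exists_congr fun i => eq_comm
  rw [outDegree, this, ← Set.image_univ, Set.ncard_image_of_injective, Set.ncard_univ,
    Nat.card_eq_fintype_card]
  intro i j h
  exact (Sigma.mk.inj (nodeEmb_inj.1 h)).1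

theorem markedIso_markedBelow_top {P : Type*} [PartialOrder P] [OrderTop P] (E : Set P) :
    MarkedIso (markedBelow E ⊤) E :=
  ⟨⟨⟨Subtype.val, fun x => ⟨x, le_top⟩, fun _ => rfl, fun _ => rfl⟩, Iff.rfl⟩, fun _ => Iff.rfl⟩

theorem isSymmetric_top_node [∀ i, OrderTop (P i)] {b : Bool} {E : ∀ i, Set (P i)} :
    IsSymmetric (nodeSet b E) ⊤ ↔ ∃ i j, i ≠ j ∧ MarkedIso (E i) (E j) := by
  have key (i : ι) : MarkedIso (E i) (markedBelow (nodeSet b E) (nodeEmb i ⊤)) :=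
    (markedIso_markedBelow_top _).symm.trans
      (markedIso_markedBelow _ (isLowerSet_range_nodeEmb i) nodeEmb_mem_nodeSet _)
  constructor
  · rintro ⟨y, y', hy, hy', hne, h⟩
    obtain ⟨i, rfl⟩ := covBy_top_node.1 hy
    obtain ⟨j, rfl⟩ := covBy_top_node.1 hy'
    exact ⟨i, j, fun e => hne (e ▸ rfl), (key i).trans (h.trans (key j).symm)⟩
  · rintro ⟨i, j, hne, h⟩
    exact ⟨_, _, covBy_top_node.2 ⟨i, rfl⟩, covBy_top_node.2 ⟨j, rfl⟩,
      fun e => hne (Sigma.mk.inj (nodeEmb_inj.1 e)).1, (key i).symm.trans (h.trans (key j))⟩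

/-- An isomorphism fixes the top, and each component, having a maximum, is carried into a single
component; applying this to the inverse as well shows that the components are permuted. -/
theorem markedIso_nodeSet_iff [∀ i, OrderTop (P i)] [∀ i, OrderTop (Q i)] {b b' : Bool}
    {E : ∀ i, Set (P i)} {E' : ∀ i, Set (Q i)} :
    MarkedIso (nodeSet b E) (nodeSet b' E') ↔
      b = b' ∧ ∃ σ : ι ≃ κ, ∀ i, MarkedIso (E i) (E' (σ i)) := by
  constructor
  · rintro ⟨φ, h⟩
    refine ⟨?_, ?_⟩
    · have := h ⊤
      rw [φ.map_top, top_mem_nodeSet, top_mem_nodeSet] at this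
      exact (Bool.eq_iff_iff.2 this).symm
    choose σ f hf using exists_component φ
    choose τ g hg using exists_component φ.symm
    have hτσ (i : ι) : τ (σ i) = i := by
      have h1 : φ.symm (φ (nodeEmb i ⊤)) = nodeEmb i ⊤ := φ.symm_apply_apply _
      rw [hf, hg] at h1
      exact (Sigma.mk.inj (nodeEmb_inj.1 h1)).1
    have hστ (j : κ) : σ (τ j) = j := by
      have h1 : φ (φ.symm (nodeEmb j ⊤)) = nodeEmb j ⊤ := φ.apply_symm_apply _
      rw [hg, hf] at h1
      exact (Sigma.mk.inj (nodeEmb_inj.1 h1)).1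
    refine ⟨⟨σ, τ, hτσ, hστ⟩, fun i => ?_⟩
    have hle (x y : P i) : f i x ≤ f i y ↔ x ≤ y := by
      rw [← (nodeEmb (σ i)).le_iff_le, ← hf, ← hf, φ.le_iff_le, (nodeEmb i).le_iff_le]
    refine ⟨RelIso.ofSurjective (⟨⟨f i, fun x y h => ?_⟩, hle _ _⟩ : P i ↪o Q (σ i)) fun y => ?_,
      fun x => ?_⟩
    · exact le_antisymm ((hle _ _).1 h.le) ((hle _ _).1 h.ge)
    · obtain ⟨x, hx⟩ : ∃ x, φ.symm (nodeEmb (σ i) y) = nodeEmb i x := by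
        have h1 : ∃ x, φ.symm (nodeEmb (σ i) y) = nodeEmb (τ (σ i)) x := ⟨_, hg _ _⟩
        rwa [hτσ] at h1
      refine ⟨x, (nodeEmb (σ i)).injective ?_⟩
      change nodeEmb (σ i) (f i x) = _
      rw [← hf, ← hx, φ.apply_symm_apply]
    · change f i x ∈ E' (σ i) ↔ _
      rw [← nodeEmb_mem_nodeSet (b := b') (E := E'), ← hf, h, nodeEmb_mem_nodeSet]
  · rintro ⟨rfl, σ, h⟩
    choose ψ hψ using h
    let e : (Σ i, P i) ≃o (Σ i, Q i) := ⟨σ.sigmaCongr fun i => (ψ i).toEquiv, by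
      rintro ⟨i, x⟩ ⟨j, y⟩
      constructor
      · intro h
        obtain ⟨h1, -⟩ := Sigma.le_def.1 h
        obtain rfl : i = j := σ.injective h1
        exact Sigma.mk_le_mk_iff.2 ((ψ i).le_iff_le.1 (Sigma.mk_le_mk_iff.1 h))
      · intro h
        obtain ⟨h1, -⟩ := Sigma.le_def.1 h
        obtain rfl : i = j := h1
        exact Sigma.mk_le_mk_iff.2 ((ψ i).le_iff_le.2 (Sigma.mk_le_mk_iff.1 h))⟩
    refine ⟨e.withTopCongr, fun x => ?_⟩
    rcases nodeEmb_eq_or_eq_top x with rfl | ⟨i, y, rfl⟩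
    · exact Iff.rfl
    · exact hψ i y

/-- The inclusion of the marked elements in a disjoint union. -/
def sigmaVal (E : ∀ i, Set (P i)) : (Σ i, E i) ↪o (Σ i, P i) :=
  ⟨⟨fun x => ⟨x.1, x.2.1⟩, by
    rintro ⟨i, x⟩ ⟨j, y⟩ h
    obtain ⟨rfl, h2⟩ := Sigma.mk.inj h
    exact Sigma.ext rfl (heq_of_eq (Subtype.ext (eq_of_heq h2)))⟩, by
    rintro ⟨i, x⟩ ⟨j, y⟩
    constructor
    · intro h
      obtain ⟨h1, -⟩ := Sigma.le_def.1 h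
      obtain rfl : i = j := h1
      replace h : (⟨i, x.1⟩ : Σ i, P i) ≤ ⟨i, y.1⟩ := h
      exact Sigma.mk_le_mk_iff.2 (show x.1 ≤ y.1 from Sigma.mk_le_mk_iff.1 h)
    · intro h
      obtain ⟨h1, -⟩ := Sigma.le_def.1 h
      obtain rfl : i = j := h1
      have h' := Sigma.mk_le_mk_iff (α := fun i => E i).1 h
      exact Sigma.mk_le_mk_iff.2 (show x.1 ≤ y.1 from h')⟩

/-- The marked elements when the adjoined maximum is unmarked. -/
noncomputable def nodeSetFalseIso (E : ∀ i, Set (P i)) : (Σ i, E i) ≃o nodeSet false E :=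
  RelIso.ofSurjective
    (⟨⟨fun x => ⟨sigmaVal E x, x.2.2⟩, fun x y h =>
        (sigmaVal E).injective (WithTop.coe_injective (congrArg Subtype.val h))⟩,
      fun {x y} => WithTop.coe_le_coe.trans (sigmaVal E).le_iff_le⟩ :
      (Σ i, E i) ↪o nodeSet false E) (by
    rintro ⟨x, hx⟩
    rcases nodeEmb_eq_or_eq_top x with rfl | ⟨i, y, rfl⟩
    · exact absurd (top_mem_nodeSet.1 hx) (by simp)
    · exact ⟨⟨i, y, hx⟩, rfl⟩)

/-- The marked elements when the adjoined maximum is marked. -/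
noncomputable def nodeSetTrueIso (E : ∀ i, Set (P i)) : WithTop (Σ i, E i) ≃o nodeSet true E :=
  RelIso.ofSurjective
    (⟨⟨fun x => ⟨(sigmaVal E).withTopMap x, by
        rcases nodeEmb_eq_or_eq_top x with rfl | ⟨i, y, rfl⟩
        · exact top_mem_nodeSet.2 rfl
        · exact y.2⟩, fun x y h => (sigmaVal E).withTopMap.injective (congrArg Subtype.val h)⟩,
      fun {x y} => (sigmaVal E).withTopMap.le_iff_le⟩ :
      WithTop (Σ i, E i) ↪o nodeSet true E) (by
    rintro ⟨x, hx⟩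
    rcases nodeEmb_eq_or_eq_top x with rfl | ⟨i, y, rfl⟩
    · exact ⟨⊤, rfl⟩
    · exact ⟨nodeEmb i ⟨y, hx⟩, rfl⟩)

/-- Components are lower sets both in the whole poset and among the marked elements, so their
conditions are inherited. Only the top adds a condition: it covers one element per component, and
among the marked elements it covers the maximal ones of their disjoint union. -/
theorem isBinarized_nodeSet [Fintype ι] [∀ i, OrderTop (P i)] {b : Bool} {E : ∀ i, Set (P i)} :
    IsBinarized (nodeSet b E) ↔
      (Fintype.card ι = if b then min 2 (maxCount (Σ i, E i)) else 2) ∧ ∀ i, IsBinarized (E i) := by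
  have hsub (i : ι) (x : P i) (hx : x ∈ E i) :
      outDegree (⟨nodeEmb i x, hx⟩ : nodeSet b E) = outDegree (⟨x, hx⟩ : E i) :=
    outDegree_subtype_of_isLowerSet_range (nodeEmb i) (isLowerSet_range_nodeEmb i)
      nodeEmb_mem_nodeSet x hx
  have htop (E : ∀ i, Set (P i)) : outDegree (⟨⊤, top_mem_nodeSet.2 rfl⟩ : nodeSet true E) =
      maxCount (Σ i, E i) := by
    rw [← outDegree_top_withTop, ← outDegree_orderIso (nodeSetTrueIso E) ⊤]; rfl
  constructor
  · rintro ⟨h1, h2⟩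
    refine ⟨?_, fun i => ⟨fun x hx => ?_, fun x => ?_⟩⟩
    · cases b
      · rw [← outDegree_top_node (P := P)]
        exact h1 ⊤ (by simp [top_mem_nodeSet])
      · rw [← outDegree_top_node (P := P)]
        have := h2 ⟨⊤, top_mem_nodeSet.2 rfl⟩
        rw [htop] at this
        simpa using this
    · rw [← outDegree_nodeEmb i x]
      exact h1 _ hx
    · have := h2 ⟨nodeEmb i x.1, x.2⟩
      rwa [hsub, outDegree_nodeEmb] at this
  · rintro ⟨h1, h2⟩
    refine ⟨fun x hx => ?_, ?_⟩
    · rcases nodeEmb_eq_or_eq_top x with rfl | ⟨i, y, rfl⟩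
      · rw [outDegree_top_node, h1, if_neg (by simpa [top_mem_nodeSet] using hx)]
      · rw [outDegree_nodeEmb]
        exact (h2 i).1 y hx
    · rintro ⟨x, hx⟩
      rcases nodeEmb_eq_or_eq_top x with rfl | ⟨i, y, rfl⟩
      · obtain rfl : b = true := top_mem_nodeSet.1 hx
        rw [outDegree_top_node, h1, htop]; simp
      · rw [hsub i y hx, outDegree_nodeEmb]
        exact (h2 i).2 ⟨y, hx⟩

end Node

/-! ### Finite disjoint unions as iterated sums of shapes -/

section SigmaFin

variable {k : ℕ} (P : Fin (k + 1) → Type) [∀ i, PartialOrder (P i)]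

theorem nonempty_sumIsoSigmaFin : Nonempty (P 0 ⊕ (Σ i : Fin k, P i.succ) ≃o Σ i, P i) := by
  let f : P 0 ⊕ (Σ i : Fin k, P i.succ) → Σ i, P i :=
    Sum.elim (fun x => ⟨0, x⟩) fun y => ⟨y.1.succ, y.2⟩
  have hle (x y) : f x ≤ f y ↔ x ≤ y := by
    rcases x with x | ⟨i, x⟩ <;> rcases y with y | ⟨j, y⟩
    · exact Sigma.mk_le_mk_iff.trans Sum.inl_le_inl_iff.symm
    · refine iff_of_false (fun h => ?_) Sum.not_inl_le_inr
      obtain ⟨h1, -⟩ := Sigma.le_def.1 h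
      exact Fin.succ_ne_zero j h1.symm
    · refine iff_of_false (fun h => ?_) Sum.not_inr_le_inl
      obtain ⟨h1, -⟩ := Sigma.le_def.1 h
      exact Fin.succ_ne_zero i h1
    · refine Iff.trans ?_ Sum.inr_le_inr_iff.symm
      constructor
      · intro h
        obtain ⟨h1, -⟩ := Sigma.le_def.1 h
        obtain rfl : i = j := Fin.succ_injective _ h1
        exact Sigma.mk_le_mk_iff.2 (Sigma.mk_le_mk_iff (α := P).1 h)
      · intro h
        obtain ⟨h1, -⟩ := Sigma.le_def.1 h
        obtain rfl : i = j := h1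
        exact Sigma.mk_le_mk_iff.2 (Sigma.mk_le_mk_iff (α := fun i : Fin k => P i.succ).1 h)
  refine ⟨RelIso.ofSurjective
    (⟨⟨f, fun x y h => le_antisymm ((hle _ _).1 h.le) ((hle _ _).1 h.ge)⟩, hle _ _⟩ :
      P 0 ⊕ (Σ i : Fin k, P i.succ) ↪o Σ i, P i) ?_⟩
  rintro ⟨i, x⟩
  induction i using Fin.cases with
  | zero => exact ⟨.inl x, rfl⟩
  | succ i => exact ⟨.inr ⟨i, x⟩, rfl⟩

theorem Shape.of_sigma_fin_succ [∀ i, Finite (P i)] :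
    of (Σ i, P i) = of (P 0) + of (Σ i : Fin k, P i.succ) :=
  (of_eq_of.2 (nonempty_sumIsoSigmaFin P)).symm

theorem Shape.of_sigma_fin_zero (P : Fin 0 → Type) [∀ i, PartialOrder (P i)] [∀ i, Finite (P i)] :
    of (Σ i, P i) = 0 := (of_eq_zero_iff _).2 ⟨fun x => x.1.elim0⟩

end SigmaFin

/-! ### Isomorphism classes of marked trees, decomposed at the root -/

namespace FinRootedTree

instance finite_vertex : (T : FinRootedTree) → Finite T.Vertex
  | node _ child =>
    letI := fun i => finite_vertex (child i)
    inferInstanceAs (Finite (Option (Σ i, (child i).Vertex)))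

/-- The marked tree with given branches at the root. -/
def MarkedTree.node (b : Bool) {k : ℕ} (c : Fin k → MarkedTree) : MarkedTree :=
  ⟨.node k fun i => (c i).tree, nodeSet b fun i => (c i).original⟩

theorem MarkedTree.exists_eq_node (t : MarkedTree) :
    ∃ (b : Bool) (k : ℕ) (c : Fin k → MarkedTree), t = MarkedTree.node b c := by
  classical
  obtain ⟨⟨k, child⟩, E⟩ := t
  let E' : Set (WithTop (Σ i, (child i).Vertex)) := E
  refine ⟨decide (⊤ ∈ E'), k, fun i => ⟨child i, {x | nodeEmb i x ∈ E'}⟩, ?_⟩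
  refine congrArg (MarkedTree.mk _) (Set.ext fun (x : WithTop (Σ i, (child i).Vertex)) => ?_)
  rcases nodeEmb_eq_or_eq_top x with rfl | ⟨i, y, rfl⟩
  · exact (decide_eq_true_iff (p := ⊤ ∈ E')).symm
  · exact Iff.rfl

instance markedSetoid : Setoid MarkedTree where
  r t t' := MarkedIso t.original t'.original
  iseqv := ⟨fun _ => .refl _, .symm, .trans⟩

theorem MarkedTree.node_equiv_iff {b b' : Bool} {k k' : ℕ} {c : Fin k → MarkedTree}
    {c' : Fin k' → MarkedTree} : MarkedTree.node b c ≈ MarkedTree.node b' c' ↔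
      b = b' ∧ ∃ σ : Fin k ≃ Fin k', ∀ i, c i ≈ c' (σ i) :=
  markedIso_nodeSet_iff (P := fun i => (c i).tree.Vertex) (Q := fun i => (c' i).tree.Vertex)
    (E := fun i => (c i).original) (E' := fun i => (c' i).original)

/-- Isomorphism classes of trees with distinguished vertices. -/
def TreeClass : Type := Quotient markedSetoid

theorem isBinary_of_orderIso {T T' : FinRootedTree} (e : T.Vertex ≃o T'.Vertex) (h : T.IsBinary) :
    T'.IsBinary := fun y => by
  obtain ⟨x, rfl⟩ := e.surjective y
  rw [outDegree_orderIso]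
  exact h x

theorem isBinary_node {k : ℕ} {c : Fin k → FinRootedTree} :
    (node k c).IsBinary ↔ (k = 0 ∨ k = 2) ∧ ∀ i, (c i).IsBinary := by
  have htop : outDegree (⊤ : WithTop (Σ i, (c i).Vertex)) = k := by
    rw [outDegree_top_node, Fintype.card_fin]
  constructor
  · intro h
    exact ⟨htop ▸ h ⊤, fun i x => (outDegree_nodeEmb (P := fun i => (c i).Vertex) i x) ▸
      h (nodeEmb (P := fun i => (c i).Vertex) i x)⟩
  · rintro ⟨h, h'⟩ (x : WithTop (Σ i, (c i).Vertex))
    rcases nodeEmb_eq_or_eq_top x with rfl | ⟨i, y, rfl⟩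
    · exact htop.symm ▸ h
    · exact (outDegree_nodeEmb (P := fun i => (c i).Vertex) i y).symm ▸ h' i y

theorem size_node {k : ℕ} (c : Fin k → FinRootedTree) :
    (node k c).size = 1 + ∑ i, (c i).size := by
  change Nat.card (Option (Σ i, (c i).Vertex)) = _
  rw [Finite.card_option, Nat.card_sigma, Nat.add_comm]; rfl

open scoped Classical in
theorem MarkedTree.numSymmetryNodes_node (b : Bool) {k : ℕ} (c : Fin k → MarkedTree) :
    (MarkedTree.node b c).numSymmetryNodes =
      (if ∃ i j, i ≠ j ∧ MarkedIso (c i).original (c j).original then 1 else 0) +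
        ∑ i, (c i).numSymmetryNodes := by
  change {x | IsSymmetric (nodeSet b fun i => (c i).original) x}.ncard = _
  rw [ncard_setOf_node]
  congr 1
  · exact if_congr isSymmetric_top_node rfl rfl
  · refine Finset.sum_congr rfl fun i _ => ?_
    exact congrArg Set.ncard (Set.ext fun x => isSymmetric_apply_iff
      (nodeEmb (P := fun i => (c i).tree.Vertex) i) (isLowerSet_range_nodeEmb i)
      (E' := nodeSet b fun i => (c i).original) (fun _ => Iff.rfl) x)

namespace TreeClass

/-- The isomorphism class of a marked tree. -/
def mk (t : MarkedTree) : TreeClass := Quotient.mk markedSetoid t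

theorem mk_eq_mk {t t' : MarkedTree} : mk t = mk t' ↔ MarkedIso t.original t'.original :=
  Quotient.eq

theorem exists_mk (q : TreeClass) : ∃ t, q = mk t := (Quotient.exists_rep q).imp fun _ => Eq.symm

theorem mk_node_eq_iff {b b' : Bool} {k k' : ℕ} {c : Fin k → MarkedTree}
    {c' : Fin k' → MarkedTree} : mk (.node b c) = mk (.node b' c') ↔
      b = b' ∧ ∃ σ : Fin k ≃ Fin k', ∀ i, mk (c i) = mk (c' (σ i)) := by
  simp only [mk_eq_mk]
  exact MarkedTree.node_equiv_iff

/-- The number of vertices. -/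
noncomputable def size : TreeClass → ℕ :=
  Quotient.lift (fun t => t.tree.size) fun _ _ ⟨φ, _⟩ => Nat.card_congr φ.toEquiv

/-- The poset of marked vertices. -/
def shape : TreeClass → Shape :=
  Quotient.lift (fun t => Shape.of t.original) fun _ _ h =>
    Shape.of_eq_of.2 (MarkedIso.nonempty_orderIso h)

/-- All vertices have no or two children. -/
def IsBinary : TreeClass → Prop :=
  Quotient.lift (fun t => t.tree.IsBinary) fun _ _ ⟨φ, _⟩ =>
    propext ⟨isBinary_of_orderIso φ, isBinary_of_orderIso φ.symm⟩

/-- Unmarked vertices have two children; marked vertices have two children, or less if there are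
less than two marked vertices covered by them in the poset of marked vertices. -/
def IsBinarization : TreeClass → Prop :=
  Quotient.lift (fun t => IsBinarized t.original) fun _ _ h =>
    propext ⟨h.isBinarized, (MarkedIso.symm h).isBinarized⟩

/-- The number of symmetry nodes. -/
noncomputable def symmetry : TreeClass → ℕ :=
  Quotient.lift (fun t => t.numSymmetryNodes) fun _ _ h => MarkedIso.ncard_isSymmetric h

/-- A single vertex. -/
def leaf (b : Bool) : TreeClass := mk (.node b ![])

/-- A root with one branch. -/
def unary (b : Bool) : TreeClass → TreeClass :=
  Quotient.map (fun t => .node b ![t]) fun _ _ h =>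
    MarkedTree.node_equiv_iff.2 ⟨rfl, Equiv.refl _, fun i => by
      obtain rfl := Subsingleton.elim i 0; exact h⟩

/-- A root with two ordered branches. -/
def pair (b : Bool) : TreeClass → TreeClass → TreeClass :=
  Quotient.map₂ (fun t t' => .node b ![t, t']) fun _ _ h _ _ h' =>
    MarkedTree.node_equiv_iff.2 ⟨rfl, Equiv.refl _, fun i => by
      refine Fin.cases h (fun i => ?_) i
      obtain rfl := Subsingleton.elim i 0
      exact h'⟩

theorem mk_pair_eq_iff {b b' : Bool} {t₁ t₂ t₁' t₂' : MarkedTree} :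
    mk (.node b ![t₁, t₂]) = mk (.node b' ![t₁', t₂']) ↔
      b = b' ∧ (mk t₁ = mk t₁' ∧ mk t₂ = mk t₂' ∨ mk t₁ = mk t₂' ∧ mk t₂ = mk t₁') := by
  rw [mk_node_eq_iff]
  refine and_congr_right fun _ => ⟨?_, ?_⟩
  · rintro ⟨σ, h⟩
    have h0 := h 0
    have h1 := h 1
    have hne : σ 0 ≠ σ 1 := σ.injective.ne (by decide)
    generalize σ 0 = i at *
    generalize σ 1 = j at *
    fin_cases i <;> fin_cases j <;> simp_all
  · rintro (⟨h1, h2⟩ | ⟨h1, h2⟩)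
    · exact ⟨Equiv.refl _, fun i => by fin_cases i <;> simpa⟩
    · exact ⟨Equiv.swap 0 1, fun i => by fin_cases i <;> simpa⟩

theorem pair_eq_iff {b b' : Bool} {q₁ q₂ q₁' q₂' : TreeClass} :
    pair b q₁ q₂ = pair b' q₁' q₂' ↔ b = b' ∧ s(q₁, q₂) = s(q₁', q₂') := by
  obtain ⟨t₁, rfl⟩ := q₁.exists_mk
  obtain ⟨t₂, rfl⟩ := q₂.exists_mk
  obtain ⟨t₁', rfl⟩ := q₁'.exists_mk
  obtain ⟨t₂', rfl⟩ := q₂'.exists_mk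
  rw [Sym2.eq_iff]
  exact mk_pair_eq_iff

/-- A root with two branches. -/
def binary (b : Bool) : Sym2 TreeClass → TreeClass :=
  Sym2.lift ⟨pair b, fun _ _ => pair_eq_iff.2 ⟨rfl, Sym2.eq_swap⟩⟩

/-- The trees whose root has at most two branches. -/
def ofRoot (x : Bool × (Unit ⊕ TreeClass ⊕ Sym2 TreeClass)) : TreeClass :=
  Sum.elim (fun _ => leaf x.1) (Sum.elim (unary x.1) (binary x.1)) x.2

/-- The mark of the root and the multiset of branches are isomorphism invariants. Injectivity allows
sums over trees to be split according to the root without overcounting. -/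
theorem ofRoot_injective : Function.Injective ofRoot := by
  have hk {b b' : Bool} {k k' : ℕ} {c : Fin k → MarkedTree} {c' : Fin k' → MarkedTree}
      (h : mk (.node b c) = mk (.node b' c')) : k = k' := by
    obtain ⟨_, σ, _⟩ := mk_node_eq_iff.1 h
    simpa using Fintype.card_congr σ
  rintro ⟨b, _ | q | s⟩ ⟨b', _ | q' | s'⟩ h
  · obtain rfl := (mk_node_eq_iff.1 h).1
    rfl
  · obtain ⟨t', rfl⟩ := q'.exists_mk
    exact absurd (hk h) (by decide)
  · induction s' with | _ q₁' q₂'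
    obtain ⟨t₁', rfl⟩ := q₁'.exists_mk
    obtain ⟨t₂', rfl⟩ := q₂'.exists_mk
    exact absurd (hk h) (by decide)
  · obtain ⟨t, rfl⟩ := q.exists_mk
    exact absurd (hk h) (by decide)
  · obtain ⟨t, rfl⟩ := q.exists_mk
    obtain ⟨t', rfl⟩ := q'.exists_mk
    obtain ⟨rfl, σ, h⟩ := mk_node_eq_iff.1 h
    have := h 0
    obtain h0 : σ 0 = 0 := Subsingleton.elim _ _
    rw [h0] at this
    exact congrArg (fun q => (b, Sum.inr (Sum.inl q))) this
  · obtain ⟨t, rfl⟩ := q.exists_mk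
    induction s' with | _ q₁' q₂'
    obtain ⟨t₁', rfl⟩ := q₁'.exists_mk
    obtain ⟨t₂', rfl⟩ := q₂'.exists_mk
    exact absurd (hk h) (by decide)
  · induction s with | _ q₁ q₂
    obtain ⟨t₁, rfl⟩ := q₁.exists_mk
    obtain ⟨t₂, rfl⟩ := q₂.exists_mk
    exact absurd (hk h) (by decide)
  · induction s with | _ q₁ q₂
    obtain ⟨t₁, rfl⟩ := q₁.exists_mk
    obtain ⟨t₂, rfl⟩ := q₂.exists_mk
    obtain ⟨t', rfl⟩ := q'.exists_mk
    exact absurd (hk h) (by decide)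
  · induction s with | _ q₁ q₂
    induction s' with | _ q₁' q₂'
    obtain ⟨hb, hs⟩ := pair_eq_iff.1 h
    exact Prod.ext hb (congrArg (fun s => Sum.inr (Sum.inr s)) hs)

theorem mk_node_zero (b : Bool) (c : Fin 0 → MarkedTree) : mk (.node b c) = leaf b := by
  rw [leaf, Subsingleton.elim c ![]]

theorem mk_node_one (b : Bool) (c : Fin 1 → MarkedTree) :
    mk (.node b c) = unary b (mk (c 0)) := by
  have : c = ![c 0] := by ext i; rw [Subsingleton.elim i 0]; rfl
  rw [this]; rfl

theorem mk_node_two (b : Bool) (c : Fin 2 → MarkedTree) :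
    mk (.node b c) = binary b s(mk (c 0), mk (c 1)) := by
  have : c = ![c 0, c 1] := by funext i; fin_cases i <;> rfl
  conv_lhs => rw [this]
  rfl

theorem size_leaf (b : Bool) : (leaf b).size = 1 :=
  (size_node _).trans (by simp)

theorem size_binary (b : Bool) (q q' : TreeClass) :
    (binary b s(q, q')).size = 1 + q.size + q'.size := by
  obtain ⟨t, rfl⟩ := q.exists_mk
  obtain ⟨t', rfl⟩ := q'.exists_mk
  exact (size_node _).trans (by rw [Fin.sum_univ_two, Nat.add_assoc]; rfl)

theorem size_pos (q : TreeClass) : 0 < q.size := by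
  obtain ⟨t, rfl⟩ := q.exists_mk
  exact Nat.card_pos (α := t.tree.Vertex)

theorem shape_mk_node (b : Bool) {k : ℕ} (c : Fin k → MarkedTree) :
    (mk (.node b c)).shape = if b then (Shape.of (Σ i, (c i).original)).withTop
      else Shape.of (Σ i, (c i).original) := by
  cases b
  · exact (Shape.of_eq_of.2 ⟨nodeSetFalseIso fun i => (c i).original⟩).symm
  · exact (Shape.of_eq_of.2 ⟨nodeSetTrueIso fun i => (c i).original⟩).symm

theorem of_sigma_zero (c : Fin 0 → MarkedTree) : Shape.of (Σ i, (c i).original) = 0 :=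
  Shape.of_sigma_fin_zero _

theorem of_sigma_one (c : Fin 1 → MarkedTree) :
    Shape.of (Σ i, (c i).original) = (mk (c 0)).shape := by
  rw [Shape.of_sigma_fin_succ (fun i => ((c i).original : Type)), Shape.of_sigma_fin_zero,
    Shape.add_zero]
  rfl

theorem of_sigma_two (c : Fin 2 → MarkedTree) :
    Shape.of (Σ i, (c i).original) = (mk (c 0)).shape + (mk (c 1)).shape := by
  rw [Shape.of_sigma_fin_succ (fun i => ((c i).original : Type)),
    Shape.of_sigma_fin_succ (fun i : Fin 1 => ((c i.succ).original : Type)),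
    Shape.of_sigma_fin_zero, Shape.add_zero]
  rfl

theorem shape_leaf (b : Bool) : (leaf b).shape = if b then Shape.withTop 0 else 0 := by
  rw [leaf, shape_mk_node, of_sigma_zero]

theorem shape_unary (b : Bool) (q : TreeClass) :
    (unary b q).shape = if b then q.shape.withTop else q.shape := by
  obtain ⟨t, rfl⟩ := q.exists_mk
  have := shape_mk_node b ![t]
  rw [of_sigma_one] at this
  exact this

theorem shape_binary (b : Bool) (q q' : TreeClass) :
    (binary b s(q, q')).shape = if b then (q.shape + q'.shape).withTop else q.shape + q'.shape := by
  obtain ⟨t, rfl⟩ := q.exists_mk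
  obtain ⟨t', rfl⟩ := q'.exists_mk
  have := shape_mk_node b ![t, t']
  rw [of_sigma_two] at this
  exact this

theorem isBinary_mk_node {b : Bool} {k : ℕ} {c : Fin k → MarkedTree} :
    (mk (.node b c)).IsBinary ↔ (k = 0 ∨ k = 2) ∧ ∀ i, (mk (c i)).IsBinary :=
  isBinary_node

theorem isBinary_leaf (b : Bool) : (leaf b).IsBinary :=
  isBinary_mk_node.2 ⟨.inl rfl, fun i => i.elim0⟩

theorem not_isBinary_unary (b : Bool) (q : TreeClass) : ¬ (unary b q).IsBinary := by
  obtain ⟨t, rfl⟩ := q.exists_mk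
  exact fun h => absurd (isBinary_mk_node.1 h).1 (by decide)

theorem isBinary_binary {b : Bool} {q q' : TreeClass} :
    (binary b s(q, q')).IsBinary ↔ q.IsBinary ∧ q'.IsBinary := by
  obtain ⟨t, rfl⟩ := q.exists_mk
  obtain ⟨t', rfl⟩ := q'.exists_mk
  refine (isBinary_mk_node (b := b) (c := ![t, t'])).trans ?_
  simp [Fin.forall_fin_two]

theorem isBinarization_mk_node {b : Bool} {k : ℕ} {c : Fin k → MarkedTree} :
    (mk (.node b c)).IsBinarization ↔
      (k = if b then min 2 (Shape.of (Σ i, (c i).original)).tops else 2) ∧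
        ∀ i, (mk (c i)).IsBinarization := by
  refine (isBinarized_nodeSet (b := b) (E := fun i => (c i).original)).trans ?_
  rw [Fintype.card_fin]
  rfl

theorem isBinarization_leaf {b : Bool} : (leaf b).IsBinarization ↔ b = true := by
  rw [leaf, isBinarization_mk_node, of_sigma_zero, Shape.tops_zero]
  cases b <;> simp

theorem isBinarization_unary {b : Bool} {q : TreeClass} :
    (unary b q).IsBinarization ↔ b = true ∧ q.shape.tops = 1 ∧ q.IsBinarization := by
  obtain ⟨t, rfl⟩ := q.exists_mk
  have := isBinarization_mk_node (b := b) (c := ![t])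
  rw [of_sigma_one] at this
  refine this.trans ?_
  cases b
  · simp
  · simp only [if_true, Matrix.cons_val_zero, true_and]
    refine and_congr ⟨fun h => by omega, fun h => by omega⟩ ⟨fun h => h 0, fun h i => ?_⟩
    rw [Subsingleton.elim i 0]; exact h

theorem isBinarization_binary {b : Bool} {q q' : TreeClass} :
    (binary b s(q, q')).IsBinarization ↔ (b = true → 2 ≤ (q.shape + q'.shape).tops) ∧
      q.IsBinarization ∧ q'.IsBinarization := by
  obtain ⟨t, rfl⟩ := q.exists_mk
  obtain ⟨t', rfl⟩ := q'.exists_mk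
  have := isBinarization_mk_node (b := b) (c := ![t, t'])
  rw [of_sigma_two] at this
  refine this.trans ?_
  simp only [Fin.forall_fin_two]
  refine and_congr ?_ Iff.rfl
  cases b
  · simp
  · simp only [if_true, true_implies]
    exact ⟨fun h => by have := h; simp at this; omega, fun h => by simp; omega⟩

theorem exists_eq_of_isBinary {q : TreeClass} (h : q.IsBinary) : q ∈ Set.range ofRoot := by
  obtain ⟨t, rfl⟩ := q.exists_mk
  obtain ⟨b, k, c, rfl⟩ := t.exists_eq_node
  rcases (isBinary_mk_node.1 h).1 with rfl | rfl
  · exact ⟨(b, .inl ()), (mk_node_zero b c).symm⟩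
  · exact ⟨(b, .inr (.inr s(mk (c 0), mk (c 1)))), (mk_node_two b c).symm⟩

theorem exists_eq_of_isBinarization {q : TreeClass} (h : q.IsBinarization) :
    q ∈ Set.range ofRoot := by
  obtain ⟨t, rfl⟩ := q.exists_mk
  obtain ⟨b, k, c, rfl⟩ := t.exists_eq_node
  have hk := (isBinarization_mk_node.1 h).1
  have : k ≤ 2 := by
    cases b
    · exact hk.le
    · exact hk.le.trans (min_le_left _ _)
  interval_cases k
  · exact ⟨(b, .inl ()), (mk_node_zero b c).symm⟩
  · exact ⟨(b, .inr (.inl (mk (c 0)))), (mk_node_one b c).symm⟩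
  · exact ⟨(b, .inr (.inr s(mk (c 0), mk (c 1)))), (mk_node_two b c).symm⟩

/-- A leaf of the tree does not have two children, so it cannot be unmarked. -/
theorem IsBinarization.shape_ne_zero {q : TreeClass} (h : q.IsBinarization) : q.shape ≠ 0 := by
  obtain ⟨⟨T, E⟩, rfl⟩ := q.exists_mk
  intro h0
  have hE := (Shape.of_eq_zero_iff _).1 h0
  obtain ⟨x, hx⟩ := Set.Finite.exists_minimal (Set.finite_univ (α := T.Vertex)) Set.univ_nonempty
  have hx0 : outDegree x = 0 := (outDegree_eq_zero_iff x).2 fun y hy => hx.2 trivial hy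
  have := h.1 x fun hxE => hE.false ⟨x, hxE⟩
  omega

theorem symmetry_leaf (b : Bool) : (leaf b).symmetry = 0 :=
  (MarkedTree.numSymmetryNodes_node b ![]).trans (by simp)

theorem symmetry_unary (b : Bool) (q : TreeClass) : (unary b q).symmetry = q.symmetry := by
  obtain ⟨t, rfl⟩ := q.exists_mk
  refine (MarkedTree.numSymmetryNodes_node b ![t]).trans ?_
  rw [if_neg (fun ⟨i, j, h, _⟩ => h (Subsingleton.elim _ _)), Fin.sum_univ_one, Nat.zero_add]
  rfl

open scoped Classical in
theorem symmetry_binary (b : Bool) (q q' : TreeClass) :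
    (binary b s(q, q')).symmetry = (if q = q' then 1 else 0) + q.symmetry + q'.symmetry := by
  obtain ⟨t, rfl⟩ := q.exists_mk
  obtain ⟨t', rfl⟩ := q'.exists_mk
  refine (MarkedTree.numSymmetryNodes_node b ![t, t']).trans ?_
  rw [Fin.sum_univ_two, ← Nat.add_assoc]
  refine congrArg₂ _ (congrArg₂ _ (if_congr ?_ rfl rfl) rfl) rfl
  rw [mk_eq_mk]
  constructor
  · rintro ⟨i, j, hne, h⟩
    fin_cases i <;> fin_cases j
    · exact absurd rfl hne
    · exact h
    · exact h.symm
    · exact absurd rfl hne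
  · intro h
    exact ⟨0, 1, by decide, h⟩

end TreeClass

end FinRootedTree

/-! ### Sums over unordered pairs -/

section Sym2Sum

variable {X M : Type*}

-- An unordered pair comes from one ordered pair on the diagonal and from two off it.
open scoped Classical in
theorem HasSum.sym2 [AddCommMonoid M] [TopologicalSpace M] [ContinuousAdd M] [RegularSpace M]
    {h : Sym2 X → M} {a : M} (hs : HasSum (fun p : X × X => h s(p.1, p.2)) a) :
    HasSum (fun s => (if s.IsDiag then 1 else 2) • h s) a := by
  refine HasSum.sigma (((Equiv.sigmaFiberEquiv fun p : X × X => s(p.1, p.2)).hasSum_iff).2 hs)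
    fun s => ?_
  induction s with | _ x y
  have hfib : {p : X × X | s(p.1, p.2) = s(x, y)} = {(x, y), (y, x)} := by
    ext ⟨u, v⟩; simp
  have hfin : Finite {p : X × X // s(p.1, p.2) = s(x, y)} :=
    Set.Finite.to_subtype (s := {p : X × X | s(p.1, p.2) = s(x, y)}) (hfib ▸ Set.toFinite _)
  have := Fintype.ofFinite {p : X × X // s(p.1, p.2) = s(x, y)}
  have hcard : Fintype.card {p : X × X // s(p.1, p.2) = s(x, y)} = if x = y then 1 else 2 := by
    rw [← Nat.card_eq_fintype_card]
    change Set.ncard {p : X × X | s(p.1, p.2) = s(x, y)} = _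
    rw [hfib]
    split_ifs with hxy
    · subst hxy; simp
    · exact Set.ncard_pair fun e => hxy (Prod.ext_iff.1 e).1
  have hconst (p : {p : X × X // s(p.1, p.2) = s(x, y)}) :
      ((fun p : X × X => h s(p.1, p.2)) ∘ (Equiv.sigmaFiberEquiv fun p : X × X => s(p.1, p.2)))
        ⟨s(x, y), p⟩ = h s(x, y) := by
    have := p.2
    simp only [Function.comp_apply, Equiv.sigmaFiberEquiv_apply]
    rw [this]
  simp only [hconst]
  convert hasSum_fintype fun _ : {p : X × X // s(p.1, p.2) = s(x, y)} => h s(x, y) using 1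
  rw [Finset.sum_const, Finset.card_univ, hcard]
  simp only [Sym2.mk_isDiag_iff]

variable {𝕜 : Type*} [RCLike 𝕜]

open scoped Classical in
theorem Summable.of_sym2 {h : Sym2 X → 𝕜} (hs : Summable fun p : X × X => h s(p.1, p.2)) :
    Summable h := by
  have h1 := hs.norm.hasSum.sym2 (h := fun s => ‖h s‖)
  refine Summable.of_norm_bounded h1.summable fun s => ?_
  split_ifs
  · simp
  · rw [two_nsmul]; linarith [norm_nonneg (h s)]

-- Adding the diagonal once more makes every unordered pair count twice. This is the origin of the
-- combination V(z)² + V(z²).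
open scoped Classical in
theorem two_mul_tsum_sym2 {h : Sym2 X → 𝕜} (hs : Summable fun p : X × X => h s(p.1, p.2)) :
    2 * ∑' s, h s = ∑' p : X × X, h s(p.1, p.2) + ∑' x, h s(x, x) := by
  have h1 := hs.hasSum.sym2
  have h2 : Summable h := hs.of_sym2
  have h3 : ∑' x, h s(x, x) = ∑' s, if s.IsDiag then h s else 0 := by
    rw [← Sym2.diag_injective.tsum_eq (f := fun s => if s.IsDiag then h s else 0)]
    · simp [Sym2.diag]
    · intro s hs'
      have : s.IsDiag := by by_contra hn; simp [hn] at hs'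
      exact ⟨s.diagElem this, Sym2.diag_diagElem this⟩
  have h4 : Summable fun s : Sym2 X => if s.IsDiag then h s else 0 :=
    Summable.of_norm_bounded h2.norm fun s => by split_ifs <;> simp
  rw [h3, ← h1.tsum_eq, ← h1.summable.tsum_add h4, ← tsum_mul_left]
  refine tsum_congr fun s => ?_
  split_ifs
  · rw [one_nsmul, two_mul]
  · rw [two_nsmul, two_mul, add_zero]

end Sym2Sum

/-! ### Weighted sums over trees with a prescribed marked poset -/

namespace FinRootedTree.TreeClass

variable {𝕜 : Type*} [RCLike 𝕜]

open scoped Classical in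
/-- The restriction of a weight to the trees whose marked vertices form a given poset. -/
noncomputable def restr (w : TreeClass → 𝕜) (F : Shape) (q : TreeClass) : 𝕜 :=
  if q.shape = F then w q else 0

/-- The total weight of the trees whose marked vertices form a given poset. -/
noncomputable def total (w : TreeClass → 𝕜) (F : Shape) : 𝕜 := ∑' q, restr w F q

/-- The disjoint union of the posets of marked vertices of two trees. -/
def pairShape : Sym2 TreeClass → Shape :=
  Sym2.lift ⟨fun q q' => q.shape + q'.shape, fun _ _ => Shape.add_comm _ _⟩

/-- The product of the weights of two trees. -/
def pairWeight (w : TreeClass → 𝕜) : Sym2 TreeClass → 𝕜 :=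
  Sym2.lift ⟨fun q q' => w q * w q', fun _ _ => mul_comm _ _⟩

open scoped Classical in
/-- The restriction of the product of weights to pairs of trees with given marked vertices. -/
noncomputable def pairRestr (w : TreeClass → 𝕜) (F : Shape) (s : Sym2 TreeClass) : 𝕜 :=
  if pairShape s = F then pairWeight w s else 0

/-- Only the decomposition into the two actual shapes contributes, so the condition on a sum of
shapes becomes a finite sum of products of separate conditions. -/
theorem pairRestr_mk (w : TreeClass → 𝕜) (F : Shape) (q q' : TreeClass) :
    pairRestr w F s(q, q') = ∑ p ∈ Shape.antidiag F, restr w p.1 q * restr w p.2 q' := by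
  classical
  have h (p : Shape × Shape) : restr w p.1 q * restr w p.2 q' =
      if p = (q.shape, q'.shape) then w q * w q' else 0 := by
    obtain ⟨a, b⟩ := p
    simp only [restr, Prod.mk.injEq, eq_comm (a := a), eq_comm (a := b)]
    split_ifs <;> simp_all
  simp only [h, Finset.sum_ite_eq', Shape.mem_antidiag]
  rfl

open scoped Classical in
theorem pairRestr_diag (w : TreeClass → 𝕜) (F : Shape) (q : TreeClass) :
    pairRestr w F s(q, q) =
      ∑ p ∈ Shape.antidiag F with p.1 = p.2, restr (fun q => w q ^ 2) p.1 q := by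
  rw [pairRestr_mk, Finset.sum_filter]
  refine Finset.sum_congr rfl fun p _ => ?_
  simp only [restr]
  split_ifs <;> simp_all [sq]

section

variable {w : TreeClass → 𝕜} {F : Shape}

theorem summable_restr_sq {G : Shape} (h : Summable (restr w G)) :
    Summable (restr (fun q => w q ^ 2) G) := by
  have h1 := summable_mul_of_summable_norm h.norm h.norm
  refine (h1.comp_injective (i := fun q => (q, q)) fun _ _ e => (Prod.ext_iff.1 e).1).congr
    fun q => ?_
  simp only [Function.comp_apply, restr]
  split_ifs <;> simp [sq]

variable (hw : ∀ p ∈ Shape.antidiag F, Summable (restr w p.1) ∧ Summable (restr w p.2))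
include hw

theorem hasSum_pairRestr_mk :
    HasSum (fun p : TreeClass × TreeClass => pairRestr w F s(p.1, p.2))
      (∑ p ∈ Shape.antidiag F, total w p.1 * total w p.2) := by
  simp only [pairRestr_mk]
  refine hasSum_sum fun p hp => ?_
  obtain ⟨h1, h2⟩ := hw p hp
  have := summable_mul_of_summable_norm h1.norm h2.norm
  rw [total, total, tsum_mul_tsum_of_summable_norm h1.norm h2.norm]
  exact this.hasSum

theorem summable_pairRestr : Summable (pairRestr w F) := (hasSum_pairRestr_mk hw).summable.of_sym2

open scoped Classical in
theorem two_mul_tsum_pairRestr :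
    2 * ∑' s, pairRestr w F s = ∑ p ∈ Shape.antidiag F,
      (total w p.1 * total w p.2 + if p.1 = p.2 then total (fun q => w q ^ 2) p.1 else 0) := by
  rw [two_mul_tsum_sym2 (hasSum_pairRestr_mk hw).summable, (hasSum_pairRestr_mk hw).tsum_eq,
    Finset.sum_add_distrib]
  congr 1
  simp only [pairRestr_diag]
  rw [Summable.tsum_finsetSum fun p hp => ?_, Finset.sum_filter]
  · rfl
  · exact summable_restr_sq (hw p (Finset.mem_filter.1 hp).1).1

-- The factor 1/2 on the diagonal compensates exactly for its single preimage, leaving half the sum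
-- over ordered pairs and no squared weights. Symmetry nodes are weighted by 1/2 for this reason.
open scoped Classical in
theorem hasSum_ite_isDiag_pairRestr :
    HasSum (fun s : Sym2 TreeClass => (if s.IsDiag then 1 / 2 else 1) * pairRestr w F s)
      ((∑ p ∈ Shape.antidiag F, total w p.1 * total w p.2) / 2) := by
  convert (hasSum_pairRestr_mk hw).sym2.div_const 2 using 1
  funext s
  split_ifs
  · rw [one_nsmul]; ring
  · rw [two_nsmul]; ring

end

/-- The value of a function of `G` at a poset that arises from `G` by adjoining a maximum, and `0`
at other posets. -/
noncomputable def _root_.Shape.topPart (g : Shape → 𝕜) (F : Shape) : 𝕜 :=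
  open scoped Classical in if h : ∃ G, Shape.withTop G = F then g h.choose else 0

theorem _root_.Shape.topPart_withTop (g : Shape → 𝕜) (G : Shape) :
    Shape.topPart g G.withTop = g G := by
  have h : ∃ G', Shape.withTop G' = G.withTop := ⟨G, rfl⟩
  rw [Shape.topPart, dif_pos h, Shape.withTop_injective h.choose_spec]

theorem _root_.Shape.topPart_of_forall_ne {F : Shape} (g : Shape → 𝕜) (h : ∀ G, Shape.withTop G ≠ F) :
    Shape.topPart g F = 0 := by
  rw [Shape.topPart, dif_neg (by simpa using h)]

open scoped Classical in
/-- The total weight of the trees with a marked or unmarked root and given marked vertices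
different from the root. -/
noncomputable def body (w : TreeClass → 𝕜) (b : Bool) (G : Shape) : 𝕜 :=
  (if G = 0 then w (leaf b) else 0) +
    ((∑' q : TreeClass, if q.shape = G then w (unary b q) else 0) +
      ∑' s, if pairShape s = G then w (binary b s) else 0)

theorem shape_binary' (b : Bool) (s : Sym2 TreeClass) :
    (binary b s).shape = if b then (pairShape s).withTop else pairShape s := by
  induction s with | _ q q'
  exact shape_binary b q q'

/-- Trees are sorted by the mark and the branches of the root. An unmarked root leaves all of `F` to
the branches; a marked root is the maximum of `F`, so this part vanishes unless `F` has one. -/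
theorem total_eq {w : TreeClass → 𝕜} {F : Shape} (hsum : Summable (restr w F))
    (hw : ∀ q, w q ≠ 0 → q ∈ Set.range ofRoot) :
    total w F = body w false F + Shape.topPart (body w true) F := by
  classical
  have h1 : total w F = ∑' x, restr w F (ofRoot x) := by
    refine (ofRoot_injective.tsum_eq fun q hq => hw q fun h => hq ?_).symm
    simp [restr, h]
  have h2 : Summable fun x => restr w F (ofRoot x) := hsum.comp_injective ofRoot_injective
  have h3 (b : Bool) : Summable fun x => restr w F (ofRoot (b, x)) := h2.prod_factor b
  have h4 (b : Bool) : ∑' x, restr w F (ofRoot (b, x)) = restr w F (leaf b) +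
      (∑' q, restr w F (unary b q) + ∑' s, restr w F (binary b s)) := by
    have h5 : Summable fun x => restr w F (ofRoot (b, .inr x)) :=
      (h3 b).comp_injective Sum.inr_injective
    rw [Summable.tsum_sum ((h3 b).comp_injective Sum.inl_injective) h5,
      Summable.tsum_sum (h5.comp_injective Sum.inl_injective)
        (h5.comp_injective Sum.inr_injective)]
    congr 1
    exact tsum_eq_single () (fun b hb => absurd rfl hb)
  rw [h1, h2.tsum_prod, tsum_bool, h4, h4]
  congr 1
  · rw [body]
    refine congrArg₂ _ ?_ (congrArg₂ _ (tsum_congr fun q => ?_) (tsum_congr fun s => ?_))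
    · simp [restr, shape_leaf, eq_comm]
    · simp [restr, shape_unary]
    · simp [restr, shape_binary']
  · by_cases h : ∃ G, Shape.withTop G = F
    · obtain ⟨G, rfl⟩ := h
      rw [Shape.topPart_withTop, body]
      refine congrArg₂ _ ?_ (congrArg₂ _ (tsum_congr fun q => ?_) (tsum_congr fun s => ?_))
      · simp [restr, shape_leaf, Shape.withTop_injective.eq_iff, eq_comm]
      · simp [restr, shape_unary, Shape.withTop_injective.eq_iff]
      · simp [restr, shape_binary', Shape.withTop_injective.eq_iff]
    · rw [Shape.topPart_of_forall_ne _ fun G hG => h ⟨G, hG⟩]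
      have h6 (G : Shape) : Shape.withTop G ≠ F := fun hG => h ⟨G, hG⟩
      simp [restr, shape_leaf, shape_unary, shape_binary', h6]

end FinRootedTree.TreeClass

/-! ### Functional equations of the generating functions -/

namespace FinRootedTree.TreeClass

variable {𝕜 : Type*} [RCLike 𝕜]

open scoped Classical in
/-- The weight of a binary tree with `n` vertices is `z ^ n`. -/
noncomputable def binaryWeight (z : 𝕜) (q : TreeClass) : 𝕜 := if q.IsBinary then z ^ q.size else 0

open scoped Classical in
/-- The weight of a binary tree with `n ≤ N` vertices is `z ^ n`. -/
noncomputable def truncWeight (N : ℕ) (z : 𝕜) (q : TreeClass) : 𝕜 :=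
  if q.size ≤ N then binaryWeight z q else 0

theorem binaryWeight_sq (z : 𝕜) : (fun q => binaryWeight z q ^ 2) = binaryWeight (z ^ 2) := by
  funext q
  simp only [binaryWeight]
  split_ifs
  · rw [← pow_mul, ← pow_mul, mul_comm]
  · simp

theorem truncWeight_sq (N : ℕ) (z : 𝕜) :
    (fun q => truncWeight N z q ^ 2) = truncWeight N (z ^ 2) := by
  funext q
  simp only [truncWeight, ← binaryWeight_sq]
  split_ifs <;> simp

theorem binaryWeight_leaf (b : Bool) (z : 𝕜) : binaryWeight z (leaf b) = z := by
  rw [binaryWeight, if_pos (isBinary_leaf b), size_leaf, pow_one]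

theorem binaryWeight_unary (b : Bool) (z : 𝕜) (q : TreeClass) :
    binaryWeight z (unary b q) = 0 := if_neg (not_isBinary_unary b q)

theorem binaryWeight_binary (b : Bool) (z : 𝕜) (s : Sym2 TreeClass) :
    binaryWeight z (binary b s) = z * pairWeight (binaryWeight z) s := by
  induction s with | _ q q'
  change _ = z * (binaryWeight z q * binaryWeight z q')
  have hb : (binary b s(q, q')).IsBinary ↔ q.IsBinary ∧ q'.IsBinary := isBinary_binary
  rw [binaryWeight, size_binary, binaryWeight, binaryWeight]
  by_cases h : q.IsBinary
  · by_cases h' : q'.IsBinary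
    · rw [if_pos (hb.2 ⟨h, h'⟩), if_pos h, if_pos h']; ring
    · rw [if_neg fun h => h' (hb.1 h).2, if_neg h']; ring
  · rw [if_neg fun h' => h (hb.1 h').1, if_neg h]; ring

theorem mem_range_ofRoot_of_binaryWeight_ne_zero {z : 𝕜} {q : TreeClass}
    (h : binaryWeight z q ≠ 0) : q ∈ Set.range ofRoot :=
  exists_eq_of_isBinary (by by_contra hn; exact h (if_neg hn))

theorem mem_range_ofRoot_of_truncWeight_ne_zero {N : ℕ} {z : 𝕜} {q : TreeClass}
    (h : truncWeight N z q ≠ 0) : q ∈ Set.range ofRoot :=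
  mem_range_ofRoot_of_binaryWeight_ne_zero (z := z) fun h' => h (by simp [truncWeight, h'])

theorem finite_setOf_isBinary (N : ℕ) : {q : TreeClass | q.IsBinary ∧ q.size ≤ N}.Finite := by
  induction N with
  | zero =>
    convert Set.finite_empty
    exact Set.eq_empty_of_forall_notMem fun q hq => (size_pos q).ne' (Nat.le_zero.1 hq.2)
  | succ N ih =>
    refine ((Set.finite_range leaf).union
      ((((Set.finite_univ (α := Bool)).prod (ih.prod ih)).image
        fun x => binary x.1 s(x.2.1, x.2.2)))).subset ?_
    rintro q ⟨h, hN⟩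
    obtain ⟨⟨b, _ | q | s⟩, rfl⟩ := exists_eq_of_isBinary h
    · exact .inl ⟨b, rfl⟩
    · exact absurd h (not_isBinary_unary b q)
    · induction s with | _ q q'
      have h' := isBinary_binary.1 h
      have hN' : 1 + q.size + q'.size ≤ N + 1 := (size_binary b q q') ▸ hN
      exact .inr ⟨(b, q, q'), ⟨trivial, ⟨h'.1, show q.size ≤ N by omega⟩,
        ⟨h'.2, show q'.size ≤ N by omega⟩⟩, rfl⟩

theorem summable_restr_truncWeight (N : ℕ) (z : 𝕜) (F : Shape) :
    Summable (restr (truncWeight N z) F) := by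
  refine summable_of_hasFiniteSupport ((finite_setOf_isBinary N).subset fun q hq => ?_)
  simp only [restr, truncWeight, binaryWeight, Function.mem_support] at hq
  split_ifs at hq <;> simp_all

/-- The generating function of the binary trees with given marked vertices. -/
noncomputable def gen (F : Shape) (z : 𝕜) : 𝕜 := total (binaryWeight z) F

section Recursion

variable {z : 𝕜}

theorem body_binaryWeight (b : Bool) (G : Shape) [Decidable (G = 0)] :
    body (binaryWeight z) b G =
      (if G = 0 then z else 0) + z * ∑' s, pairRestr (binaryWeight z) G s := by
  simp only [body, binaryWeight_leaf, binaryWeight_unary, binaryWeight_binary, ite_self, tsum_zero,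
    zero_add, ← tsum_mul_left, pairRestr, mul_ite, mul_zero]

variable (hS : ∀ F : Shape, Summable (restr (binaryWeight z) F))
include hS

open scoped Classical in
theorem two_mul_tsum_pairRestr_binaryWeight (F : Shape) :
    2 * ∑' s, pairRestr (binaryWeight z) F s = ∑ p ∈ Shape.antidiag F,
      (gen p.1 z * gen p.2 z + if p.1 = p.2 then gen p.1 (z ^ 2) else 0) := by
  rw [two_mul_tsum_pairRestr fun p _ => ⟨hS _, hS _⟩, binaryWeight_sq]; rfl

theorem gen_eq (F : Shape) :
    gen F z = body (binaryWeight z) false F + Shape.topPart (body (binaryWeight z) true) F :=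
  total_eq (hS F) fun _ h => mem_range_ofRoot_of_binaryWeight_ne_zero h

theorem body_binaryWeight_zero (b : Bool) :
    body (binaryWeight z) b 0 = z + z / 2 * (gen 0 z ^ 2 + gen 0 (z ^ 2)) := by
  classical
  have h := two_mul_tsum_pairRestr_binaryWeight hS 0
  rw [Shape.antidiag_zero, Finset.sum_singleton, if_pos rfl] at h
  rw [body_binaryWeight, if_pos rfl, sq (gen 0 z), ← h]
  ring

theorem gen_zero : gen 0 z = z + z / 2 * (gen 0 z ^ 2 + gen 0 (z ^ 2)) := by
  rw [← body_binaryWeight_zero hS false]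
  conv_lhs => rw [gen_eq hS, Shape.topPart_of_forall_ne _ fun G => G.withTop_ne_zero, add_zero]

open scoped Classical in
theorem body_binaryWeight_of_ne_zero (b : Bool) {F : Shape} (hF : F ≠ 0) :
    body (binaryWeight z) b F = z * gen 0 z * gen F z +
      z / 2 * ∑ p ∈ Shape.properAntidiag F,
        (gen p.1 z * gen p.2 z + if p.1 = p.2 then gen p.1 (z ^ 2) else 0) := by
  have h := two_mul_tsum_pairRestr_binaryWeight hS F
  rw [Shape.sum_antidiag hF, if_neg (Ne.symm hF), if_neg hF] at h
  rw [body_binaryWeight, if_neg hF]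
  linear_combination z / 2 * h

open scoped Classical in
theorem gen_of_forall_withTop_ne {F : Shape} (hF : F ≠ 0) (h : ∀ G, Shape.withTop G ≠ F) :
    gen F z * (1 - z * gen 0 z) = z / 2 * ∑ p ∈ Shape.properAntidiag F,
        (gen p.1 z * gen p.2 z + if p.1 = p.2 then gen p.1 (z ^ 2) else 0) := by
  have h1 := gen_eq hS F
  rw [Shape.topPart_of_forall_ne _ h, body_binaryWeight_of_ne_zero hS _ hF] at h1
  linear_combination h1

/-- A poset with a maximum has only trivial decompositions, so the trees with an unmarked root
contribute just `z * gen 0 z * gen G.withTop z`. -/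
theorem gen_withTop (G : Shape) :
    gen G.withTop z * (1 - z * gen 0 z) = body (binaryWeight z) true G := by
  classical
  have h1 := gen_eq hS G.withTop
  rw [Shape.topPart_withTop, body_binaryWeight_of_ne_zero hS _ G.withTop_ne_zero,
    Shape.properAntidiag_withTop, Finset.sum_empty] at h1
  linear_combination h1

theorem gen_withTop_zero : gen (Shape.withTop 0) z * (1 - z * gen 0 z) = gen 0 z := by
  rw [gen_withTop hS, body_binaryWeight_zero hS, ← gen_zero hS]

/-- Below the marked root, the marked vertices have a maximum and hence lie in one branch; the other
branch is an arbitrary unmarked tree. -/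
theorem gen_withTop_withTop (G : Shape) :
    gen G.withTop.withTop z * (1 - z * gen 0 z) = z * gen 0 z * gen G.withTop z := by
  classical
  rw [gen_withTop hS, body_binaryWeight_of_ne_zero hS _ G.withTop_ne_zero,
    Shape.properAntidiag_withTop, Finset.sum_empty, mul_zero, add_zero]

/-- A tree with marked poset `F` has an unmarked root, as `F` has no maximum. Marking the root does
not change the weight, so the trees with a marked root over `F` have total weight `gen F z`. -/
theorem gen_withTop_of_forall_withTop_ne {F : Shape} (hF : F ≠ 0) (h : ∀ G, Shape.withTop G ≠ F) :
    gen F.withTop z * (1 - z * gen 0 z) = gen F z := by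
  classical
  rw [gen_withTop hS, body_binaryWeight_of_ne_zero hS _ hF,
    ← gen_of_forall_withTop_ne hS hF h]
  ring

end Recursion

/-! ### Convergence by truncation -/

section Summability

theorem binaryWeight_nonneg {x : ℝ} (hx : 0 ≤ x) (q : TreeClass) : 0 ≤ binaryWeight x q := by
  rw [binaryWeight]; split_ifs <;> positivity

theorem truncWeight_nonneg (N : ℕ) {x : ℝ} (hx : 0 ≤ x) (q : TreeClass) :
    0 ≤ truncWeight N x q := by
  rw [truncWeight]; split_ifs
  exacts [binaryWeight_nonneg hx q, le_rfl]

theorem truncWeight_le (N : ℕ) {x : ℝ} (hx : 0 ≤ x) (q : TreeClass) :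
    truncWeight N x q ≤ binaryWeight x q := by
  rw [truncWeight]; split_ifs
  exacts [le_rfl, binaryWeight_nonneg hx q]

theorem restr_nonneg {w : TreeClass → ℝ} (hw : ∀ q, 0 ≤ w q) (F : Shape) (q : TreeClass) :
    0 ≤ restr w F q := by
  rw [restr]; split_ifs
  exacts [hw q, le_rfl]

theorem restr_mono {w w' : TreeClass → ℝ} (hw : ∀ q, w q ≤ w' q) (F : Shape) (q : TreeClass) :
    restr w F q ≤ restr w' F q := by
  rw [restr, restr]; split_ifs
  exacts [hw q, le_rfl]

theorem total_nonneg {w : TreeClass → ℝ} (hw : ∀ q, 0 ≤ w q) (F : Shape) : 0 ≤ total w F :=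
  tsum_nonneg (restr_nonneg hw F)

theorem total_truncWeight_mono (N : ℕ) {x y : ℝ} (hx : 0 ≤ x) (hxy : x ≤ y) (F : Shape) :
    total (truncWeight N x) F ≤ total (truncWeight N y) F := by
  refine (summable_restr_truncWeight N x F).tsum_le_tsum (fun q => restr_mono (fun q => ?_) F q)
    (summable_restr_truncWeight N y F)
  simp only [truncWeight, binaryWeight]
  split_ifs <;> first | rfl | gcongr

/-- Both branches of a tree with at most `N + 1` vertices have at most `N`. The recursions thus
become inequalities between finite sums, and convergence can be proved rather than presupposed. -/
theorem truncWeight_succ_binary_le (N : ℕ) (b : Bool) {x : ℝ} (hx : 0 ≤ x) (s : Sym2 TreeClass) :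
    truncWeight (N + 1) x (binary b s) ≤ x * pairWeight (truncWeight N x) s := by
  induction s with | _ q q'
  rw [truncWeight, binaryWeight_binary, size_binary]
  change _ ≤ x * (truncWeight N x q * truncWeight N x q')
  split_ifs with h
  · rw [truncWeight, truncWeight, if_pos (by omega), if_pos (by omega)]
    rfl
  · have := truncWeight_nonneg N hx q
    have := truncWeight_nonneg N hx q'
    positivity

theorem summable_pairRestr_truncWeight (N : ℕ) (x : 𝕜) (F : Shape) :
    Summable (pairRestr (truncWeight N x) F) :=
  summable_pairRestr fun _ _ => ⟨summable_restr_truncWeight N x _, summable_restr_truncWeight N x _⟩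

open scoped Classical in
theorem body_truncWeight_succ_le (N : ℕ) (b : Bool) {x : ℝ} (hx : 0 ≤ x) (G : Shape) :
    body (truncWeight (N + 1) x) b G ≤
      (if G = 0 then x else 0) + x * ∑' s, pairRestr (truncWeight N x) G s := by
  have h1 : truncWeight (N + 1) x (leaf b) = x := by
    rw [truncWeight, size_leaf, if_pos (by omega), binaryWeight_leaf]
  have h2 (q) : truncWeight (N + 1) x (unary b q) = 0 := by
    rw [truncWeight, binaryWeight_unary, ite_self]
  simp only [body, h1, h2, ite_self, tsum_zero, zero_add, ← tsum_mul_left]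
  have h3 (s) : (if pairShape s = G then truncWeight (N + 1) x (binary b s) else 0) ≤
      x * pairRestr (truncWeight N x) G s := by
    rw [pairRestr]
    split_ifs
    · exact truncWeight_succ_binary_le N b hx s
    · simp
  have h4 := (summable_pairRestr_truncWeight N x G).mul_left x
  refine add_le_add le_rfl (Summable.tsum_le_tsum h3 (Summable.of_nonneg_of_le (fun s => ?_) h3 h4) h4)
  split_ifs
  exacts [truncWeight_nonneg _ hx _, le_rfl]

open scoped Classical in
theorem two_mul_tsum_pairRestr_truncWeight (N : ℕ) (x : 𝕜) (F : Shape) :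
    2 * ∑' s, pairRestr (truncWeight N x) F s = ∑ p ∈ Shape.antidiag F,
      (total (truncWeight N x) p.1 * total (truncWeight N x) p.2 +
        if p.1 = p.2 then total (truncWeight N (x ^ 2)) p.1 else 0) := by
  rw [two_mul_tsum_pairRestr fun p _ =>
    ⟨summable_restr_truncWeight N x _, summable_restr_truncWeight N x _⟩, truncWeight_sq]

theorem total_truncWeight_zero (x : 𝕜) (F : Shape) : total (truncWeight 0 x) F = 0 := by
  have (q : TreeClass) : ¬ q.size ≤ 0 := (size_pos q).not_ge
  simp [total, restr, truncWeight, this]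

theorem total_truncWeight_succ (N : ℕ) (x : 𝕜) (F : Shape) :
    total (truncWeight (N + 1) x) F = body (truncWeight (N + 1) x) false F +
      Shape.topPart (body (truncWeight (N + 1) x) true) F :=
  total_eq (summable_restr_truncWeight _ _ F) fun _ h => mem_range_ofRoot_of_truncWeight_ne_zero h

theorem total_truncWeight_succ_zero_le (N : ℕ) {x : ℝ} (hx : 0 ≤ x) :
    total (truncWeight (N + 1) x) 0 ≤
      x + x / 2 * (total (truncWeight N x) 0 ^ 2 + total (truncWeight N (x ^ 2)) 0) := by
  classical
  rw [total_truncWeight_succ, Shape.topPart_of_forall_ne _ fun G => G.withTop_ne_zero, add_zero]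
  refine (body_truncWeight_succ_le N false hx 0).trans ?_
  have h := two_mul_tsum_pairRestr_truncWeight N x 0
  rw [Shape.antidiag_zero, Finset.sum_singleton, if_pos rfl] at h
  rw [if_pos rfl, sq (total _ _), ← h]
  linarith

theorem summable_of_total_truncWeight_le {x c : ℝ} (hx : 0 ≤ x) {F : Shape}
    (h : ∀ N, total (truncWeight N x) F ≤ c) :
    Summable (restr (binaryWeight x) F) ∧ gen F x ≤ c := by
  have h0 := restr_nonneg (binaryWeight_nonneg hx) F
  have hle (u : Finset TreeClass) : ∑ q ∈ u, restr (binaryWeight x) F q ≤ c := by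
    refine le_trans ?_ (h (u.sup size))
    refine le_trans (Finset.sum_le_sum fun q hq => ?_)
      ((summable_restr_truncWeight (u.sup size) x F).sum_le_tsum u fun q _ =>
        restr_nonneg (truncWeight_nonneg _ hx) F q)
    simp only [restr, truncWeight, if_pos (Finset.le_sup (f := size) hq)]
    rfl
  exact ⟨summable_of_sum_le h0 hle, Real.tsum_le_of_sum_le h0 hle⟩

/-- The truncations start at 0 and are bounded step by step by the monotone map `y ↦ x + x / 2 * (y
^ 2 + v)`, so they stay below any nonnegative point that this map does not raise. -/
theorem total_truncWeight_le_of_supersolution {x y v : ℝ} (hx : 0 ≤ x) (hy : 0 ≤ y)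
    (hv : ∀ N, total (truncWeight N (x ^ 2)) 0 ≤ v) (h : x + x / 2 * (y ^ 2 + v) ≤ y) (N : ℕ) :
    total (truncWeight N x) 0 ≤ y := by
  induction N with
  | zero => rwa [total_truncWeight_zero]
  | succ N ih =>
    refine (total_truncWeight_succ_zero_le N hx).trans (le_trans ?_ h)
    have := total_nonneg (truncWeight_nonneg N hx) 0
    have := hv N
    gcongr

/-- The value 1 reproduces itself: 1/2 + (1/4)(1 + 1) = 1, where the truncation at 1/4 is bounded by
that at 1/2. -/
theorem total_truncWeight_half_le (N : ℕ) : total (truncWeight N (1 / 2 : ℝ)) 0 ≤ 1 := by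
  induction N with
  | zero => rw [total_truncWeight_zero]; norm_num
  | succ N ih =>
    refine (total_truncWeight_succ_zero_le N (by norm_num)).trans ?_
    have h1 := total_nonneg (truncWeight_nonneg N (x := (1 / 2 : ℝ)) (by norm_num)) 0
    have h2 := total_truncWeight_mono N (x := (1 / 2 : ℝ) ^ 2) (y := 1 / 2) (by norm_num)
      (by norm_num) 0
    nlinarith

variable {x v : ℝ} (hx : 0 ≤ x) (hx1 : x ≤ 1) (hv : ∀ N, total (truncWeight N x) 0 ≤ v)
  (hv1 : x * v < 1)
include hx hx1 hv hv1

/-- Induction on the cardinality of `F`. The proper decompositions and the marked root involve only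
smaller posets and contribute at most a constant c, while the two trivial decompositions give T(N+1)
≤ xv·T(N) + c. As xv < 1, the bound c/(1 - xv) propagates. -/
theorem exists_total_truncWeight_le (F : Shape) : ∃ c, ∀ N, total (truncWeight N x) F ≤ c := by
  classical
  have hT (N F) := total_nonneg (truncWeight_nonneg N hx) F
  have hsq (N F) : total (truncWeight N (x ^ 2)) F ≤ total (truncWeight N x) F :=
    total_truncWeight_mono N (by positivity) (by nlinarith) F
  induction hn : F.card using Nat.strong_induction_on generalizing F with | _ n ih
  subst hn
  by_cases hF : F = 0
  · subst hF; exact ⟨v, hv⟩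
  have hbd (G : Shape) (s : Finset (Shape × Shape))
      (hs : ∀ p ∈ s, p.1.card < F.card ∧ p.2.card < F.card) : ∃ c, 0 ≤ c ∧ ∀ N,
      ∑ p ∈ s, (total (truncWeight N x) p.1 * total (truncWeight N x) p.2 +
        if p.1 = p.2 then total (truncWeight N (x ^ 2)) p.1 else 0) ≤ c := by
    choose t ht using fun G hG => ih (Shape.card G) hG G rfl
    refine ⟨∑ p ∈ s.attach, (t p.1.1 (hs p.1 p.2).1 * t p.1.2 (hs p.1 p.2).2 + t p.1.1 (hs p.1 p.2).1),
      ?_, fun N => ?_⟩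
    · refine Finset.sum_nonneg fun p _ => ?_
      have h1 := (hT 0 _).trans (ht p.1.1 (hs p.1 p.2).1 0)
      have h2 := (hT 0 _).trans (ht p.1.2 (hs p.1 p.2).2 0)
      positivity
    · rw [← Finset.sum_attach s]
      refine Finset.sum_le_sum fun p _ => ?_
      have h0 := hT N p.1.1
      have h0' := hT N p.1.2
      have h1 := ht p.1.1 (hs p.1 p.2).1 N
      have h2 := ht p.1.2 (hs p.1 p.2).2 N
      have h3 := hsq N p.1.1
      have h4 : 0 ≤ t p.1.1 (hs p.1 p.2).1 := h0.trans h1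
      refine add_le_add (by gcongr) ?_
      split_ifs
      · exact h3.trans h1
      · exact h4
  obtain ⟨c₁, hc₁, h₁⟩ := hbd F (Shape.properAntidiag F) fun p hp =>
    Shape.card_lt_of_mem_properAntidiag hp
  obtain ⟨c₂, hc₂, h₂⟩ : ∃ c, 0 ≤ c ∧ ∀ N, Shape.topPart (body (truncWeight (N + 1) x) true) F ≤ c := by
    by_cases h : ∃ G, Shape.withTop G = F
    · obtain ⟨G, rfl⟩ := h
      obtain ⟨c, hc, h⟩ := hbd G (Shape.antidiag G) fun p hp => by
        rw [Shape.mem_antidiag] at hp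
        rw [Shape.card_withTop, ← hp, Shape.card_add]
        omega
      refine ⟨x + x / 2 * c, by positivity, fun N => ?_⟩
      rw [Shape.topPart_withTop]
      refine (body_truncWeight_succ_le N true hx G).trans ?_
      have h' := h N
      rw [← two_mul_tsum_pairRestr_truncWeight] at h'
      refine add_le_add (by split_ifs <;> simp [hx]) ?_
      nlinarith
    · refine ⟨0, le_rfl, fun N => ?_⟩
      rw [Shape.topPart_of_forall_ne _ fun G hG => h ⟨G, hG⟩]
  refine ⟨(x / 2 * c₁ + c₂) / (1 - x * v), fun N => ?_⟩
  have hpos : 0 < 1 - x * v := by linarith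
  induction N with
  | zero => rw [total_truncWeight_zero]; positivity
  | succ N ihN =>
    rw [total_truncWeight_succ]
    have h3 := body_truncWeight_succ_le N false hx F
    have h4 := two_mul_tsum_pairRestr_truncWeight N x F
    rw [Shape.sum_antidiag hF, if_neg (Ne.symm hF), if_neg hF] at h4
    rw [if_neg hF] at h3
    have h5 := h₁ N
    have h6 := h₂ N
    rw [le_div_iff₀ hpos] at ihN ⊢
    have h7 := hv N
    have h8 : x * (total (truncWeight N x) 0 * total (truncWeight N x) F) ≤
        x * v * total (truncWeight N x) F := by
      rw [mul_assoc]
      have := hT N F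
      gcongr
    have h9 : x * ∑' s, pairRestr (truncWeight N x) F s ≤
        x * v * total (truncWeight N x) F + x / 2 * c₁ := by
      nlinarith
    have h10 : body (truncWeight (N + 1) x) false F +
        Shape.topPart (body (truncWeight (N + 1) x) true) F ≤
        x * v * total (truncWeight N x) F + (x / 2 * c₁ + c₂) := by linarith
    have h11 : 0 ≤ x * v := mul_nonneg hx ((hT 0 0).trans (hv 0))
    nlinarith [mul_le_mul_of_nonneg_right h10 hpos.le, mul_le_mul_of_nonneg_left ihN h11]

theorem summable_restr_binaryWeight (F : Shape) : Summable (restr (binaryWeight x) F) := by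
  obtain ⟨c, hc⟩ := exists_total_truncWeight_le hx hx1 hv hv1 F
  exact (summable_of_total_truncWeight_le hx hc).1

end Summability

end FinRootedTree.TreeClass

/-! ### The symmetry constant and its recursion -/

namespace FinRootedTree.TreeClass

open scoped Classical in
/-- The weight of a binarization with `s` symmetry nodes is `(1 / 2) ^ s`. -/
noncomputable def symmetryWeight (q : TreeClass) : ℝ :=
  if q.IsBinarization then (1 / 2) ^ q.symmetry else 0

theorem symmetryWeight_nonneg (q : TreeClass) : 0 ≤ symmetryWeight q := by
  rw [symmetryWeight]; split_ifs <;> positivity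

theorem symmetryWeight_leaf (b : Bool) : symmetryWeight (leaf b) = if b then 1 else 0 := by
  simp [symmetryWeight, isBinarization_leaf, symmetry_leaf]

open scoped Classical in
theorem symmetryWeight_unary (b : Bool) (q : TreeClass) :
    symmetryWeight (unary b q) = if b = true ∧ q.shape.tops = 1 then symmetryWeight q else 0 := by
  simp only [symmetryWeight, isBinarization_unary, symmetry_unary, ← and_assoc]
  split_ifs <;> simp_all

open scoped Classical in
theorem symmetryWeight_binary (b : Bool) (s : Sym2 TreeClass) :
    symmetryWeight (binary b s) = if b = true → 2 ≤ (pairShape s).tops then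
      (if s.IsDiag then 1 / 2 else 1) * pairWeight symmetryWeight s else 0 := by
  induction s with | _ q q'
  have hb : (binary b s(q, q')).IsBinarization ↔
    (b = true → 2 ≤ (pairShape s(q, q')).tops) ∧ q.IsBinarization ∧ q'.IsBinarization :=
    isBinarization_binary
  have hp : pairWeight symmetryWeight s(q, q') = symmetryWeight q * symmetryWeight q' := rfl
  rw [symmetryWeight, symmetry_binary, hp]
  by_cases h : b = true → 2 ≤ (pairShape s(q, q')).tops
  · by_cases hq : q.IsBinarization
    · by_cases hq' : q'.IsBinarization
      · rw [if_pos (hb.2 ⟨h, hq, hq'⟩), if_pos h, symmetryWeight, symmetryWeight, if_pos hq,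
          if_pos hq']
        simp only [Sym2.mk_isDiag_iff]
        split_ifs <;> ring
      · rw [if_neg fun h => hq' (hb.1 h).2.2, symmetryWeight, symmetryWeight, if_neg hq']; simp
    · rw [if_neg fun h => hq (hb.1 h).2.1, symmetryWeight, if_neg hq]; simp
  · rw [if_neg fun h' => h (hb.1 h').1, if_neg h]

/-- The root of a unary tree is marked, and both branches of a binary root contain marked vertices;
in either case the branches have strictly fewer marked vertices than the whole tree. -/
theorem finite_setOf_isBinarization (N : ℕ) :
    {q : TreeClass | q.IsBinarization ∧ q.shape.card ≤ N}.Finite := by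
  induction N with
  | zero =>
    convert Set.finite_empty
    exact Set.eq_empty_of_forall_notMem fun q hq =>
      (Shape.card_pos hq.1.shape_ne_zero).ne' (Nat.le_zero.1 hq.2)
  | succ N ih =>
    refine ((Set.finite_range leaf).union ((ih.image (unary true)).union
      ((((Set.finite_univ (α := Bool)).prod (ih.prod ih)).image
        fun x => binary x.1 s(x.2.1, x.2.2))))).subset ?_
    rintro q ⟨h, hN⟩
    obtain ⟨⟨b, _ | q | s⟩, rfl⟩ := exists_eq_of_isBinarization h
    · exact .inl ⟨b, rfl⟩
    · obtain ⟨rfl, _, h'⟩ := isBinarization_unary.1 h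
      have hN' : (unary true q).shape.card ≤ N + 1 := hN
      rw [shape_unary, if_pos rfl, Shape.card_withTop] at hN'
      exact .inr (.inl ⟨q, ⟨h', show q.shape.card ≤ N by omega⟩, rfl⟩)
    · induction s with | _ q q'
      obtain ⟨_, h1, h2⟩ := isBinarization_binary.1 h
      have hN' : (binary b s(q, q')).shape.card ≤ N + 1 := hN
      have hle : q.shape.card + q'.shape.card ≤ N + 1 := by
        rw [← Shape.card_add]
        rw [shape_binary] at hN'
        split_ifs at hN'
        · rw [Shape.card_withTop] at hN'; omega
        · exact hN'
      have hp1 := Shape.card_pos h1.shape_ne_zero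
      have hp2 := Shape.card_pos h2.shape_ne_zero
      exact .inr (.inr ⟨(b, q, q'), ⟨trivial, ⟨h1, show q.shape.card ≤ N by omega⟩,
        ⟨h2, show q'.shape.card ≤ N by omega⟩⟩, rfl⟩)

theorem summable_restr_symmetryWeight (F : Shape) : Summable (restr symmetryWeight F) := by
  refine summable_of_hasFiniteSupport ((finite_setOf_isBinarization F.card).subset fun q hq => ?_)
  simp only [restr, symmetryWeight, Function.mem_support] at hq
  split_ifs at hq <;> simp_all

/-- The sum of `(1 / 2) ^ s` over the binarizations of a poset, where `s` is the number of symmetry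
nodes. -/
noncomputable def symmetrySum (F : Shape) : ℝ := total symmetryWeight F

theorem symmetrySum_nonneg (F : Shape) : 0 ≤ symmetrySum F := total_nonneg symmetryWeight_nonneg F

theorem symmetrySum_zero : symmetrySum 0 = 0 := by
  have (q : TreeClass) : restr symmetryWeight 0 q = 0 := by
    rw [restr, symmetryWeight]
    split_ifs with h1 h2
    · exact absurd h1 h2.shape_ne_zero
    · rfl
    · rfl
  simp [symmetrySum, total, this]

/-- Half the sum of products over all decompositions. -/
noncomputable def symmetryProd (F : Shape) : ℝ :=
  (∑ p ∈ Shape.antidiag F, symmetrySum p.1 * symmetrySum p.2) / 2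

open scoped Classical in
theorem hasSum_symmetryProd (F : Shape) :
    HasSum (fun s : Sym2 TreeClass => (if s.IsDiag then 1 / 2 else 1) *
      pairRestr symmetryWeight F s) (symmetryProd F) :=
  hasSum_ite_isDiag_pairRestr fun _ _ =>
    ⟨summable_restr_symmetryWeight _, summable_restr_symmetryWeight _⟩

/-- One part of each decomposition is then empty, and the empty poset has no binarization. -/
theorem symmetryProd_of_tops_lt {F : Shape} (h : F.tops < 2) : symmetryProd F = 0 := by
  rw [symmetryProd, Finset.sum_eq_zero, zero_div]
  intro p hp
  rw [Shape.mem_antidiag] at hp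
  by_cases h1 : p.1 = 0
  · rw [h1, symmetrySum_zero, zero_mul]
  by_cases h2 : p.2 = 0
  · rw [h2, symmetrySum_zero, mul_zero]
  have := Shape.tops_pos h1
  have := Shape.tops_pos h2
  have := Shape.tops_add p.1 p.2
  rw [hp] at this
  omega

theorem body_symmetryWeight_false (F : Shape) : body symmetryWeight false F = symmetryProd F := by
  classical
  rw [← (hasSum_symmetryProd F).tsum_eq]
  simp [body, symmetryWeight_leaf, symmetryWeight_unary, symmetryWeight_binary, pairRestr]

open scoped Classical in
theorem body_symmetryWeight_true (F : Shape) : body symmetryWeight true F =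
    (if F = 0 then 1 else 0) + ((if F.tops = 1 then symmetrySum F else 0) + symmetryProd F) := by
  rw [body]
  refine congrArg₂ _ (by simp [symmetryWeight_leaf]) (congrArg₂ _ ?_ ?_)
  · rw [symmetrySum, total]
    split_ifs with h
    · refine tsum_congr fun q => ?_
      rw [symmetryWeight_unary, restr]
      split_ifs <;> simp_all
    · rw [← tsum_zero (α := ℝ) (β := TreeClass)]
      refine tsum_congr fun q => ?_
      rw [symmetryWeight_unary]
      split_ifs <;> simp_all
  · by_cases h : F.tops < 2
    · rw [symmetryProd_of_tops_lt h, ← tsum_zero (α := ℝ) (β := Sym2 TreeClass)]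
      refine tsum_congr fun s => ?_
      rw [symmetryWeight_binary]
      by_cases h1 : pairShape s = F
      · subst h1
        rw [if_pos rfl, if_neg fun h2 => absurd (h2 rfl) (by omega)]
      · rw [if_neg h1, tsum_zero]
    · rw [← (hasSum_symmetryProd F).tsum_eq]
      refine tsum_congr fun s => ?_
      rw [symmetryWeight_binary, pairRestr]
      by_cases h1 : pairShape s = F
      · subst h1
        rw [if_pos rfl, if_pos rfl, if_pos fun _ => by omega]
      · rw [if_neg h1, if_neg h1, mul_zero]

theorem symmetrySum_eq (F : Shape) :
    symmetrySum F = symmetryProd F + Shape.topPart (body symmetryWeight true) F := by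
  rw [← body_symmetryWeight_false]
  refine total_eq (summable_restr_symmetryWeight F) fun q hq => exists_eq_of_isBinarization ?_
  by_contra hn
  exact hq (if_neg hn)

theorem symmetrySum_withTop_zero : symmetrySum (Shape.withTop 0) = 1 := by
  classical
  rw [symmetrySum_eq, Shape.topPart_withTop, body_symmetryWeight_true,
    symmetryProd_of_tops_lt (by rw [Shape.tops_withTop]; omega),
    symmetryProd_of_tops_lt (by rw [Shape.tops_zero]; omega), Shape.tops_zero]
  simp

theorem symmetrySum_of_forall_withTop_ne {F : Shape} (h : ∀ G, Shape.withTop G ≠ F) :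
    symmetrySum F = symmetryProd F := by
  rw [symmetrySum_eq, Shape.topPart_of_forall_ne _ h, add_zero]

/-- If `F` has a maximum, its binarizations become the single branch of the new root; otherwise
their unmarked root is turned into a marked one. Neither operation changes the number of symmetry
nodes. -/
theorem symmetrySum_withTop {F : Shape} (hF : F ≠ 0) :
    symmetrySum F.withTop = symmetrySum F := by
  classical
  rw [symmetrySum_eq, Shape.topPart_withTop, body_symmetryWeight_true,
    symmetryProd_of_tops_lt (by rw [Shape.tops_withTop]; omega), if_neg hF, zero_add, zero_add]
  by_cases h : ∃ G, Shape.withTop G = F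
  · obtain ⟨G, rfl⟩ := h
    rw [if_pos (Shape.tops_withTop G),
      symmetryProd_of_tops_lt (by rw [Shape.tops_withTop]; omega), add_zero]
  · have h' := symmetrySum_of_forall_withTop_ne fun G hG => h ⟨G, hG⟩
    rw [h']
    -- A finite poset with a single maximal element has a maximum, so the first case is void; it
    -- need not be excluded, since both sides vanish there.
    split_ifs with h1
    · rw [symmetryProd_of_tops_lt (by omega), add_zero]
    · rw [zero_add]

theorem symmetryProd_eq {F : Shape} (hF : F ≠ 0) : symmetryProd F =
    (∑ p ∈ Shape.properAntidiag F, symmetrySum p.1 * symmetrySum p.2) / 2 := by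
  rw [symmetryProd, Shape.sum_antidiag hF]
  simp [symmetrySum_zero]

theorem symmetryProd_le (F : Shape) : symmetryProd F ≤ symmetrySum F := by
  by_cases h : F.tops < 2
  · rw [symmetryProd_of_tops_lt h]; exact symmetrySum_nonneg F
  · refine (symmetrySum_of_forall_withTop_ne fun G hG => h ?_).ge
    rw [← hG, Shape.tops_withTop]; omega

theorem symmetrySum_add_pos {F G : Shape} (hF : 0 < symmetrySum F) (hG : 0 < symmetrySum G) :
    0 < symmetrySum (F + G) := by
  refine lt_of_lt_of_le ?_ (symmetryProd_le _)
  refine div_pos (lt_of_lt_of_le (mul_pos hF hG) ?_) two_pos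
  exact Finset.single_le_sum (f := fun p : Shape × Shape => symmetrySum p.1 * symmetrySum p.2)
    (fun p _ => mul_nonneg (symmetrySum_nonneg _) (symmetrySum_nonneg _))
    (Shape.mem_antidiag.2 (rfl : (F, G).1 + (F, G).2 = F + G))

theorem symmetrySum_sigma_pos {k : ℕ} (P : Fin (k + 1) → Type) [∀ i, PartialOrder (P i)]
    [∀ i, Finite (P i)] (h : ∀ i, 0 < symmetrySum (Shape.of (P i))) :
    0 < symmetrySum (Shape.of (Σ i, P i)) := by
  induction k with
  | zero =>
    rw [Shape.of_sigma_fin_succ, Shape.of_sigma_fin_zero, Shape.add_zero]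
    exact h 0
  | succ k ih =>
    rw [Shape.of_sigma_fin_succ]
    exact symmetrySum_add_pos (h 0) (ih _ fun i => h i.succ)

/-- Positivity passes through disjoint unions and adjoined tops. It makes the leading coefficient at
`±ρ` nonzero, on which both the equivalence and the singularity of `A_S` depend. -/
theorem symmetrySum_vertex_pos : (S : FinRootedTree) → 0 < symmetrySum (Shape.of S.Vertex)
  | .node 0 child => by
    change 0 < symmetrySum (Shape.withTop (Shape.of (Σ i, (child i).Vertex)))
    rw [Shape.of_sigma_fin_zero, symmetrySum_withTop_zero]
    exact one_pos
  | .node (k + 1) child => by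
    change 0 < symmetrySum (Shape.withTop (Shape.of (Σ i, (child i).Vertex)))
    have h := symmetrySum_sigma_pos (fun i => (child i).Vertex)
      fun i => symmetrySum_vertex_pos (child i)
    rwa [symmetrySum_withTop]
    intro h0
    rw [h0, symmetrySum_zero] at h
    exact h.false

end FinRootedTree.TreeClass

/-! ### The discriminant, its zero and the radius of convergence -/

namespace FinRootedTree.TreeClass

theorem norm_restr_binaryWeight (z : ℂ) (F : Shape) (q : TreeClass) :
    ‖restr (binaryWeight z) F q‖ = restr (binaryWeight ‖z‖) F q := by
  simp only [restr, binaryWeight]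
  split_ifs <;> simp

theorem ofReal_restr_binaryWeight (x : ℝ) (F : Shape) (q : TreeClass) :
    ((restr (binaryWeight x) F q : ℝ) : ℂ) = restr (binaryWeight (x : ℂ)) F q := by
  simp only [restr, binaryWeight]
  split_ifs <;> simp

theorem ofReal_gen (F : Shape) (x : ℝ) : ((gen F x : ℝ) : ℂ) = gen F (x : ℂ) := by
  simp only [gen, total, Complex.ofReal_tsum, ofReal_restr_binaryWeight]

theorem summable_restr_of_norm {z : ℂ} {F : Shape} (h : Summable (restr (binaryWeight ‖z‖) F)) :
    Summable (restr (binaryWeight z) F) :=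
  Summable.of_norm (h.congr fun q => (norm_restr_binaryWeight z F q).symm)

theorem norm_gen_le {z : ℂ} {F : Shape} (h : Summable (restr (binaryWeight ‖z‖) F)) :
    ‖gen F z‖ ≤ gen F ‖z‖ :=
  tsum_of_norm_bounded h.hasSum fun q => (norm_restr_binaryWeight z F q).le

theorem restr_binaryWeight_mono {x y : ℝ} (hx : 0 ≤ x) (hxy : x ≤ y) (F : Shape) (q : TreeClass) :
    restr (binaryWeight x) F q ≤ restr (binaryWeight y) F q := by
  refine restr_mono (fun q => ?_) F q
  simp only [binaryWeight]
  split_ifs <;> first | rfl | gcongr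

theorem gen_nonneg {x : ℝ} (hx : 0 ≤ x) (F : Shape) : 0 ≤ gen F x :=
  total_nonneg (binaryWeight_nonneg hx) F

theorem gen_mono {x y : ℝ} (hx : 0 ≤ x) (hxy : x ≤ y) {F : Shape}
    (h : Summable (restr (binaryWeight y) F)) : gen F x ≤ gen F y :=
  Summable.tsum_le_tsum (restr_binaryWeight_mono hx hxy F)
    (Summable.of_nonneg_of_le (restr_nonneg (binaryWeight_nonneg hx) F)
      (restr_binaryWeight_mono hx hxy F) h) h

theorem differentiable_restr_binaryWeight (F : Shape) (q : TreeClass) :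
    Differentiable ℂ fun z : ℂ => restr (binaryWeight z) F q := by
  simp only [restr, binaryWeight]
  split_ifs <;> fun_prop

theorem differentiableOn_gen {r : ℝ} {F : Shape}
    (h : ∀ x : ℝ, 0 ≤ x → x < r → Summable (restr (binaryWeight x) F)) :
    DifferentiableOn ℂ (gen F) (Metric.ball (0 : ℂ) r) := by
  intro z hz
  rw [mem_ball_zero_iff] at hz
  obtain ⟨s, hs, hs'⟩ := exists_between hz
  have hs0 : 0 ≤ s := (norm_nonneg z).trans hs.le
  have := Complex.differentiableOn_tsum_of_summable_norm (h s hs0 hs')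
    (F := fun q (z : ℂ) => restr (binaryWeight z) F q) (U := Metric.ball 0 s)
    (fun q => (differentiable_restr_binaryWeight F q).differentiableOn) Metric.isOpen_ball
    fun q w hw => by
      rw [norm_restr_binaryWeight]
      exact restr_binaryWeight_mono (norm_nonneg w) (mem_ball_zero_iff.1 hw).le F q
  exact (this.differentiableAt
    (Metric.isOpen_ball.mem_nhds (mem_ball_zero_iff.2 hs))).differentiableWithinAt

theorem total_truncWeight_le_one {x : ℝ} (hx : 0 ≤ x) (hx' : x ≤ 1 / 2) (N : ℕ) :
    total (truncWeight N x) 0 ≤ 1 :=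
  (total_truncWeight_mono N hx hx' 0).trans (total_truncWeight_half_le N)

theorem summable_of_le_half {x : ℝ} (hx : 0 ≤ x) (hx' : x ≤ 1 / 2) (F : Shape) :
    Summable (restr (binaryWeight x) F) :=
  summable_restr_binaryWeight hx (by linarith) (total_truncWeight_le_one hx hx') (by linarith) F

theorem gen_zero_le_one {x : ℝ} (hx : 0 ≤ x) (hx' : x ≤ 1 / 2) : gen 0 x ≤ 1 :=
  (summable_of_total_truncWeight_le hx (total_truncWeight_le_one hx hx')).2

section

variable {𝕜 : Type*} [RCLike 𝕜]

/-- The function `δ` for which the discriminant of the quadratic equation for the generating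
function of the binary trees is a multiple of `δ (z ^ 2)`. -/
noncomputable def discr (z : 𝕜) : 𝕜 := 1 - (2 * z + z * gen 0 z)

/-- Completing the square in the quadratic equation for V. The right side involves V only at `z ^
2`, hence makes sense beyond the radius of convergence. -/
theorem one_sub_mul_gen_sq {z : 𝕜} (hS : ∀ F : Shape, Summable (restr (binaryWeight z) F)) :
    (1 - z * gen 0 z) ^ 2 = discr (z ^ 2) := by
  have h := gen_zero hS
  rw [discr]
  linear_combination (-2 * z) * h

end

theorem ofReal_discr (x : ℝ) : ((discr x : ℝ) : ℂ) = discr (x : ℂ) := by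
  simp [discr, ofReal_gen]

/-- The term `x * gen 0 x` increases, so `discr` falls at least at the rate 2. This gives positivity
to the left of the zero and also the simplicity of the zero. -/
theorem discr_le {x y : ℝ} (hx : 0 ≤ x) (hxy : x ≤ y) (hy : y ≤ 1 / 2) :
    discr y ≤ discr x - 2 * (y - x) := by
  have h1 := gen_mono hx hxy (summable_of_le_half (hx.trans hxy) hy 0)
  have h2 := gen_nonneg hx 0
  simp only [discr]
  nlinarith

theorem le_gen_zero {x : ℝ} (hx : 0 ≤ x) (hS : ∀ F : Shape, Summable (restr (binaryWeight x) F)) :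
    x ≤ gen 0 x := by
  have h := gen_zero hS
  have h1 := gen_nonneg hx 0
  have h2 := gen_nonneg (sq_nonneg x) 0
  nlinarith [mul_nonneg hx h2, mul_nonneg hx (mul_nonneg h1 h1)]

theorem gen_zero_le_two_mul {x : ℝ} (hx : 0 ≤ x) (hx' : x ≤ 1 / 2) : gen 0 x ≤ 2 * x := by
  have h := gen_zero (summable_of_le_half hx hx')
  have h1 := gen_nonneg hx 0
  have h2 := gen_zero_le_one hx hx'
  have h3 := gen_zero_le_one (sq_nonneg x) (by nlinarith)
  nlinarith [mul_nonneg hx (sub_nonneg.2 h3), mul_nonneg hx (mul_nonneg h1 (sub_nonneg.2 h2)),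
    mul_nonneg hx (sub_nonneg.2 h2)]

/-- Intermediate value theorem between δ(0) = 1 and δ(1/2) = -V(1/2)/2 < 0. -/
theorem exists_discr_eq_zero : ∃ x : ℝ, 0 < x ∧ x < 1 / 2 ∧ discr x = 0 := by
  have hc : ContinuousOn (discr : ℝ → ℝ) (Set.Icc 0 (1 / 2)) := by
    have : ContinuousOn (gen 0 : ℝ → ℝ) (Set.Icc 0 (1 / 2)) := by
      refine continuousOn_tsum (u := restr (binaryWeight (1 / 2 : ℝ)) 0) (fun q => ?_)
        (summable_of_le_half (by norm_num) le_rfl 0) fun q x hx => ?_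
      · simp only [restr, binaryWeight]
        split_ifs <;> fun_prop
      · rw [Real.norm_of_nonneg (restr_nonneg (binaryWeight_nonneg hx.1) 0 q)]
        exact restr_binaryWeight_mono hx.1 hx.2 0 q
    unfold discr
    fun_prop
  have h0 : discr (0 : ℝ) = 1 := by simp [discr]
  have h1 : discr (1 / 2 : ℝ) < 0 := by
    have := le_gen_zero (x := 1 / 2) (by norm_num) (summable_of_le_half (by norm_num) le_rfl)
    rw [discr]; linarith
  obtain ⟨x, hx, hx0⟩ := intermediate_value_Icc' (by norm_num) hc
    (show (0 : ℝ) ∈ Set.Icc (discr (1 / 2 : ℝ)) (discr 0) from ⟨h1.le, by rw [h0]; exact zero_le_one⟩)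
  refine ⟨x, lt_of_le_of_ne hx.1 ?_, lt_of_le_of_ne hx.2 ?_, hx0⟩
  · rintro rfl; rw [h0] at hx0; exact one_ne_zero hx0
  · rintro rfl; exact h1.ne hx0

section Root

variable {x₀ : ℝ} (h0 : 0 < x₀) (h1 : x₀ < 1 / 2) (hd : discr x₀ = 0)
include h0 h1 hd

/-- Starting from 1 - x₀V(x₀) = 2x₀, the squared equation at X = x₀² gives 1 - XV(X) = 6X, and at Y
= x₀⁴ = ρ⁸ it gives 38Y + Y·V(Y) = 1. For so small a Y crude bounds on V(Y) suffice: 0.02629 < Y ≤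
1/38, and eighth roots locate ρ. -/
theorem abs_sqrt_root_sub_lt : |√x₀ - 0.6346| < 0.00005 := by
  have e1 : x₀ ^ 2 ≤ 1 / 2 := by nlinarith
  have e2 : (x₀ ^ 2) ^ 2 ≤ 1 / 2 := by nlinarith [sq_nonneg x₀]
  have a1 := one_sub_mul_gen_sq (summable_of_le_half h0.le h1.le)
  have a2 := one_sub_mul_gen_sq (summable_of_le_half (sq_nonneg x₀) e1)
  rw [discr] at hd a1 a2
  set X := x₀ ^ 2 with hX
  set Y := X ^ 2 with hY
  have b1 : x₀ * gen 0 x₀ = 1 - 2 * x₀ := by linarith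
  rw [b1] at a1
  have b2 : X * gen 0 X = 1 - 6 * X := by nlinarith
  rw [b2] at a2
  have b3 : 38 * Y + Y * gen 0 Y = 1 := by nlinarith
  have hY0 : 0 ≤ Y := sq_nonneg X
  have hYle : 38 * Y ≤ 1 := by nlinarith [gen_nonneg hY0 0]
  have c1 := gen_zero_le_two_mul hY0 e2
  have c2 := gen_zero_le_two_mul (sq_nonneg Y) (by nlinarith : Y ^ 2 ≤ 1 / 2)
  have c3 := gen_zero (summable_of_le_half hY0 e2)
  have c4 : gen 0 Y ≤ Y + Y / 2 * ((2 * Y) ^ 2 + 2 * Y ^ 2) := by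
    have := gen_nonneg hY0 0
    calc gen 0 Y = _ := c3
      _ ≤ _ := by gcongr
  have hYge : 0.02629 < Y := by
    by_contra! hle
    have : gen 0 Y ≤ 0.0264 := by
      refine c4.trans ?_
      have : Y / 2 * ((2 * Y) ^ 2 + 2 * Y ^ 2) ≤
        0.02629 / 2 * ((2 * 0.02629) ^ 2 + 2 * 0.02629 ^ 2) := by gcongr
      norm_num at this ⊢
      linarith
    nlinarith [mul_le_mul hle this (gen_nonneg hY0 0) (by norm_num)]
  have hρ := Real.sq_sqrt h0.le
  have hY8 : Y = √x₀ ^ 8 := by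
    rw [hY, hX]
    calc (x₀ ^ 2) ^ 2 = (√x₀ ^ 2) ^ 4 := by rw [hρ]; ring
      _ = _ := by ring
  have hp := Real.sqrt_nonneg x₀
  rw [abs_lt]
  constructor
  · by_contra! hle
    have : √x₀ ^ 8 ≤ 0.63455 ^ 8 := by gcongr; norm_num at hle ⊢; linarith
    rw [← hY8] at this
    norm_num at this hYge
    linarith
  · by_contra! hle
    have : (0.63465 : ℝ) ^ 8 ≤ √x₀ ^ 8 := by gcongr; norm_num at hle ⊢; linarith
    rw [← hY8] at this
    norm_num at this
    linarith

omit h0 h1 hd in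
theorem sq_lt_of_lt_sqrt {x : ℝ} (hx : 0 ≤ x) (hx' : x < √x₀) : x ^ 2 < x₀ := by
  rwa [Real.lt_sqrt hx] at hx'

-- The bound is the smaller root of y = x + (x/2)(y² + V(x²)), real because δ(x²) > 0. It also
-- yields xy = 1 - √δ(x²) < 1, the contraction needed for all other posets.
omit h0 in
theorem total_truncWeight_le_of_lt_sqrt {x : ℝ} (hx : 0 < x) (hx' : x < √x₀) (N : ℕ) :
    total (truncWeight N x) 0 ≤ (1 - √(discr (x ^ 2))) / x := by
  have hlt := sq_lt_of_lt_sqrt hx.le hx'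
  have hD : 0 < discr (x ^ 2) := by
    have := discr_le (sq_nonneg x) hlt.le h1.le
    linarith
  have hD1 : discr (x ^ 2) ≤ 1 := by
    have := gen_nonneg (sq_nonneg x) 0
    rw [discr]; nlinarith [sq_nonneg x]
  have hs1 : √(discr (x ^ 2)) ≤ 1 := Real.sqrt_le_one.2 hD1
  refine total_truncWeight_le_of_supersolution (v := gen 0 (x ^ 2)) hx.le
    (div_nonneg (by linarith) hx.le) (fun N => ?_) (le_of_eq ?_) N
  · exact Summable.tsum_le_tsum (restr_mono (truncWeight_le N (sq_nonneg x)) 0)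
      (summable_restr_truncWeight N _ 0) (summable_of_le_half (sq_nonneg x) (by linarith) 0)
  · have h2 := Real.sq_sqrt hD.le
    rw [discr] at h2
    field_simp
    rw [discr]
    nlinarith

theorem summable_of_lt_sqrt {x : ℝ} (hx : 0 ≤ x) (hx' : x < √x₀) (F : Shape) :
    Summable (restr (binaryWeight x) F) := by
  have hlt := sq_lt_of_lt_sqrt hx hx'
  rcases hx.eq_or_lt with rfl | hx0
  · exact summable_of_le_half le_rfl (by norm_num) F
  have hD : 0 < discr (x ^ 2) := by
    have := discr_le (sq_nonneg x) hlt.le h1.le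
    linarith
  refine summable_restr_binaryWeight hx (by nlinarith)
    (total_truncWeight_le_of_lt_sqrt h1 hd hx0 hx') ?_ F
  rw [mul_div_cancel₀ _ hx0.ne']
  linarith [Real.sqrt_pos.2 hD]

omit h0 in
theorem mul_gen_lt_one {x : ℝ} (hx : 0 ≤ x) (hx' : x < √x₀) : x * gen 0 x < 1 := by
  have hlt := sq_lt_of_lt_sqrt hx hx'
  rcases hx.eq_or_lt with rfl | hx0
  · simp
  have hD : 0 < discr (x ^ 2) := by
    have := discr_le (sq_nonneg x) hlt.le h1.le
    linarith
  have h := (summable_of_total_truncWeight_le hx (total_truncWeight_le_of_lt_sqrt h1 hd hx0 hx')).2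
  rw [le_div_iff₀ hx0] at h
  linarith [Real.sqrt_pos.2 hD]

end Root

end FinRootedTree.TreeClass

/-! ### Analytic continuation of V through the principal square root -/

/-- The principal branch of the square root. -/
noncomputable def principalSqrt (w : ℂ) : ℂ := Complex.exp (Complex.log w / 2)

theorem principalSqrt_sq {w : ℂ} (hw : w ≠ 0) : principalSqrt w ^ 2 = w := by
  rw [principalSqrt, sq, ← Complex.exp_add, add_halves, Complex.exp_log hw]

theorem re_principalSqrt_pos {w : ℂ} (hw : w ∈ Complex.slitPlane) : 0 < (principalSqrt w).re := by
  rw [principalSqrt, Complex.exp_re]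
  refine mul_pos (Real.exp_pos _) (Real.cos_pos_of_mem_Ioo ?_)
  have h1 := Complex.neg_pi_lt_arg w
  have h2 := lt_of_le_of_ne (Complex.arg_le_pi w) (Complex.mem_slitPlane_iff_arg.1 hw).1
  have h3 : (Complex.log w / 2).im = w.arg / 2 := by
    rw [← Complex.log_im]
    exact Complex.div_ofNat_im _ _
  rw [h3]
  constructor <;> linarith

theorem differentiableAt_principalSqrt {w : ℂ} (hw : w ∈ Complex.slitPlane) :
    DifferentiableAt ℂ principalSqrt w :=
  ((Complex.differentiableAt_log hw).div_const 2).cexp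

theorem eq_principalSqrt {u w : ℂ} (hu : 0 < u.re) (hw : w ∈ Complex.slitPlane) (h : u ^ 2 = w) :
    u = principalSqrt w := by
  have h1 : principalSqrt w ^ 2 = u ^ 2 := by
    rw [principalSqrt_sq (Complex.slitPlane_ne_zero hw), h]
  rcases sq_eq_sq_iff_eq_or_eq_neg.1 h1 with h1 | h1
  · exact h1.symm
  · have := re_principalSqrt_pos hw
    rw [h1, Complex.neg_re] at this
    linarith

namespace FinRootedTree.TreeClass

theorem star_gen (F : Shape) (z : ℂ) : star (gen F z) = gen F (star z) := by
  rw [gen, total, tsum_star]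
  refine tsum_congr fun q => ?_
  simp only [restr, binaryWeight]
  split_ifs <;> simp

theorem star_discr (z : ℂ) : star (discr z) = discr (star z) := by
  rw [discr, discr, ← star_gen]
  simp

theorem differentiableOn_discr : DifferentiableOn ℂ (discr : ℂ → ℂ) (Metric.ball 0 (1 / 2)) := by
  have := differentiableOn_gen (r := 1 / 2) (F := 0) fun x hx hx' => summable_of_le_half hx hx'.le 0
  unfold discr
  fun_prop

theorem analyticAt_discr {z : ℂ} (hz : ‖z‖ < 1 / 2) : AnalyticAt ℂ (discr : ℂ → ℂ) z :=
  differentiableOn_discr.analyticAt (Metric.isOpen_ball.mem_nhds (mem_ball_zero_iff.2 hz))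

section Root

variable {x₀ : ℝ} (h0 : 0 < x₀) (h1 : x₀ < 1 / 2) (hd : discr x₀ = 0)
include h0 h1 hd

/-- Nonnegative coefficients give Re(zV(z)) ≤ x₀V(x₀), and Re z < x₀ unless z = x₀; hence Re δ(z) >
δ(x₀) = 0. -/
theorem re_discr_pos {z : ℂ} (hz : ‖z‖ ≤ x₀) (hz' : z ≠ x₀) : 0 < (discr z).re := by
  have hre : z.re < x₀ := by
    refine lt_of_le_of_ne ((Complex.re_le_norm z).trans hz) fun h => hz' ?_
    have h2 := Complex.sq_norm z
    rw [Complex.normSq_apply, h] at h2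
    have h3 : ‖z‖ ^ 2 ≤ x₀ ^ 2 := by gcongr
    have h4 : z.im = 0 := by nlinarith [mul_self_nonneg z.im]
    exact Complex.ext (by simpa using h) (by simpa using h4)
  have h2 : (z * gen 0 z).re ≤ x₀ * gen 0 x₀ := by
    refine (Complex.re_le_norm _).trans ?_
    rw [norm_mul]
    have h3 := norm_gen_le (F := 0) (summable_of_le_half (norm_nonneg z) (by linarith) 0)
    have h4 := gen_mono (norm_nonneg z) hz (summable_of_le_half h0.le h1.le 0)
    exact mul_le_mul hz (h3.trans h4) (norm_nonneg _) h0.le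
  rw [discr] at hd
  rw [discr]
  simp only [Complex.sub_re, Complex.add_re, Complex.one_re]
  have h5 : (2 * z).re = 2 * z.re := by simp
  rw [h5]
  linarith

/-- A vanishing derivative would give δ(t) = o(x₀ - t), against δ(t) ≥ 2(x₀ - t) for real t to the
left of x₀. -/
theorem exists_hasStrictDerivAt_discr :
    ∃ d : ℂ, d ≠ 0 ∧ HasStrictDerivAt (discr : ℂ → ℂ) d x₀ := by
  have ha : AnalyticAt ℂ (discr : ℂ → ℂ) x₀ :=
    analyticAt_discr (by rw [Complex.norm_real, Real.norm_of_nonneg h0.le]; exact h1)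
  refine ⟨_, fun h => ?_, ha.hasStrictDerivAt⟩
  have h2 := ha.hasStrictDerivAt.hasDerivAt
  rw [h, hasDerivAt_iff_isLittleO] at h2
  have h3 := h2.bound one_pos
  have h4 : Filter.Tendsto (fun t : ℝ => (t : ℂ)) (𝓝[<] x₀) (𝓝 (x₀ : ℂ)) :=
    (Complex.continuous_ofReal.tendsto x₀).mono_left nhdsWithin_le_nhds
  obtain ⟨t, ht, ht0, ht1⟩ :=
    ((h4.eventually h3).and (Ioo_mem_nhdsLT h0)).exists
  rw [← ofReal_discr, ← ofReal_discr, hd, smul_zero, sub_zero, ← Complex.ofReal_sub,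
    ← Complex.ofReal_sub, Complex.norm_real, Complex.norm_real, Real.norm_eq_abs,
    Real.norm_eq_abs, sub_zero, one_mul, abs_of_nonpos (by linarith : t - x₀ ≤ 0)] at ht
  have h5 := discr_le ht0.le ht1.le h1.le
  have h6 := le_abs_self (discr t)
  linarith

/-- Near x₀ the function δ is injective and commutes with conjugation, so it is real only at real
points; to the left of x₀ it is positive there. -/
theorem eventually_discr_mem_slitPlane :
    ∀ᶠ z : ℂ in 𝓝 (x₀ : ℂ), ¬ (z.im = 0 ∧ x₀ ≤ z.re) → discr z ∈ Complex.slitPlane := by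
  obtain ⟨d, hd0, hda⟩ := exists_hasStrictDerivAt_discr h0 h1 hd
  have hinj := hda.eventually_left_inverse hd0
  have hstar : Filter.Tendsto (fun z : ℂ => star z) (𝓝 (x₀ : ℂ)) (𝓝 (x₀ : ℂ)) := by
    have := (continuous_star (R := ℂ)).tendsto (x₀ : ℂ)
    simpa using this
  have hre : ∀ᶠ z : ℂ in 𝓝 (x₀ : ℂ), 0 < z.re :=
    Complex.continuous_re.continuousAt.eventually (lt_mem_nhds (by simpa using h0))
  filter_upwards [hinj, hstar.eventually hinj, hre] with z hz hz' hzre hns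
  by_contra hn
  rw [Complex.mem_slitPlane_iff, not_or, not_lt, not_not] at hn
  have hs : star (discr z) = discr z := Complex.conj_eq_iff_im.2 hn.2
  rw [← star_discr, hs, hz] at hz'
  have him : z.im = 0 := Complex.conj_eq_iff_im.1 hz'.symm
  have hlt : z.re < x₀ := by
    by_contra! hle; exact hns ⟨him, hle⟩
  have hzz : z = (z.re : ℂ) := Complex.ext (by simp) (by simpa using him)
  have h2 := discr_le hzre.le hlt.le h1.le
  have h3 := hn.1
  rw [hzz, ← ofReal_discr, Complex.ofReal_re] at h3
  linarith

/-- The condition holds in a neighbourhood of every point of the closed disc of radius x₀, hence by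
compactness on a larger disc; the cap 1/2 keeps δ analytic. -/
theorem exists_radius : ∃ r : ℝ, x₀ < r ∧ r ≤ 1 / 2 ∧ ∀ z : ℂ, ‖z‖ < r →
    ¬ (z.im = 0 ∧ x₀ ≤ z.re) → discr z ∈ Complex.slitPlane := by
  have hsub : Metric.closedBall (0 : ℂ) x₀ ⊆
      interior {z : ℂ | ¬ (z.im = 0 ∧ x₀ ≤ z.re) → discr z ∈ Complex.slitPlane} := by
    intro z hz
    rw [mem_interior_iff_mem_nhds]
    rw [mem_closedBall_zero_iff] at hz
    by_cases hzx : z = x₀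
    · rw [hzx]; exact eventually_discr_mem_slitPlane h0 h1 hd
    · have hs : discr z ∈ Complex.slitPlane := .inl (re_discr_pos h0 h1 hd hz hzx)
      have hc := (analyticAt_discr (hz.trans_lt h1)).continuousAt
      filter_upwards [hc.eventually (Complex.isOpen_slitPlane.mem_nhds hs)] with w hw _ using hw
  obtain ⟨ε, hε, h⟩ := (isCompact_closedBall (0 : ℂ) x₀).exists_thickening_subset_open
    isOpen_interior hsub
  rw [thickening_closedBall hε h0.le] at h
  refine ⟨min (ε + x₀) (1 / 2), lt_min (by linarith) h1, min_le_right _ _, fun z hz => ?_⟩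
  exact interior_subset (h (mem_ball_zero_iff.2 (hz.trans_le (min_le_left _ _))))

end Root

/-- The data of the analytic continuation of the generating function of the binary trees. -/
structure IsContinuation (ρ R : ℝ) (V : ℂ → ℂ) : Prop where
  pos : 0 < ρ
  lt : ρ < R
  sq_lt : R ^ 2 < ρ
  summable : ∀ x : ℝ, 0 ≤ x → x < ρ → ∀ F : Shape, Summable (restr (binaryWeight x) F)
  eq_gen : ∀ z : ℂ, ‖z‖ < ρ → V z = gen 0 z
  differentiableOn : DifferentiableOn ℂ V (slitDisc ρ R)
  ne_zero : ∀ z ∈ slitDisc ρ R, 1 - z * V z ≠ 0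
  exists_sq_eq : ∃ D : ℂ → ℂ, (∀ z ∈ slitDisc ρ R, (1 - z * V z) ^ 2 = D z) ∧
    ∀ w : ℂ, w = ρ ∨ w = -ρ → AnalyticAt ℂ D w ∧ D w = 0 ∧ deriv D w ≠ 0

theorem exists_isContinuation :
    ∃ (ρ R : ℝ) (V : ℂ → ℂ), |ρ - 0.6346| < 0.00005 ∧ IsContinuation ρ R V := by
  obtain ⟨x₀, h0, h1, hd⟩ := exists_discr_eq_zero
  obtain ⟨r, hr, hr', hsl⟩ := exists_radius h0 h1 hd
  have hρ := abs_sqrt_root_sub_lt h0 h1 hd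
  set ρ := √x₀ with hρdef
  have hρ0 : 0 < ρ := Real.sqrt_pos.2 h0
  have hρsq : ρ ^ 2 = x₀ := Real.sq_sqrt h0.le
  have hρR : ρ < √r := Real.sqrt_lt_sqrt h0.le hr
  have hRsq : √r ^ 2 = r := Real.sq_sqrt (by linarith)
  have hnorm {z : ℂ} (hz : z ∈ slitDisc ρ √r) : ‖z ^ 2‖ < r := by
    have := hz.1
    rw [norm_pow, ← hRsq]
    gcongr
  have hslit {z : ℂ} (hz : z ∈ slitDisc ρ √r) : discr (z ^ 2) ∈ Complex.slitPlane := by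
    refine hsl _ (hnorm hz) fun ⟨him, hre⟩ => hz.2 ?_
    have e1 : (z ^ 2).im = 2 * (z.re * z.im) := by rw [sq, Complex.mul_im]; ring
    have e2 : (z ^ 2).re = z.re ^ 2 - z.im ^ 2 := by rw [sq, Complex.mul_re]; ring
    rw [e1] at him
    rw [e2] at hre
    have hor : z.re = 0 ∨ z.im = 0 := by simpa using him
    rcases hor with h | h
    · rw [h] at hre
      nlinarith [sq_nonneg z.im]
    · refine ⟨h, ?_⟩
      rw [h] at hre
      rw [hρdef, ← Real.sqrt_sq_eq_abs]
      exact Real.sqrt_le_sqrt (by linarith)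
  have hsum (x : ℝ) (hx : 0 ≤ x) (hx' : x < ρ) (F : Shape) : Summable (restr (binaryWeight x) F) :=
    summable_of_lt_sqrt h0 h1 hd hx hx' F
  classical
  let V : ℂ → ℂ := fun z => if ‖z‖ < ρ then gen 0 z else (1 - principalSqrt (discr (z ^ 2))) / z
  have hV1 (z : ℂ) (hz : ‖z‖ < ρ) : V z = gen 0 z := if_pos hz
  have hV (z : ℂ) (hz : z ∈ slitDisc ρ √r) : 1 - z * V z = principalSqrt (discr (z ^ 2)) := by
    by_cases hlt : ‖z‖ < ρ
    · rw [hV1 z hlt]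
      -- Inside the disc of convergence |zV(z)| < 1, so 1 - zV has positive real part and must be
      -- the principal root. This glues the two formulas defining `V`.
      refine eq_principalSqrt ?_ (hslit hz) (one_sub_mul_gen_sq fun F =>
        summable_restr_of_norm (hsum _ (norm_nonneg z) hlt F))
      have h2 := norm_gen_le (F := 0) (hsum _ (norm_nonneg z) hlt 0)
      have h3 := mul_gen_lt_one h1 hd (norm_nonneg z) hlt
      have h4 := Complex.re_le_norm (z * gen 0 z)
      rw [norm_mul] at h4
      have h5 : ‖z‖ * ‖gen 0 z‖ ≤ ‖z‖ * gen 0 ‖z‖ := by gcongr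
      rw [Complex.sub_re, Complex.one_re]
      linarith
    · have hz0 : z ≠ 0 := by rintro rfl; exact hlt (by simpa using hρ0)
      simp only [V, if_neg hlt]
      field_simp
      ring
  have hderiv {z : ℂ} (hz : ‖z ^ 2‖ < r) : AnalyticAt ℂ (fun z : ℂ => discr (z ^ 2)) z :=
    AnalyticAt.fun_comp (f := fun z : ℂ => z ^ 2) (analyticAt_discr (hz.trans_le hr'))
      (analyticAt_id.pow 2)
  refine ⟨ρ, √r, V, hρ, hρ0, hρR, ?_, hsum, hV1, fun z hz => ?_, fun z hz => ?_,
    fun z : ℂ => discr (z ^ 2), fun z hz => ?_, fun w hw => ?_⟩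
  -- R² = r ≤ 1/2 < ρ, so squaring maps the whole disc of radius R into the disc of convergence.
  · rw [hRsq]
    have := (abs_lt.1 hρ).1
    norm_num at this ⊢
    linarith
  · by_cases hlt : ‖z‖ < ρ
    · have h2 := (differentiableOn_gen (F := 0) fun x hx hx' => hsum x hx hx' 0).differentiableAt
        (Metric.isOpen_ball.mem_nhds (mem_ball_zero_iff.2 hlt))
      refine (h2.congr_of_eventuallyEq ?_).differentiableWithinAt
      filter_upwards [Metric.isOpen_ball.mem_nhds (mem_ball_zero_iff.2 hlt)] with w hw
      exact hV1 w (mem_ball_zero_iff.1 hw)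
    · have hz0 : z ≠ 0 := by rintro rfl; exact hlt (by simpa using hρ0)
      have h2 : DifferentiableAt ℂ (fun z : ℂ => (1 - principalSqrt (discr (z ^ 2))) / z) z := by
        refine DifferentiableAt.div ?_ differentiableAt_id hz0
        exact (DifferentiableAt.comp (g := principalSqrt) z
          (differentiableAt_principalSqrt (hslit hz)) (hderiv (hnorm hz)).differentiableAt).const_sub 1
      refine h2.differentiableWithinAt.congr_of_eventuallyEq ?_ ?_
      · filter_upwards [self_mem_nhdsWithin,
          nhdsWithin_le_nhds (isOpen_ne.mem_nhds hz0)] with w hw hw0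
        rw [eq_div_iff hw0, ← hV w hw]
        ring
      · rw [eq_div_iff hz0, ← hV z hz]
        ring
  · rw [hV z hz]
    exact Complex.exp_ne_zero _
  · rw [hV z hz, principalSqrt_sq (Complex.slitPlane_ne_zero (hslit hz))]
  · have hw2 : w ^ 2 = x₀ := by
      rw [← hρsq]
      rcases hw with rfl | rfl <;> push_cast <;> ring
    have hw0 : w ≠ 0 := by
      rintro rfl
      have : (x₀ : ℂ) ≠ 0 := by exact_mod_cast h0.ne'
      exact this (by rw [← hw2]; ring)
    refine ⟨hderiv ?_, ?_, ?_⟩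
    · rw [hw2, Complex.norm_real, Real.norm_of_nonneg h0.le]; exact hr
    · simp only [hw2]
      rw [← ofReal_discr, hd, Complex.ofReal_zero]
    · obtain ⟨d, hd0, hda⟩ := exists_hasStrictDerivAt_discr h0 h1 hd
      rw [← hw2] at hda
      have h2 := HasDerivAt.comp w hda.hasDerivAt (hasDerivAt_pow 2 w)
      have h3 : deriv (fun z : ℂ => discr (z ^ 2)) w = _ := h2.deriv
      rw [h3]
      simp [hd0, hw0]

end FinRootedTree.TreeClass

/-! ### Continuation of the series `gen F` and limits at ±ρ -/

open Filter

section SlitDisc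

variable {ρ R : ℝ}

theorem mem_slitDisc_of_norm_lt (h : ρ < R) {z : ℂ} (hz : ‖z‖ < ρ) : z ∈ slitDisc ρ R :=
  ⟨hz.trans h, fun hn => absurd ((Complex.abs_re_le_norm z).trans_lt hz) hn.2.not_gt⟩

theorem neBot_nhdsWithin_slitDisc (h0 : 0 < ρ) (h : ρ < R) {w : ℂ} (hw : ‖w‖ = ρ) :
    (𝓝[slitDisc ρ R] w).NeBot := by
  refine neBot_of_le (nhdsWithin_mono w (s := Metric.ball 0 ρ) fun z hz =>
    mem_slitDisc_of_norm_lt h (mem_ball_zero_iff.1 hz)) (hf := ?_)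
  rw [← mem_closure_iff_nhdsWithin_neBot, closure_ball (0 : ℂ) h0.ne']
  simp [hw]

theorem not_mem_slitDisc {w : ℂ} (hw : w = ρ ∨ w = -ρ) : w ∉ slitDisc ρ R := by
  rintro ⟨_, h⟩
  refine h ?_
  rcases hw with rfl | rfl <;> simp [le_abs_self]

end SlitDisc

namespace FinRootedTree.TreeClass.IsContinuation

variable {ρ R : ℝ} {V : ℂ → ℂ} (h : IsContinuation ρ R V)
include h

theorem summable_restr {z : ℂ} (hz : ‖z‖ < ρ) (F : Shape) : Summable (restr (binaryWeight z) F) :=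
  summable_restr_of_norm (h.summable _ (norm_nonneg z) hz F)

theorem norm_eq {w : ℂ} (hw : w = ρ ∨ w = -ρ) : ‖w‖ = ρ := by
  rcases hw with rfl | rfl <;> simp [abs_of_pos h.pos]

theorem ne_zero_of_eq {w : ℂ} (hw : w = ρ ∨ w = -ρ) : w ≠ 0 := by
  rw [← norm_pos_iff, h.norm_eq hw]; exact h.pos

theorem neBot {w : ℂ} (hw : w = ρ ∨ w = -ρ) : (𝓝[slitDisc ρ R] w).NeBot :=
  neBot_nhdsWithin_slitDisc h.pos h.lt (h.norm_eq hw)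

theorem tendsto_one_sub {w : ℂ} (hw : w = ρ ∨ w = -ρ) :
    Tendsto (fun z => 1 - z * V z) (𝓝[slitDisc ρ R] w) (𝓝 0) := by
  obtain ⟨D, hD, hD'⟩ := h.exists_sq_eq
  obtain ⟨ha, h0, -⟩ := hD' w hw
  have h1 : Tendsto D (𝓝[slitDisc ρ R] w) (𝓝 0) := by
    rw [← h0]; exact ha.continuousAt.tendsto.mono_left nhdsWithin_le_nhds
  have h2 : Tendsto (fun z => ‖1 - z * V z‖ ^ 2) (𝓝[slitDisc ρ R] w) (𝓝 0) := by
    refine Tendsto.congr' ?_ (by simpa using h1.norm)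
    filter_upwards [self_mem_nhdsWithin] with z hz
    rw [← hD z hz, norm_pow]
  rw [tendsto_zero_iff_norm_tendsto_zero]
  simpa using h2.sqrt

omit h in
theorem tendsto_id' (w : ℂ) : Tendsto (fun z => z) (𝓝[slitDisc ρ R] w) (𝓝 w) :=
  tendsto_id.mono_left nhdsWithin_le_nhds

theorem tendsto_mul {w : ℂ} (hw : w = ρ ∨ w = -ρ) :
    Tendsto (fun z => z * V z) (𝓝[slitDisc ρ R] w) (𝓝 1) := by
  simpa using (h.tendsto_one_sub hw).const_sub 1

theorem tendsto_inv {w : ℂ} (hw : w = ρ ∨ w = -ρ) :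
    Tendsto V (𝓝[slitDisc ρ R] w) (𝓝 (1 / w)) := by
  have hw0 := h.ne_zero_of_eq hw
  refine ((h.tendsto_mul hw).div (tendsto_id' w) hw0).congr' ?_
  filter_upwards [nhdsWithin_le_nhds (isOpen_ne.mem_nhds hw0)] with z hz
  exact mul_div_cancel_left₀ (V z) hz

theorem norm_sq_lt {z : ℂ} (hz : ‖z‖ ≤ R) : ‖z ^ 2‖ < ρ := by
  rw [norm_pow]
  exact lt_of_le_of_lt (by gcongr) h.sq_lt

/-- The diagonal terms A_G(z²) are regular even at ±ρ, so they do not influence the leading order.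
-/
theorem differentiableAt_gen_sq (F : Shape) {z : ℂ} (hz : ‖z‖ ≤ R) :
    DifferentiableAt ℂ (fun z : ℂ => gen F (z ^ 2)) z := by
  have h1 := (differentiableOn_gen (F := F) fun x hx hx' => h.summable x hx hx' F).differentiableAt
    (Metric.isOpen_ball.mem_nhds (mem_ball_zero_iff.2 (h.norm_sq_lt hz)))
  exact DifferentiableAt.comp (g := gen F) z h1 (differentiableAt_pow 2)

/-- A continuation of the generating function of the trees with given marked vertices, together
with its behaviour at the singularities. -/
structure IsGenContinuation (ρ R : ℝ) (V : ℂ → ℂ) (F : Shape) (A : ℂ → ℂ) : Prop where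
  eq_gen : ∀ z : ℂ, ‖z‖ < ρ → A z = gen F z
  differentiableOn : DifferentiableOn ℂ A (slitDisc ρ R)
  tendsto : ∀ w : ℂ, w = ρ ∨ w = -ρ →
    Tendsto (fun z => A z * (1 - z * V z) ^ (F.card + F.leaves - 1)) (𝓝[slitDisc ρ R] w)
      (𝓝 (symmetrySum F / w))

theorem differentiableOn_one_sub : DifferentiableOn ℂ (fun z => 1 - z * V z) (slitDisc ρ R) :=
  (differentiableOn_id.mul h.differentiableOn).const_sub 1

theorem isGenContinuation_withTop_zero :
    IsGenContinuation ρ R V (Shape.withTop 0) fun z => V z / (1 - z * V z) where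
  eq_gen z hz := by
    have h1 := h.ne_zero z (mem_slitDisc_of_norm_lt h.lt hz)
    rw [h.eq_gen z hz] at h1 ⊢
    rw [div_eq_iff h1, gen_withTop_zero fun F => h.summable_restr hz F]
  differentiableOn := h.differentiableOn.div h.differentiableOn_one_sub h.ne_zero
  tendsto w hw := by
    rw [Shape.card_withTop, Shape.card_zero, Shape.leaves_withTop_zero, symmetrySum_withTop_zero]
    refine Tendsto.congr' ?_ (by simpa using h.tendsto_inv hw)
    filter_upwards [self_mem_nhdsWithin] with z hz
    have := h.ne_zero z hz
    simp only [Nat.zero_add, Nat.add_sub_cancel, pow_one]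
    rw [div_mul_cancel₀ _ this]

/-- Used with f = zV or f = 1, according to whether `F` has a maximum or not. Both tend to 1, so a
new top only costs one factor 1/(1 - zV). -/
theorem isGenContinuation_withTop {F : Shape} (hF : F ≠ 0) {A : ℂ → ℂ}
    (hA : IsGenContinuation ρ R V F A) {f : ℂ → ℂ} (hf : DifferentiableOn ℂ f (slitDisc ρ R))
    (hf' : ∀ w : ℂ, w = ρ ∨ w = -ρ → Tendsto f (𝓝[slitDisc ρ R] w) (𝓝 1))
    (heq : ∀ z, ‖z‖ < ρ → gen F.withTop z * (1 - z * gen 0 z) = f z * gen F z) :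
    IsGenContinuation ρ R V F.withTop fun z => f z * A z / (1 - z * V z) where
  eq_gen z hz := by
    have h1 := h.ne_zero z (mem_slitDisc_of_norm_lt h.lt hz)
    rw [h.eq_gen z hz] at h1 ⊢
    rw [div_eq_iff h1, heq z hz, hA.eq_gen z hz]
  differentiableOn := (hf.mul hA.differentiableOn).div h.differentiableOn_one_sub h.ne_zero
  tendsto w hw := by
    rw [Shape.card_withTop, Shape.leaves_withTop hF, symmetrySum_withTop hF]
    have h1 := (hf' w hw).mul (hA.tendsto w hw)
    rw [one_mul] at h1
    refine h1.congr' ?_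
    filter_upwards [self_mem_nhdsWithin] with z hz
    have h2 := h.ne_zero z hz
    have h3 := Shape.card_pos hF
    have h4 : F.card + 1 + F.leaves - 1 = (F.card + F.leaves - 1) + 1 := by omega
    rw [h4, pow_succ]
    field_simp

open scoped Classical in
theorem isGenContinuation_of_forall_withTop_ne {F : Shape} (hF : F ≠ 0)
    (hF' : ∀ G, Shape.withTop G ≠ F) {B : Shape → ℂ → ℂ}
    (hB : ∀ G : Shape, G ≠ 0 → G.card < F.card → IsGenContinuation ρ R V G (B G)) :
    IsGenContinuation ρ R V F fun z => z / 2 * (∑ p ∈ Shape.properAntidiag F,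
      (B p.1 z * B p.2 z + if p.1 = p.2 then gen p.1 (z ^ 2) else 0)) / (1 - z * V z) := by
  have hB1 (p) (hp : p ∈ Shape.properAntidiag F) : IsGenContinuation ρ R V p.1 (B p.1) :=
    hB _ (Shape.mem_properAntidiag.1 hp).2.1 (Shape.card_lt_of_mem_properAntidiag hp).1
  have hB2 (p) (hp : p ∈ Shape.properAntidiag F) : IsGenContinuation ρ R V p.2 (B p.2) :=
    hB _ (Shape.mem_properAntidiag.1 hp).2.2 (Shape.card_lt_of_mem_properAntidiag hp).2
  refine ⟨fun z hz => ?_, ?_, fun w hw => ?_⟩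
  · have h1 := h.ne_zero z (mem_slitDisc_of_norm_lt h.lt hz)
    rw [h.eq_gen z hz] at h1 ⊢
    rw [div_eq_iff h1, gen_of_forall_withTop_ne (fun F => h.summable_restr hz F) hF hF']
    congr 1
    refine Finset.sum_congr rfl fun p hp => ?_
    rw [(hB1 p hp).eq_gen z hz, (hB2 p hp).eq_gen z hz]
  · refine DifferentiableOn.div (DifferentiableOn.mul (by fun_prop) ?_)
      h.differentiableOn_one_sub h.ne_zero
    refine DifferentiableOn.fun_sum fun p hp =>
      ((hB1 p hp).differentiableOn.mul (hB2 p hp).differentiableOn).add ?_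
    split_ifs
    · exact fun z hz => (h.differentiableAt_gen_sq p.1 hz.1.le).differentiableWithinAt
    · exact differentiableOn_const 0
  · have hterm (p) (hp : p ∈ Shape.properAntidiag F) :
        Tendsto (fun z => (B p.1 z * B p.2 z + if p.1 = p.2 then gen p.1 (z ^ 2) else 0) *
          (1 - z * V z) ^ (F.card + F.leaves - 2)) (𝓝[slitDisc ρ R] w)
          (𝓝 (symmetrySum p.1 / w * (symmetrySum p.2 / w) +
            (if p.1 = p.2 then gen p.1 (w ^ 2) else 0) * 0)) := by
      obtain ⟨hsum, hp1, hp2⟩ := Shape.mem_properAntidiag.1 hp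
      have c1 := Shape.card_pos hp1
      have c2 := Shape.card_pos hp2
      have c3 := Shape.card_add p.1 p.2
      have c4 := Shape.leaves_add p.1 p.2
      rw [hsum] at c3 c4
      -- The exponents of the two parts add up to one less than that of `F`; the missing factor is
      -- the division by 1 - zV.
      have c5 : F.card + F.leaves - 2 =
        (p.1.card + p.1.leaves - 1) + (p.2.card + p.2.leaves - 1) := by omega
      have c6 := Shape.leaves_pos hp1
      -- A strictly positive power of 1 - zV remains at the diagonal term, which therefore
      -- disappears in the limit.
      have c7 : F.card + F.leaves - 2 ≠ 0 := by omega
      have t1 := ((hB1 p hp).tendsto w hw).mul ((hB2 p hp).tendsto w hw)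
      have t2 : Tendsto (fun z => (1 - z * V z) ^ (F.card + F.leaves - 2)) (𝓝[slitDisc ρ R] w)
          (𝓝 0) := by
        simpa [c7] using (h.tendsto_one_sub hw).pow (F.card + F.leaves - 2)
      have t3 : Tendsto (fun z : ℂ => if p.1 = p.2 then gen p.1 (z ^ 2) else 0)
          (𝓝[slitDisc ρ R] w) (𝓝 (if p.1 = p.2 then gen p.1 (w ^ 2) else 0)) := by
        split_ifs
        · exact (h.differentiableAt_gen_sq p.1
            ((h.norm_eq hw).trans_le h.lt.le)).continuousAt.tendsto.mono_left nhdsWithin_le_nhds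
        · exact tendsto_const_nhds
      refine (t1.add (t3.mul t2)).congr fun z => ?_
      rw [add_mul]
      congr 1
      rw [c5, pow_add]
      ring
    have hw0 := h.ne_zero_of_eq hw
    have t4 := ((tendsto_id' w).div_const 2).mul (tendsto_finsetSum _ hterm)
    -- With the diagonal terms gone, this is the recursion of the symmetry constant divided by w.
    have hlim : w / 2 * ∑ p ∈ Shape.properAntidiag F,
        ((symmetrySum p.1 : ℂ) / w * (symmetrySum p.2 / w) +
          (if p.1 = p.2 then gen p.1 (w ^ 2) else 0) * 0) = symmetrySum F / w := by
      rw [symmetrySum_of_forall_withTop_ne hF', symmetryProd_eq hF]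
      push_cast
      simp only [mul_zero, add_zero]
      rw [Finset.mul_sum, Finset.sum_div, Finset.sum_div]
      refine Finset.sum_congr rfl fun p _ => ?_
      field_simp
    rw [hlim] at t4
    refine t4.congr' ?_
    filter_upwards [self_mem_nhdsWithin] with z hz
    have h2 := h.ne_zero z hz
    have h3 := Shape.card_pos hF
    have h5 := Shape.leaves_pos hF
    have h4 : F.card + F.leaves - 1 = (F.card + F.leaves - 2) + 1 := by omega
    rw [h4, pow_succ, ← Finset.sum_mul]
    generalize 1 - z * V z = e at h2
    field_simp
    ring

theorem exists_isGenContinuation {F : Shape} (hF : F ≠ 0) :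
    ∃ A, IsGenContinuation ρ R V F A := by
  classical
  induction hn : F.card using Nat.strong_induction_on generalizing F with | _ n ih
  subst hn
  by_cases hF' : ∃ G, Shape.withTop G = F
  · obtain ⟨G, rfl⟩ := hF'
    by_cases hG : G = 0
    · subst hG; exact ⟨_, h.isGenContinuation_withTop_zero⟩
    obtain ⟨A, hA⟩ := ih G.card (by rw [Shape.card_withTop]; omega) hG rfl
    by_cases hG' : ∃ H, Shape.withTop H = G
    · obtain ⟨H, rfl⟩ := hG'
      refine ⟨_, h.isGenContinuation_withTop hG hA (differentiableOn_id.mul h.differentiableOn)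
        (fun w hw => h.tendsto_mul hw) fun z hz => ?_⟩
      rw [gen_withTop_withTop fun F => h.summable_restr hz F]
      change _ = z * V z * _
      rw [h.eq_gen z hz]
    · refine ⟨_, h.isGenContinuation_withTop hG hA (f := fun _ => 1) (differentiableOn_const 1)
        (fun w hw => tendsto_const_nhds) fun z hz => ?_⟩
      rw [gen_withTop_of_forall_withTop_ne (fun F => h.summable_restr hz F) hG
        fun H hH => hG' ⟨H, hH⟩, one_mul]
  · have hB (G : Shape) : ∃ A, G ≠ 0 → G.card < F.card → IsGenContinuation ρ R V G A := by
      by_cases hG : G ≠ 0 ∧ G.card < F.card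
      · obtain ⟨A, hA⟩ := ih G.card hG.2 hG.1 rfl
        exact ⟨A, fun _ _ => hA⟩
      · exact ⟨0, fun h1 h2 => absurd ⟨h1, h2⟩ hG⟩
    choose B hB using hB
    exact ⟨_, h.isGenContinuation_of_forall_withTop_ne hF (fun G hG => hF' ⟨G, hG⟩) hB⟩

/-- If V extended analytically by g, the identity theorem would give D = (1 - zg)² near w, so the
zero of D at w would be at least double, against D'(w) ≠ 0. -/
theorem not_exists_analyticAt {w : ℂ} (hw : w = ρ ∨ w = -ρ) :
    ¬ ∃ g : ℂ → ℂ, AnalyticAt ℂ g w ∧ V =ᶠ[𝓝[slitDisc ρ R] w] g := by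
  rintro ⟨g, hg, hVg⟩
  obtain ⟨D, hD, hD'⟩ := h.exists_sq_eq
  obtain ⟨ha, h0, hne⟩ := hD' w hw
  have := h.neBot hw
  have hu : AnalyticAt ℂ (fun z => 1 - z * g z) w := analyticAt_const.sub (analyticAt_id.mul hg)
  have hev : ∀ᶠ z in 𝓝[slitDisc ρ R] w, D z = (1 - z * g z) ^ 2 := by
    filter_upwards [hVg, self_mem_nhdsWithin] with z hz hz'
    rw [← hD z hz', hz]
  have hle : 𝓝[slitDisc ρ R] w ≤ 𝓝[≠] w :=
    nhdsWithin_mono w fun z hz hzw => not_mem_slitDisc hw (hzw ▸ hz)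
  have hev' : D =ᶠ[𝓝 w] fun z => (1 - z * g z) ^ 2 :=
    (ha.frequently_eq_iff_eventually_eq (hu.pow 2)).1 (hev.frequently.filter_mono hle)
  have hz0 : 1 - w * g w = 0 := by
    have := hev'.eq_of_nhds
    rw [h0] at this
    exact pow_eq_zero_iff two_ne_zero |>.1 this.symm
  refine hne ?_
  rw [hev'.deriv_eq]
  have h2 := hu.differentiableAt.hasDerivAt.pow 2
  have h3 : deriv (fun z => (1 - z * g z) ^ 2) w = _ := h2.deriv
  rw [h3]
  simp [hz0]

/-- An analytic extension would be bounded near w, and its product with a positive power of 1 - zV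
would tend to 0 instead of to the nonzero `symmetrySum F / w`. -/
theorem _root_.FinRootedTree.TreeClass.IsContinuation.IsGenContinuation.not_exists_analyticAt
    {F : Shape} (hF : F ≠ 0) (hc : symmetrySum F ≠ 0) {A : ℂ → ℂ}
    (hA : IsGenContinuation ρ R V F A) {w : ℂ} (hw : w = ρ ∨ w = -ρ) :
    ¬ ∃ g : ℂ → ℂ, AnalyticAt ℂ g w ∧ A =ᶠ[𝓝[slitDisc ρ R] w] g := by
  rintro ⟨g, hg, hAg⟩
  have := h.neBot hw
  have h1 := Shape.card_pos hF
  have h2 := Shape.leaves_pos hF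
  have t1 := (hg.continuousAt.tendsto.mono_left nhdsWithin_le_nhds).mul
    ((h.tendsto_one_sub hw).pow (F.card + F.leaves - 1))
  rw [zero_pow (by omega), mul_zero] at t1
  have t2 := t1.congr' (hAg.mono fun z hz => by rw [← hz])
  have := tendsto_nhds_unique t2 (hA.tendsto w hw)
  rw [eq_comm, div_eq_zero_iff] at this
  exact this.elim (by exact_mod_cast hc) (h.ne_zero_of_eq hw)

/-- Since zV → 1, the factor z^k V^(k+1) tends to 1/w for every k, so after multiplication by the
power of 1 - zV both sides have the same nonzero limit. -/
theorem _root_.FinRootedTree.TreeClass.IsContinuation.IsGenContinuation.isEquivalent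
    {F : Shape} (hF : F ≠ 0) (hc : symmetrySum F ≠ 0) {A : ℂ → ℂ}
    (hA : IsGenContinuation ρ R V F A) {w : ℂ} (hw : w = ρ ∨ w = -ρ) (u : ℕ) :
    Asymptotics.IsEquivalent (𝓝[slitDisc ρ R] w) A fun z =>
      (1 / (1 - z * V z)) ^ (F.card + F.leaves - 1) * z ^ (F.leaves + u - 1) *
        V z ^ (F.leaves + u) * (symmetrySum F : ℂ) := by
  have hw0 := h.ne_zero_of_eq hw
  have hc' : (symmetrySum F : ℂ) ≠ 0 := by exact_mod_cast hc
  have hV := h.tendsto_inv hw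
  have hVne := hV.eventually_ne (one_div_ne_zero hw0)
  have hzne : ∀ᶠ z in 𝓝[slitDisc ρ R] w, z ≠ 0 := (tendsto_id' w).eventually_ne hw0
  have hl := Shape.leaves_pos hF
  obtain ⟨k, hk⟩ : ∃ k, F.leaves + u = k + 1 := ⟨F.leaves + u - 1, by omega⟩
  rw [hk, Nat.add_sub_cancel]
  rw [Asymptotics.isEquivalent_iff_tendsto_one]
  · have t1 := (hA.tendsto w hw).div ((((tendsto_id' w).pow k).mul (hV.pow (k + 1))).mul_const
      (symmetrySum F : ℂ))
      (mul_ne_zero (mul_ne_zero (pow_ne_zero _ hw0) (pow_ne_zero _ (one_div_ne_zero hw0))) hc')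
    have hlim : (symmetrySum F : ℂ) / w / (w ^ k * (1 / w) ^ (k + 1) * symmetrySum F) = 1 := by
      rw [one_div, inv_pow]
      field_simp
      ring
    rw [hlim] at t1
    refine t1.congr' ?_
    filter_upwards [self_mem_nhdsWithin, hVne, hzne] with z hz hVz hz0
    have h2 := h.ne_zero z hz
    simp only [Pi.div_apply]
    rw [one_div, inv_pow]
    generalize 1 - z * V z = e at h2
    field_simp
  · filter_upwards [self_mem_nhdsWithin, hVne, hzne] with z hz hVz hz0
    have h2 := one_div_ne_zero (h.ne_zero z hz)
    exact mul_ne_zero (mul_ne_zero (mul_ne_zero (pow_ne_zero _ h2) (pow_ne_zero _ hz0))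
      (pow_ne_zero _ hVz)) hc'

end FinRootedTree.TreeClass.IsContinuation

/-! ### Identification with the counted objects -/

namespace FinRootedTree

namespace TreeClass

/-- The binary trees with `n` vertices and given marked vertices. -/
def BinaryClass (F : Shape) (n : ℕ) : Type :=
  {q : TreeClass // q.IsBinary ∧ q.shape = F ∧ q.size = n}

instance (F : Shape) (n : ℕ) : Finite (BinaryClass F n) :=
  ((finite_setOf_isBinary n).subset fun _ hq => ⟨hq.1, hq.2.2.le⟩ :
    {q : TreeClass | q.IsBinary ∧ q.shape = F ∧ q.size = n}.Finite).to_subtype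

theorem hasSum_card_binaryClass {z : ℂ} {F : Shape} (hS : Summable (restr (binaryWeight z) F)) :
    HasSum (fun n => (Nat.card (BinaryClass F n) : ℂ) * z ^ n) (gen F z) := by
  classical
  let P : Set TreeClass := {q | q.IsBinary ∧ q.shape = F}
  have h1 : HasSum (fun q : P => z ^ (q : TreeClass).size) (gen F z) := by
    refine (hasSum_subtype_iff_indicator (f := fun q : TreeClass => z ^ q.size) (s := P)).2 ?_
    have h0 : HasSum (restr (binaryWeight z) F) (gen F z) := hS.hasSum
    convert h0 using 1
    funext q
    simp only [Set.indicator, restr, binaryWeight, P, Set.mem_ofPred_eq]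
    split_ifs <;> simp_all
  refine HasSum.sigma
    (((Equiv.sigmaFiberEquiv fun q : P => (q : TreeClass).size).hasSum_iff).2 h1) fun n => ?_
  let e : {q : P // (q : TreeClass).size = n} ≃ BinaryClass F n :=
    ⟨fun q => ⟨q.1.1, q.1.2.1, q.1.2.2, q.2⟩, fun q => ⟨⟨q.1, q.2.1, q.2.2.1⟩, q.2.2.2⟩,
      fun _ => rfl, fun _ => rfl⟩
  have : Finite {q : P // (q : TreeClass).size = n} := Finite.of_equiv _ e.symm
  have := Fintype.ofFinite {q : P // (q : TreeClass).size = n}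
  rw [← Nat.card_congr e, Nat.card_eq_fintype_card]
  have h2 := hasSum_fintype fun q : {q : P // (q : TreeClass).size = n} => z ^ (q.1 : TreeClass).size
  have h3 : ∑ q : {q : P // (q : TreeClass).size = n}, z ^ (q.1 : TreeClass).size =
      (Fintype.card {q : P // (q : TreeClass).size = n} : ℂ) * z ^ n := by
    rw [Finset.sum_congr rfl fun q _ => by rw [q.2], Finset.sum_const, Finset.card_univ,
      nsmul_eq_mul]
  rw [h3] at h2
  exact h2

end TreeClass

open TreeClass

theorem NonplaneBinary.ext_orderIso {n : ℕ} {T T' : NonplaneBinary n}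
    (e : T.tree.Vertex ≃o T'.tree.Vertex) : T = T' := by
  rw [← Quotient.out_eq T, ← Quotient.out_eq T']
  exact Quotient.sound ⟨e⟩

theorem NonplaneBinary.exists_orderIso {n : ℕ} {T : FinRootedTree} (h : T.IsBinary)
    (hn : T.size = n) : ∃ T' : NonplaneBinary n, Nonempty (T'.tree.Vertex ≃o T.Vertex) :=
  ⟨Quotient.mk _ ⟨T, h, hn⟩, Quotient.mk_out (s := binarySetoid n) ⟨T, h, hn⟩⟩

theorem card_nonplaneBinary (n : ℕ) :
    Nat.card (NonplaneBinary n) = Nat.card (BinaryClass 0 n) := by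
  let f (T : NonplaneBinary n) : BinaryClass 0 n :=
    ⟨mk ⟨T.tree, ∅⟩, (Quotient.out T).2.1, (Shape.of_eq_zero_iff _).2 (Set.isEmpty_coe_sort.2 rfl),
      (Quotient.out T).2.2⟩
  refine Nat.card_eq_of_bijective f ⟨fun T T' h => ?_, ?_⟩
  · obtain ⟨φ, _⟩ := mk_eq_mk.1 (congrArg Subtype.val h)
    exact NonplaneBinary.ext_orderIso φ
  · rintro ⟨q, h1, h2, h3⟩
    obtain ⟨⟨T, E⟩, rfl⟩ := q.exists_mk
    obtain ⟨T', ⟨φ⟩⟩ := NonplaneBinary.exists_orderIso h1 h3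
    obtain rfl : E = ∅ := Set.isEmpty_coe_sort.1 ((Shape.of_eq_zero_iff _).1 h2)
    exact ⟨T', Subtype.ext (mk_eq_mk.2 ⟨φ, fun x => by simp⟩)⟩

instance (n : ℕ) : Finite (NonplaneBinary n) := by
  let f (T : NonplaneBinary n) : BinaryClass 0 n :=
    ⟨mk ⟨T.tree, ∅⟩, (Quotient.out T).2.1, (Shape.of_eq_zero_iff _).2 (Set.isEmpty_coe_sort.2 rfl),
      (Quotient.out T).2.2⟩
  refine Finite.of_injective f fun T T' h => ?_
  obtain ⟨φ, _⟩ := mk_eq_mk.1 (congrArg Subtype.val h)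
  exact NonplaneBinary.ext_orderIso φ

/-- A representative tree with an automorphism orbit of subsets is the same thing as an isomorphism
class of marked trees: representatives of distinct classes are not isomorphic, so isomorphisms
between such pairs are automorphisms of one tree. -/
theorem totalEmbeddings_eq (S : FinRootedTree) (n : ℕ) :
    S.totalEmbeddings n = Nat.card (BinaryClass (Shape.of S.Vertex) n) := by
  have := Fintype.ofFinite (NonplaneBinary n)
  rw [totalEmbeddings, finsum_eq_sum_of_fintype]
  simp only [numEmbeddings]
  rw [← Nat.card_sigma]
  let f (x : Σ T : NonplaneBinary n, Quotient (embeddingSetoid S T.tree)) :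
      BinaryClass (Shape.of S.Vertex) n :=
    Quotient.lift (s := embeddingSetoid S x.1.tree) (fun E : {E : Set x.1.tree.Vertex // Nonempty (E ≃o S.Vertex)} =>
      (⟨mk ⟨x.1.tree, E.1⟩, (Quotient.out x.1).2.1, Shape.of_eq_of.2 E.2, (Quotient.out x.1).2.2⟩ :
        BinaryClass (Shape.of S.Vertex) n)) (fun _ _ ⟨φ, h⟩ =>
      Subtype.ext (mk_eq_mk.2 ⟨φ, (image_eq_iff_forall_mem φ).1 h⟩)) x.2
  refine Nat.card_eq_of_bijective f ⟨?_, ?_⟩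
  · rintro ⟨T, e⟩ ⟨T', e'⟩ h
    obtain ⟨E, rfl⟩ := Quotient.exists_rep e
    obtain ⟨E', rfl⟩ := Quotient.exists_rep e'
    obtain ⟨φ, hφ⟩ := mk_eq_mk.1 (congrArg Subtype.val h)
    obtain rfl := NonplaneBinary.ext_orderIso φ
    exact congrArg (Sigma.mk T) (Quotient.sound ⟨φ, (image_eq_iff_forall_mem φ).2 hφ⟩)
  · rintro ⟨q, h1, h2, h3⟩
    obtain ⟨⟨T, E⟩, rfl⟩ := q.exists_mk
    obtain ⟨T', ⟨φ⟩⟩ := NonplaneBinary.exists_orderIso h1 h3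
    obtain ⟨e⟩ := Shape.of_eq_of.1 h2
    have hiso : MarkedIso (φ ⁻¹' E) E := ⟨φ, fun x => Iff.rfl⟩
    obtain ⟨e'⟩ := hiso.nonempty_orderIso
    exact ⟨⟨T', Quotient.mk _ ⟨φ ⁻¹' E, ⟨e'.trans e⟩⟩⟩, Subtype.ext (mk_eq_mk.2 hiso)⟩

theorem shape_vertex_eq_withTop : (S : FinRootedTree) →
    ∃ G, Shape.of S.Vertex = Shape.withTop G
  | .node _ child => ⟨Shape.of (Σ i, (child i).Vertex), rfl⟩

/-- On classes, `IsBinarization` does not require a marked root, because the recursion passes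
through forests. For a tree this is automatic: an unmarked root would split the marked poset into
two nonempty parts without a common maximum. -/
theorem top_mem_original_of_isBinarization {t : MarkedTree} {G : Shape}
    (h : (mk t).IsBinarization) (hG : (mk t).shape = Shape.withTop G) : ⊤ ∈ t.original := by
  obtain ⟨b, k, c, rfl⟩ := t.exists_eq_node
  cases b
  · exfalso
    obtain ⟨hk, hc⟩ := isBinarization_mk_node.1 h
    obtain rfl : k = 2 := hk
    rw [shape_mk_node, of_sigma_two] at hG
    rcases Shape.eq_zero_or_of_add_eq_withTop hG with h0 | h0
    · exact (hc 0).shape_ne_zero h0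
    · exact (hc 1).shape_ne_zero h0
  · exact (rfl : true = true)

theorem symmetryConstant_eq (S : FinRootedTree) :
    S.symmetryConstant = symmetrySum (Shape.of S.Vertex) := by
  classical
  let B : Set TreeClass := {q | q.IsBinarization ∧ q.shape = Shape.of S.Vertex}
  have hB : B.Finite :=
    (finite_setOf_isBinarization (Shape.of S.Vertex).card).subset fun q hq => ⟨hq.1, hq.2 ▸ le_rfl⟩
  let f (t : S.Binarization) : B :=
    ⟨mk (Quotient.out t).1, (Quotient.out t).2.2.2, Shape.of_eq_of.2 (Quotient.out t).2.2.1⟩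
  have hf : Function.Bijective f := by
    constructor
    · intro t t' h
      obtain ⟨φ, hφ⟩ := mk_eq_mk.1 (congrArg Subtype.val h)
      rw [← Quotient.out_eq t, ← Quotient.out_eq t']
      exact Quotient.sound ⟨φ, (image_eq_iff_forall_mem φ).2 hφ⟩
    · rintro ⟨q, h1, h2⟩
      obtain ⟨t, rfl⟩ := q.exists_mk
      obtain ⟨G, hG⟩ := shape_vertex_eq_withTop S
      let t' : {t : MarkedTree // S.IsBinarization t} :=
        ⟨t, top_mem_original_of_isBinarization h1 (h2.trans hG), Shape.of_eq_of.1 h2, h1⟩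
      refine ⟨Quotient.mk _ t', Subtype.ext (mk_eq_mk.2 ?_)⟩
      obtain ⟨φ, hφ⟩ := Quotient.mk_out (s := binarizationSetoid S) t'
      exact ⟨φ, (image_eq_iff_forall_mem φ).1 hφ⟩
  have := hB.to_subtype
  have : Finite S.Binarization := Finite.of_injective f hf.1
  have h1 : symmetrySum (Shape.of S.Vertex) = ∑' q : B, (1 / 2 : ℝ) ^ (q : TreeClass).symmetry := by
    rw [tsum_subtype B fun q : TreeClass => (1 / 2 : ℝ) ^ q.symmetry, symmetrySum, total]
    refine tsum_congr fun q => ?_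
    simp only [Set.indicator, restr, symmetryWeight, B, Set.mem_ofPred_eq]
    split_ifs <;> simp_all
  rw [h1, ← (Equiv.ofBijective f hf).tsum_eq, tsum_eq_finsum (Set.toFinite _)]
  rfl

end FinRootedTree

theorem mainTheorem8 :
    ∃ (ρ R : ℝ) (V : ℂ → ℂ),
      |ρ - 0.6346| < 0.00005 ∧
      HasDominantSingularities (fun n => Nat.card (FinRootedTree.NonplaneBinary n)) V ρ R ∧
      (∀ z : ℂ, ‖z‖ < ρ → V z = z + z / 2 * (V z ^ 2 + V (z ^ 2))) ∧
      ∀ (S : FinRootedTree) (m l u : ℕ),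
        m = S.size → l = S.degreeCount 0 → u = S.degreeCount 1 →
        ∃ A : ℂ → ℂ,
          HasDominantSingularities S.totalEmbeddings A ρ R ∧
          ∀ w : ℂ, w = ρ ∨ w = -ρ →
            Asymptotics.IsEquivalent (𝓝[slitDisc ρ R] w) A
              (fun z => (1 / (1 - z * V z)) ^ (m + l - 1) * z ^ (l + u - 1) * V z ^ (l + u) *
                (S.symmetryConstant : ℂ)) := by
  obtain ⟨ρ, R, V, hρ, h⟩ := TreeClass.exists_isContinuation
  refine ⟨ρ, R, V, hρ, ⟨h.pos, h.lt, fun z hz => ?_, h.differentiableOn,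
    h.not_exists_analyticAt (.inl rfl), h.not_exists_analyticAt (.inr rfl)⟩, fun z hz => ?_, ?_⟩
  · rw [h.eq_gen z hz]
    simp only [card_nonplaneBinary]
    exact TreeClass.hasSum_card_binaryClass (h.summable_restr hz 0)
  · have hz2 : ‖z ^ 2‖ < ρ := h.norm_sq_lt (hz.le.trans h.lt.le)
    rw [h.eq_gen z hz, h.eq_gen _ hz2]
    exact TreeClass.gen_zero fun F => h.summable_restr hz F
  · rintro S m l u rfl rfl -
    have hpos := TreeClass.symmetrySum_vertex_pos S
    have hF : Shape.of S.Vertex ≠ 0 := by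
      obtain ⟨G, hG⟩ := shape_vertex_eq_withTop S
      rw [hG]
      exact G.withTop_ne_zero
    obtain ⟨A, hA⟩ := h.exists_isGenContinuation hF
    refine ⟨A, ⟨h.pos, h.lt, fun z hz => ?_, hA.differentiableOn,
      hA.not_exists_analyticAt h hF hpos.ne' (.inl rfl),
      hA.not_exists_analyticAt h hF hpos.ne' (.inr rfl)⟩, fun w hw => ?_⟩
    · rw [hA.eq_gen z hz]
      simp only [totalEmbeddings_eq]
      exact TreeClass.hasSum_card_binaryClass (h.summable_restr hz _)
    · rw [symmetryConstant_eq]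
      exact hA.isEquivalent h hF hpos.ne' hw u
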